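/- Let $\mathcal{G}$ be the class of finite simple connected graphs whose adjacency matrix has, counted with multiplicity, exactly one eigenvalue $r>1$, exactly one eigenvalue $s<-1$, and all remaining eigenvalues equal to $1$ or $-1$. No two non-isomorphic graphs in $\mathcal{G}$ are cospectral: if $G,H\in\mathcal{G}$ are not isomorphic, then the multisets of eigenvalues (with multiplicities) of their adjacency matrices are different. -/

import Mathlib

/-- The adjacency spectrum of a finite graph: the multiset of eigenvalues of its real adjacency
matrix, that is, the roots of the characteristic polynomial with their multiplicities (the matrix
is real symmetric, so all its eigenvalues are real). -/
noncomputable def SimpleGraph.adjSpectrum {V : Type*} [Fintype V] [DecidableEq V]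
    (G : SimpleGraph V) [DecidableRel G.Adj] : Multiset ℝ :=
  (G.adjMatrix ℝ).charpoly.roots

/-- Two finite graphs are cospectral if their adjacency matrices have the same eigenvalues,
with the same multiplicities. -/
def SimpleGraph.Cospectral {V W : Type*} [Fintype V] [DecidableEq V] [Fintype W] [DecidableEq W]
    (G : SimpleGraph V) [DecidableRel G.Adj] (H : SimpleGraph W) [DecidableRel H.Adj] : Prop :=
  G.adjSpectrum = H.adjSpectrum

/-- The class `𝒢` of finite connected graphs whose adjacency matrix has, counted with
multiplicity, one eigenvalue `r > 1`, one eigenvalue `s < -1`, and all other eigenvalues equal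
to `1` or `-1`. -/
def SimpleGraph.InClassG {V : Type*} [Fintype V] [DecidableEq V]
    (G : SimpleGraph V) [DecidableRel G.Adj] : Prop :=
  G.Connected ∧ ∃ (r s : ℝ) (T : Multiset ℝ), 1 < r ∧ s < -1 ∧ (∀ x ∈ T, x = 1 ∨ x = -1) ∧
    G.adjSpectrum = r ::ₘ s ::ₘ T

/-!
Write `A` for the adjacency matrix of a graph in the class. The proof determines all graphs of the
class and observes that three spectral invariants tell them apart.

*What the spectrum gives.* The matrix `A² - 1` is positive semidefinite of rank two, so its
integral entries, `G.gram x y`, are the scalar products of vectors in a plane: all `3 × 3` minors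
vanish. Moreover `A + 1` is positive semidefinite but for one negative eigenvalue, and so is
`1 - A`. `PlanarSpectrum` collects these facts, and all later structural arguments use them alone.

*Local structure.* If a form with one negative direction is negative at `f`, and `e` is orthogonal
to `f` with nonpositive value, then `e` is in the radical (`mulVec_eq_zero_of_orthogonal_neg`).
Applied to `A + 1` and `1 - A` on small induced subgraphs this forces vertices to have the same
closed neighbourhood (`Twin`): of the three vertices of a triangle, two are twins. The graph is not
complete, so it has an induced path `u - c - w`; if `u` and `w` have further neighbours `a` and `b`
that are adjacent to no other vertex of the path, the five vertices form a `Fork`.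

*Without forks* the graph contains no induced path on four vertices, hence it is the join of two
disjoint unions of cliques (`exists_isCliqueJoin`). The vanishing minors become equations for the
clique sizes, solved in `join_cases`.

*With a fork* the vertices `a, u, w, b` form a `Frame`: `a, b` have the same other neighbours, and
so have `u, w`. The vectors of `a` and `u` are orthogonal, so every scalar product is computed from
those with `a` and `u`, that is, from numbers of neighbours in `common a b` and `common u w`.
Applied to a vertex with itself and to pairs of vertices this gives Diophantine equations with few
solutions (`far_degIn`, `common_cases`, `card_matched`, `full_relation`, `full_pair`), and these
determine the graph up to isomorphism (`isBlowup_hub`, `isBlowup_crown`, `isBlowup_block`).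

*Comparison.* Every graph of the class is a blow-up of an explicit pattern (`exists_shape`). The
traces of `(A + 1)^k` for `k = 0, 2, 3` are polynomials in the parameters, and they are equal for
two members of the list only if these are the same (`Shape.eq_of_invariants`).
-/

set_option linter.unusedSectionVars false

/-! ### The spectral decomposition of the adjacency matrix -/

namespace SimpleGraph

open Matrix Finset

variable {V : Type*} [Fintype V] [DecidableEq V]

/-- Entrywise spectral theorem for a real symmetric matrix, with the eigenvalues listed as the
roots of the characteristic polynomial. -/
theorem exists_orthogonal_diagonalization (A : Matrix V V ℝ) (hA : A.IsSymm) :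
    ∃ (U : Matrix V V ℝ) (ev : V → ℝ), U * Uᵀ = 1 ∧ Uᵀ * U = 1 ∧ A = U * diagonal ev * Uᵀ ∧
      A.charpoly.roots = univ.val.map ev := by
  have hH : A.IsHermitian := by
    rw [Matrix.IsHermitian, conjTranspose_eq_transpose_of_trivial]; exact hA
  refine ⟨(hH.eigenvectorUnitary : Matrix V V ℝ), hH.eigenvalues, ?_, ?_, ?_, ?_⟩
  · have := Unitary.coe_mul_star_self hH.eigenvectorUnitary
    rwa [Unitary.coe_star, star_eq_conjTranspose, conjTranspose_eq_transpose_of_trivial] at this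
  · have := Unitary.coe_star_mul_self hH.eigenvectorUnitary
    rwa [star_eq_conjTranspose, conjTranspose_eq_transpose_of_trivial] at this
  · have := hH.spectral_theorem
    rw [Unitary.conjStarAlgAut_apply] at this
    rw [star_eq_conjTranspose, conjTranspose_eq_transpose_of_trivial] at this
    exact this
  · simpa using hH.roots_charpoly_eq_eigenvalues

/-- Power sums of the shifted eigenvalues are traces of powers of the shifted matrix. -/
theorem trace_add_one_pow (A : Matrix V V ℝ) (hA : A.IsSymm) (k : ℕ) :
    ((A + 1) ^ k).trace = (A.charpoly.roots.map fun x => (x + 1) ^ k).sum := by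
  obtain ⟨U, ev, h1, h2, h3, h4⟩ := exists_orthogonal_diagonalization A hA
  have h5 : A + 1 = U * diagonal (fun i => ev i + 1) * Uᵀ := by
    have : diagonal (fun i => ev i + 1) = diagonal ev + (1 : Matrix V V ℝ) := by
      rw [← diagonal_one, diagonal_add]
    rw [this, Matrix.mul_add, Matrix.add_mul, Matrix.mul_one, h1, ← h3]
  have h6 : ∀ k : ℕ, (A + 1) ^ k = U * diagonal (fun i => (ev i + 1) ^ k) * Uᵀ := by
    intro k
    induction k with
    | zero => simp [h1]
    | succ k ih =>
      rw [pow_succ, ih, h5]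
      have : U * diagonal (fun i => (ev i + 1) ^ k) * Uᵀ * (U * diagonal (fun i => ev i + 1) * Uᵀ)
          = U * diagonal (fun i => (ev i + 1) ^ k) * (Uᵀ * U) *
            diagonal (fun i => ev i + 1) * Uᵀ := by
        simp only [Matrix.mul_assoc]
      rw [this, h2, Matrix.mul_one, Matrix.mul_assoc U, diagonal_mul_diagonal]
      simp only [pow_succ]
  rw [h6, trace_mul_comm, ← Matrix.mul_assoc, h2, Matrix.one_mul, trace_diagonal, h4,
    Multiset.map_map]
  rfl

variable (G : SimpleGraph V) [DecidableRel G.Adj]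

/-- The consequences of membership in `𝒢` from which everything else is derived: `A² - 1` is the
Gram matrix of vectors `(f x, g x)` of the plane, while `A + 1` and `1 - A` become positive
semidefinite after adding a matrix of rank one, and `A + 1` itself is not positive semidefinite. -/
structure PlanarSpectrum : Prop where
  conn : G.Connected
  gram : ∃ f g : V → ℝ, ∀ x y,
    (G.adjMatrix ℝ * G.adjMatrix ℝ - 1) x y = f x * f y + g x * g y
  plus : ∃ h : V → ℝ, ∀ ξ : V → ℝ, 0 ≤ ξ ⬝ᵥ ((G.adjMatrix ℝ + 1) *ᵥ ξ) + (h ⬝ᵥ ξ) ^ 2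
  minus : ∃ h : V → ℝ, ∀ ξ : V → ℝ, 0 ≤ ξ ⬝ᵥ ((1 - G.adjMatrix ℝ) *ᵥ ξ) + (h ⬝ᵥ ξ) ^ 2
  neg : ∃ ξ : V → ℝ, ξ ⬝ᵥ ((G.adjMatrix ℝ + 1) *ᵥ ξ) < 0

theorem conj_diagonal_apply (U : Matrix V V ℝ) (d : V → ℝ) (x y : V) :
    (U * diagonal d * Uᵀ) x y = ∑ i, d i * (U x i * U y i) := by
  rw [Matrix.mul_apply]
  refine sum_congr rfl fun i _ => ?_
  rw [mul_diagonal, transpose_apply]; ring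

theorem dotProduct_conj_diagonal (U : Matrix V V ℝ) (d ξ : V → ℝ) :
    ξ ⬝ᵥ ((U * diagonal d * Uᵀ) *ᵥ ξ) = ∑ i, d i * (Uᵀ *ᵥ ξ) i ^ 2 := by
  rw [← mulVec_mulVec, ← mulVec_mulVec, dotProduct_mulVec, ← mulVec_transpose]
  simp only [dotProduct, mulVec_diagonal]
  exact sum_congr rfl fun i _ => by ring

variable {G}

/-- The planar vectors have as coordinates the entries of the eigenvectors for `r` and `s`, scaled
by `√(r² - 1)` and `√(s² - 1)`; all other eigenvalues of `A² - 1` are zero. -/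
theorem InClassG.planarSpectrum (hG : G.InClassG) : G.PlanarSpectrum := by
  obtain ⟨hc, r, s, T, hr, hs, hT, hspec⟩ := hG
  have hsymm : (G.adjMatrix ℝ).IsSymm := G.isSymm_adjMatrix
  obtain ⟨U, ev, h1, h2, h3, h4⟩ := exists_orthogonal_diagonalization _ hsymm
  rw [adjSpectrum, h4] at hspec
  obtain ⟨i, -, hi⟩ : ∃ i ∈ (univ : Finset V).val, ev i = r := by
    rw [← Multiset.mem_map, hspec]; simp
  have e1 : (univ : Finset V).val = i ::ₘ (univ.erase i).val := by
    rw [erase_val, Multiset.cons_erase]; simp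
  rw [e1, Multiset.map_cons, hi, Multiset.cons_inj_right] at hspec
  obtain ⟨j, hj', hj⟩ : ∃ j ∈ (univ.erase i : Finset V).val, ev j = s := by
    rw [← Multiset.mem_map, hspec]; simp
  have hji : j ≠ i := (mem_erase.mp (mem_def.mpr hj')).1
  have e2 : (univ.erase i : Finset V).val = j ::ₘ ((univ.erase i).erase j).val := by
    rw [erase_val (univ.erase i) j, Multiset.cons_erase hj']
  rw [e2, Multiset.map_cons, hj, Multiset.cons_inj_right] at hspec
  have hrest : ∀ k, k ≠ i → k ≠ j → ev k = 1 ∨ ev k = -1 := by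
    intro k hk hk'
    apply hT
    rw [← hspec, Multiset.mem_map]
    exact ⟨k, mem_def.mp (mem_erase.mpr ⟨hk', mem_erase.mpr ⟨hk, mem_univ k⟩⟩), rfl⟩
  have hid : ∀ a : ℝ, (a • 1 : Matrix V V ℝ) = U * diagonal (fun _ => a) * Uᵀ := by
    intro a
    have : (diagonal (fun _ => a) : Matrix V V ℝ) = a • 1 := by
      rw [← diagonal_one, ← diagonal_smul]; congr 1; ext; simp
    rw [this, Matrix.mul_smul, Matrix.smul_mul, Matrix.mul_one, h1]
  have hplus : G.adjMatrix ℝ + 1 = U * diagonal (fun k => ev k + 1) * Uᵀ := by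
    have := hid 1
    rw [one_smul] at this
    rw [this]
    conv_lhs => rw [h3]
    rw [← Matrix.add_mul, ← Matrix.mul_add, diagonal_add]
  have hminus : 1 - G.adjMatrix ℝ = U * diagonal (fun k => 1 - ev k) * Uᵀ := by
    have := hid 1
    rw [one_smul] at this
    rw [this]
    conv_lhs => rw [h3]
    rw [← Matrix.sub_mul, ← Matrix.mul_sub, diagonal_sub]
  have hgram : G.adjMatrix ℝ * G.adjMatrix ℝ - 1 = U * diagonal (fun k => ev k ^ 2 - 1) * Uᵀ := by
    have h := hid 1
    rw [one_smul] at h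
    have h' : G.adjMatrix ℝ * G.adjMatrix ℝ = U * diagonal (fun k => ev k ^ 2) * Uᵀ := by
      conv_lhs => rw [h3]
      have : U * diagonal ev * Uᵀ * (U * diagonal ev * Uᵀ)
          = U * diagonal ev * (Uᵀ * U) * diagonal ev * Uᵀ := by simp only [Matrix.mul_assoc]
      rw [this, h2, Matrix.mul_one, Matrix.mul_assoc U, diagonal_mul_diagonal]
      simp only [pow_two]
    rw [h', h, ← Matrix.sub_mul, ← Matrix.mul_sub, diagonal_sub]
  have hdot : ∀ (k : V) (c : ℝ) (ξ : V → ℝ), ((fun x => c * U x k) ⬝ᵥ ξ) = c * (Uᵀ *ᵥ ξ) k := by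
    intro k c ξ
    simp only [dotProduct, mulVec, transpose_apply, mul_sum, mul_assoc]
  refine ⟨hc, ⟨fun x => √(r ^ 2 - 1) * U x i, fun x => √(s ^ 2 - 1) * U x j, fun x y => ?_⟩,
    ⟨fun x => √(-(s + 1)) * U x j, fun ξ => ?_⟩, ⟨fun x => √(r - 1) * U x i, fun ξ => ?_⟩,
    ⟨fun x => U x j, ?_⟩⟩
  · rw [hgram, conj_diagonal_apply, ← add_sum_erase _ _ (mem_univ i),
      ← add_sum_erase (univ.erase i) _ (by simp [hji] : j ∈ univ.erase i), sum_eq_zero, hi, hj]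
    · have q1 : √(r ^ 2 - 1) ^ 2 = r ^ 2 - 1 := Real.sq_sqrt (by nlinarith)
      have q2 : √(s ^ 2 - 1) ^ 2 = s ^ 2 - 1 := Real.sq_sqrt (by nlinarith)
      linear_combination (-(U x i * U y i)) * q1 - U x j * U y j * q2
    · intro k hk
      simp only [mem_erase, mem_univ, and_true] at hk
      rcases hrest k hk.2 hk.1 with h | h <;> rw [h] <;> ring
  · rw [hplus, dotProduct_conj_diagonal, hdot, mul_pow, Real.sq_sqrt (by linarith),
      ← add_sum_erase _ _ (mem_univ j), hj]
    have : 0 ≤ ∑ k ∈ univ.erase j, (ev k + 1) * (Uᵀ *ᵥ ξ) k ^ 2 := by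
      refine sum_nonneg fun k hk => mul_nonneg ?_ (sq_nonneg _)
      simp only [mem_erase, mem_univ, and_true] at hk
      by_cases hki : k = i
      · rw [hki, hi]; linarith
      · rcases hrest k hki hk with h | h <;> rw [h] <;> norm_num
    linarith
  · rw [hminus, dotProduct_conj_diagonal, hdot, mul_pow, Real.sq_sqrt (by linarith),
      ← add_sum_erase _ _ (mem_univ i), hi]
    have : 0 ≤ ∑ k ∈ univ.erase i, (1 - ev k) * (Uᵀ *ᵥ ξ) k ^ 2 := by
      refine sum_nonneg fun k hk => mul_nonneg ?_ (sq_nonneg _)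
      simp only [mem_erase, mem_univ, and_true] at hk
      by_cases hkj : k = j
      · rw [hkj, hj]; linarith
      · rcases hrest k hk hkj with h | h <;> rw [h] <;> norm_num
    linarith
  · rw [hplus, dotProduct_conj_diagonal]
    have hu : ∀ k, (Uᵀ *ᵥ fun x => U x j) k = if k = j then 1 else 0 := by
      intro k
      have := congrFun (congrFun h2 k) j
      rw [Matrix.mul_apply, Matrix.one_apply] at this
      exact this
    simp only [hu]
    rw [sum_eq_single j]
    · simp [hj]; linarith
    · intro k _ hk; simp [hk]
    · simp

end SimpleGraph

/-! ### Local structure forced by the spectrum -/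

namespace SimpleGraph

open Matrix Finset

variable {V : Type*} [Fintype V] [DecidableEq V]

/-- A quadratic form with only one negative direction: if it is negative at `f`, then a vector `e`
orthogonal to `f` on which the form is nonpositive lies in the radical. -/
theorem mulVec_eq_zero_of_orthogonal_neg (Q : Matrix V V ℝ) (hQ : Q.IsSymm) (h : V → ℝ)
    (hpos : ∀ ξ : V → ℝ, 0 ≤ ξ ⬝ᵥ (Q *ᵥ ξ) + (h ⬝ᵥ ξ) ^ 2) (f e : V → ℝ)
    (hf : f ⬝ᵥ (Q *ᵥ f) < 0) (hfe : f ⬝ᵥ (Q *ᵥ e) = 0) (he : e ⬝ᵥ (Q *ᵥ e) ≤ 0) :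
    Q *ᵥ e = 0 := by
  have hsymm : ∀ a b : V → ℝ, a ⬝ᵥ (Q *ᵥ b) = b ⬝ᵥ (Q *ᵥ a) := by
    intro a b
    rw [dotProduct_mulVec, dotProduct_comm, ← mulVec_transpose, hQ.eq]
  have hhf : h ⬝ᵥ f ≠ 0 := by
    intro h0
    have := hpos f
    rw [h0] at this
    linarith
  -- correct an arbitrary vector by a multiple of `f` so that `h` vanishes on it
  have key : ∀ ξ : V → ℝ, f ⬝ᵥ (Q *ᵥ ξ) = 0 → 0 ≤ ξ ⬝ᵥ (Q *ᵥ ξ) + ((h ⬝ᵥ ξ) / (h ⬝ᵥ f)) ^ 2 *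
      (f ⬝ᵥ (Q *ᵥ f)) := by
    intro ξ hξ
    have := hpos (ξ - ((h ⬝ᵥ ξ) / (h ⬝ᵥ f)) • f)
    simp only [mulVec_sub, mulVec_smul, dotProduct_sub, sub_dotProduct, dotProduct_smul,
      smul_dotProduct, smul_eq_mul, hsymm ξ f, hξ] at this
    rw [div_mul_cancel₀ _ hhf, sub_self] at this
    nlinarith
  have hall : ∀ ξ : V → ℝ, f ⬝ᵥ (Q *ᵥ ξ) = 0 → 0 ≤ ξ ⬝ᵥ (Q *ᵥ ξ) := by
    intro ξ hξ
    have := key ξ hξ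
    nlinarith [sq_nonneg ((h ⬝ᵥ ξ) / (h ⬝ᵥ f))]
  have hee : e ⬝ᵥ (Q *ᵥ e) = 0 := le_antisymm he (hall e hfe)
  have hfin : ∀ y : V → ℝ, f ⬝ᵥ (Q *ᵥ y) = 0 → y ⬝ᵥ (Q *ᵥ e) = 0 := by
    intro y hy
    by_contra hne
    have := hall (y - ((y ⬝ᵥ (Q *ᵥ y) + 1) / (2 * (y ⬝ᵥ (Q *ᵥ e)))) • e) (by
      simp [mulVec_sub, mulVec_smul, dotProduct_sub, hy, hfe])
    simp only [mulVec_sub, mulVec_smul, dotProduct_sub, sub_dotProduct, dotProduct_smul,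
      smul_dotProduct, smul_eq_mul, hsymm e y, hee] at this
    have h2 : (y ⬝ᵥ (Q *ᵥ y) + 1) / (2 * (y ⬝ᵥ (Q *ᵥ e))) * (y ⬝ᵥ (Q *ᵥ e))
        = (y ⬝ᵥ (Q *ᵥ y) + 1) / 2 := by field_simp
    rw [h2] at this
    linarith
  have : ∀ y : V → ℝ, y ⬝ᵥ (Q *ᵥ e) = 0 := by
    intro y
    have := hfin (y - ((f ⬝ᵥ (Q *ᵥ y)) / (f ⬝ᵥ (Q *ᵥ f))) • f) (by
      simp only [mulVec_sub, mulVec_smul, dotProduct_sub, dotProduct_smul, smul_eq_mul]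
      rw [div_mul_cancel₀ _ hf.ne, sub_self])
    simpa [sub_dotProduct, hfe] using this
  ext x
  simpa using this (Pi.single x 1)

/-- Equality of closed neighbourhoods. -/
def Twin {V : Type*} (G : SimpleGraph V) (x y : V) : Prop :=
  ∀ z, (z = x ∨ G.Adj x z) ↔ (z = y ∨ G.Adj y z)

theorem Twin.refl {V : Type*} (G : SimpleGraph V) (x : V) : G.Twin x x := fun _ => Iff.rfl

theorem Twin.symm {V : Type*} {G : SimpleGraph V} {x y : V} (h : G.Twin x y) : G.Twin y x :=
  fun z => (h z).symm

theorem Twin.trans {V : Type*} {G : SimpleGraph V} {x y z : V} (h : G.Twin x y)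
    (h' : G.Twin y z) : G.Twin x z := fun w => (h w).trans (h' w)

theorem Twin.adj {V : Type*} {G : SimpleGraph V} {x y : V} (h : G.Twin x y) (hne : x ≠ y) :
    G.Adj x y := ((h y).mpr (Or.inl rfl)).resolve_left hne.symm

theorem Twin.adj_of_adj {V : Type*} {G : SimpleGraph V} {x y z : V} (h : G.Twin x y)
    (hz : G.Adj x z) (hne : z ≠ y) : G.Adj y z := ((h z).mp (Or.inr hz)).resolve_left hne

/-- The entries of `A² - 1`: the number of common neighbours of two distinct vertices, and one less
than the degree on the diagonal. -/
def gram (G : SimpleGraph V) [DecidableRel G.Adj] (x y : V) : ℤ :=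
  #{z | G.Adj x z ∧ G.Adj y z} - if x = y then 1 else 0

variable {G : SimpleGraph V} [DecidableRel G.Adj]

theorem gram_comm (x y : V) : G.gram x y = G.gram y x := by
  simp only [gram, and_comm, eq_comm]

theorem gram_self (x : V) : G.gram x x = #{z | G.Adj x z} - 1 := by
  simp [gram]

theorem gram_of_ne {x y : V} (h : x ≠ y) : G.gram x y = #{z | G.Adj x z ∧ G.Adj y z} := by
  simp [gram, h]

theorem gram_pos {x y z : V} (h : x ≠ y) (hx : G.Adj x z) (hy : G.Adj y z) : 0 < G.gram x y := by
  rw [gram_of_ne h]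
  exact_mod_cast card_pos.mpr ⟨z, by simp [hx, hy]⟩

theorem cast_gram (x y : V) :
    ((G.gram x y : ℤ) : ℝ) = (G.adjMatrix ℝ * G.adjMatrix ℝ - 1) x y := by
  rw [Matrix.sub_apply, Matrix.mul_apply, Matrix.one_apply, gram, card_filter]
  push_cast
  congr 1
  refine sum_congr rfl fun z _ => ?_
  simp only [adjMatrix_apply, G.adj_comm z y]
  by_cases h1 : G.Adj x z <;> by_cases h2 : G.Adj y z <;> simp [h1, h2]

/-- In a connected graph a nonempty set closed under adjacency contains every vertex. -/
theorem Connected.mem_of_closed {W : Type*} {G : SimpleGraph W} (hG : G.Connected) (S : Set W)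
    {x : W} (hx : x ∈ S) (hS : ∀ y ∈ S, ∀ z, G.Adj y z → z ∈ S) (y : W) : y ∈ S := by
  obtain ⟨p⟩ := hG.preconnected x y
  induction p with
  | nil => exact hx
  | cons h _ ih => exact ih (hS _ hx _ h)

/-- `u - c - w` is an induced path. -/
structure IndPath {W : Type*} (G : SimpleGraph W) (u c w : W) : Prop where
  huc : G.Adj u c
  hcw : G.Adj c w
  ne : u ≠ w
  nadj : ¬ G.Adj u w

theorem IndPath.symm {W : Type*} {G : SimpleGraph W} {u c w : W} (h : G.IndPath u c w) :
    G.IndPath w c u := ⟨h.hcw.symm, h.huc.symm, h.ne.symm, fun h' => h.nadj h'.symm⟩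

namespace PlanarSpectrum

variable (H : G.PlanarSpectrum)
include H

/-- All minors of order three of `A² - 1` vanish. -/
theorem minor (a d x b e y : V) :
    G.gram a b * (G.gram d e * G.gram x y - G.gram d y * G.gram x e)
      - G.gram a e * (G.gram d b * G.gram x y - G.gram d y * G.gram x b)
      + G.gram a y * (G.gram d b * G.gram x e - G.gram d e * G.gram x b) = 0 := by
  obtain ⟨f, g, hfg⟩ := H.gram
  have : ∀ x y, ((G.gram x y : ℤ) : ℝ) = f x * f y + g x * g y := fun x y => by
    rw [cast_gram, hfg]
  have h : ((G.gram a b * (G.gram d e * G.gram x y - G.gram d y * G.gram x e)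
      - G.gram a e * (G.gram d b * G.gram x y - G.gram d y * G.gram x b)
      + G.gram a y * (G.gram d b * G.gram x e - G.gram d e * G.gram x b) : ℤ) : ℝ) = 0 := by
    push_cast
    simp only [this]
    ring
  exact_mod_cast h

/-- Expansion of a scalar product along an orthogonal pair of vectors of the plane. -/
theorem gram_expand {a d : V} (h : G.gram a d = 0) (x y : V) :
    G.gram a a * G.gram d d * G.gram x y =
      G.gram d d * (G.gram x a * G.gram y a) + G.gram a a * (G.gram x d * G.gram y d) := by
  have := H.minor a d x a d y
  rw [gram_comm d a, h, gram_comm a y, gram_comm d y] at this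
  linear_combination this

theorem gram_self_nonneg (x : V) : 0 ≤ G.gram x x := by
  obtain ⟨f, g, hfg⟩ := H.gram
  have h : (0 : ℝ) ≤ ((G.gram x x : ℤ) : ℝ) := by
    rw [cast_gram, hfg]
    nlinarith [sq_nonneg (f x), sq_nonneg (g x)]
  exact_mod_cast h

theorem gram_sq_le (x y : V) : G.gram x y ^ 2 ≤ G.gram x x * G.gram y y := by
  obtain ⟨f, g, hfg⟩ := H.gram
  have : ∀ x y, ((G.gram x y : ℤ) : ℝ) = f x * f y + g x * g y := fun x y => by
    rw [cast_gram, hfg]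
  have h : (((G.gram x y ^ 2 : ℤ)) : ℝ) ≤ ((G.gram x x * G.gram y y : ℤ) : ℝ) := by
    push_cast
    simp only [this]
    nlinarith [sq_nonneg (f x * g y - g x * f y)]
  exact_mod_cast h

/-- The form `A + 1` is negative at `u - c + w` for an induced path `u - c - w`. -/
theorem plus_radical {u c w : V} (hP : G.IndPath u c w) (e : V → ℝ)
    (hfe : ((G.adjMatrix ℝ + 1) *ᵥ e) u - ((G.adjMatrix ℝ + 1) *ᵥ e) c
      + ((G.adjMatrix ℝ + 1) *ᵥ e) w = 0)
    (he : e ⬝ᵥ ((G.adjMatrix ℝ + 1) *ᵥ e) ≤ 0) : (G.adjMatrix ℝ + 1) *ᵥ e = 0 := by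
  obtain ⟨h, hh⟩ := H.plus
  have hs : (G.adjMatrix ℝ + 1).IsSymm := by
    rw [Matrix.IsSymm, transpose_add, transpose_one, transpose_adjMatrix]
  refine mulVec_eq_zero_of_orthogonal_neg _ hs h hh
    (Pi.single u 1 - Pi.single c 1 + Pi.single w 1) e ?_ ?_ he
  · obtain ⟨h1, h2, h3, h4⟩ := hP
    have h5 : ¬ G.Adj w u := fun h => h4 h.symm
    simp [mulVec_add, mulVec_sub, add_dotProduct, sub_dotProduct, 
      h1, h2, h1.symm, h2.symm, h1.ne, h2.ne, h1.ne', h2.ne', h3, h3.symm, h4, h5]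
  · simpa [add_dotProduct, sub_dotProduct] using hfe

/-- The form `1 - A` is negative at `u + c + w` for an induced path `u - c - w`. -/
theorem minus_radical {u c w : V} (hP : G.IndPath u c w) (e : V → ℝ)
    (hfe : ((1 - G.adjMatrix ℝ) *ᵥ e) u + ((1 - G.adjMatrix ℝ) *ᵥ e) c
      + ((1 - G.adjMatrix ℝ) *ᵥ e) w = 0)
    (he : e ⬝ᵥ ((1 - G.adjMatrix ℝ) *ᵥ e) ≤ 0) : (1 - G.adjMatrix ℝ) *ᵥ e = 0 := by
  obtain ⟨h, hh⟩ := H.minus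
  have hs : (1 - G.adjMatrix ℝ).IsSymm := by
    rw [Matrix.IsSymm, transpose_sub, transpose_one, transpose_adjMatrix]
  refine mulVec_eq_zero_of_orthogonal_neg _ hs h hh
    (Pi.single u 1 + Pi.single c 1 + Pi.single w 1) e ?_ ?_ he
  · obtain ⟨h1, h2, h3, h4⟩ := hP
    have h5 : ¬ G.Adj w u := fun h => h4 h.symm
    simp [mulVec_add, add_dotProduct, 
      h1, h2, h1.symm, h2.symm, h1.ne, h2.ne, h1.ne', h2.ne', h3, h3.symm, h4, h5]
  · simpa [add_dotProduct] using hfe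

/-- The graph is not complete, since `A + 1` is not positive semidefinite. -/
theorem exists_indPath : ∃ u c w, G.IndPath u c w := by
  by_contra! hno
  have htrans : ∀ x y z, G.Adj x y → G.Adj y z → x ≠ z → G.Adj x z := by
    intro x y z h1 h2 h3
    by_contra h4
    exact hno x y z ⟨h1, h2, h3, h4⟩
  have hall : ∀ x y, x ≠ y → G.Adj x y := by
    intro x y hxy
    have := H.conn.mem_of_closed {y | y = x ∨ G.Adj x y} (x := x) (Or.inl rfl) (by
      rintro y (rfl | hy) z hz
      · exact Or.inr hz
      · by_cases hxz : x = z
        · exact Or.inl hxz.symm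
        · exact Or.inr (htrans x y z hy hz hxz)) y
    exact this.resolve_left hxy.symm
  obtain ⟨ξ, hξ⟩ := H.neg
  have : (G.adjMatrix ℝ + 1) *ᵥ ξ = fun _ => ∑ y, ξ y := by
    ext x
    simp only [mulVec, dotProduct]
    refine sum_congr rfl fun y _ => ?_
    by_cases hxy : x = y
    · simp [hxy]
    · simp [hxy, hall x y hxy]
  rw [this] at hξ
  simp only [dotProduct, ← sum_mul] at hξ
  nlinarith

/-- The planar vector of `x` is not zero: otherwise `x` would have no common neighbour with any
other vertex, although it has degree one, and the graph would be a single edge. -/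
theorem gram_self_pos (x : V) : 0 < G.gram x x := by
  by_contra hx
  have h0 : ∀ y, G.gram x y = 0 := by
    intro y
    have := H.gram_sq_le x y
    have h1 := H.gram_self_nonneg x
    have h2 : G.gram x x = 0 := by omega
    rw [h2] at this
    nlinarith [sq_nonneg (G.gram x y)]
  have hdeg : #{z | G.Adj x z} = 1 := by
    have := h0 x
    rw [gram_self] at this
    omega
  obtain ⟨y, hy⟩ := card_eq_one.mp hdeg
  have hxy : ∀ z, G.Adj x z ↔ z = y := by
    intro z
    have := Finset.ext_iff.mp hy z
    simpa using this
  have hclosed := H.conn.mem_of_closed {z | z = x ∨ z = y} (x := x) (Or.inl rfl) (by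
    rintro z (rfl | rfl) w hw
    · exact Or.inr ((hxy w).mp hw)
    · by_contra hne
      have hwx : x ≠ w := fun h => hne (Or.inl h.symm)
      exact (gram_pos hwx ((hxy z).mpr rfl) hw.symm).ne' (h0 w))
  obtain ⟨u, c, w, hP⟩ := H.exists_indPath
  have h1 := hP.huc.ne
  have h2 := hP.hcw.ne
  have h3 := hP.ne
  rcases hclosed u with h | h <;> rcases hclosed c with h' | h' <;>
    rcases hclosed w with h'' | h'' <;> simp_all

/-- A vertex adjacent to the first two vertices of an induced path, but not to the third, is a
twin of the first. -/
theorem twin_left {u c w z : V} (hP : G.IndPath u c w) (hzu : G.Adj z u) (hzc : G.Adj z c)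
    (hzw : ¬ G.Adj z w) : G.Twin z u := by
  have hzw' : z ≠ w := fun h => hP.nadj (h ▸ hzu.symm)
  have h := H.plus_radical hP (Pi.single z 1 - Pi.single u 1) (by
    simp [mulVec_sub, hzu.symm, hzu.ne', hzc.symm, hzc.ne', hzw'.symm, hP.huc.symm, hP.huc.ne',
      hP.ne.symm, hP.nadj, G.adj_comm w z, G.adj_comm w u, hzw]) (by
    simp [mulVec_sub, sub_dotProduct, hzu, hzu.symm, hzu.ne, hzu.ne'])
  intro y
  have hy := congrFun h y
  simp only [mulVec_sub, mulVec_single_one, Pi.sub_apply, col_apply, Matrix.add_apply,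
    adjMatrix_apply, Matrix.one_apply, Pi.zero_apply] at hy
  by_cases h1 : y = z <;> by_cases h2 : y = u <;> by_cases h3 : G.Adj z y <;>
    by_cases h4 : G.Adj u y <;> simp_all [G.adj_comm]

/-- A vertex adjacent to all three vertices of an induced path is a twin of the middle one. -/
theorem twin_mid {u c w z : V} (hP : G.IndPath u c w) (hzu : G.Adj z u) (hzc : G.Adj z c)
    (hzw : G.Adj z w) : G.Twin z c := by
  have h := H.plus_radical hP (Pi.single z 1 - Pi.single c 1) (by
    simp [mulVec_sub, hzu.symm, hzu.ne', hzc.symm, hzc.ne', hzw.symm, hzw.ne', hP.huc, hP.huc.ne,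
      hP.hcw.symm, hP.hcw.ne']) (by
    simp [mulVec_sub, sub_dotProduct, hzc, hzc.symm, hzc.ne, hzc.ne'])
  intro y
  have hy := congrFun h y
  simp only [mulVec_sub, mulVec_single_one, Pi.sub_apply, col_apply, Matrix.add_apply,
    adjMatrix_apply, Matrix.one_apply, Pi.zero_apply] at hy
  by_cases h1 : y = z <;> by_cases h2 : y = c <;> by_cases h3 : G.Adj z y <;>
    by_cases h4 : G.Adj c y <;> simp_all [G.adj_comm]

/-- The closed twin classes of a triangle are not all different: the graph is a blow-up of a
triangle-free graph. -/
theorem twin_of_triangle {x y z : V} (hxy : G.Adj x y) (hxz : G.Adj x z) (hyz : G.Adj y z) :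
    G.Twin x y ∨ G.Twin z x ∨ G.Twin z y := by
  by_contra! hno
  obtain ⟨h1, h2, h3⟩ := hno
  have key : ∀ {x y : V}, G.Adj x y → G.Adj z x → G.Adj z y → ¬ G.Twin z x → ¬ G.Twin z y →
      ∀ w, w = x ∨ G.Adj x w → w = y ∨ G.Adj y w := by
    intro x y hxy hxz hyz h2 h3 w hw
    rcases hw with rfl | hw
    · exact Or.inr hxy.symm
    by_contra! hno
    have hP : G.IndPath y x w := ⟨hxy.symm, hw, hno.1.symm, hno.2⟩
    by_cases hzw : G.Adj z w
    · exact h2 (H.twin_mid hP hyz hxz hzw)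
    · exact h3 (H.twin_left hP hyz hxz hzw)
  exact h1 fun w => ⟨key hxy hxz.symm hyz.symm h2 h3 w, key hxy.symm hyz.symm hxz.symm h3 h2 w⟩

/-- No edge is far away from an induced path with three vertices. -/
theorem false_of_far_edge {u c w x y : V} (hP : G.IndPath u c w) (hxy : G.Adj x y)
    (hxu : ¬ G.Adj x u) (hxc : ¬ G.Adj x c) (hxw : ¬ G.Adj x w)
    (hyu : ¬ G.Adj y u) (hyc : ¬ G.Adj y c) (hyw : ¬ G.Adj y w) : False := by
  have e1 : x ≠ u := by rintro rfl; exact hxc hP.huc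
  have e2 : x ≠ c := by rintro rfl; exact hxw hP.hcw
  have e3 : x ≠ w := by rintro rfl; exact hxc hP.hcw.symm
  have e4 : y ≠ u := by rintro rfl; exact hyc hP.huc
  have e5 : y ≠ c := by rintro rfl; exact hyw hP.hcw
  have e6 : y ≠ w := by rintro rfl; exact hyc hP.hcw.symm
  rw [G.adj_comm] at hxu hxc hxw hyu hyc hyw
  have h1 := H.plus_radical hP (Pi.single x 1 - Pi.single y 1) (by
    simp [mulVec_sub, hxu, hxc, hxw, hyu, hyc, hyw, e1.symm, e2.symm, e3.symm,
      e4.symm, e5.symm, e6.symm]) (by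
    simp [mulVec_sub, sub_dotProduct, hxy, hxy.symm, hxy.ne, hxy.ne'])
  have h2 := H.minus_radical hP (Pi.single x 1 + Pi.single y 1) (by
    simp [mulVec_add, hxu, hxc, hxw, hyu, hyc, hyw, e1.symm, e2.symm, e3.symm,
      e4.symm, e5.symm, e6.symm]) (by
    simp [mulVec_add, add_dotProduct, hxy, hxy.symm, hxy.ne, hxy.ne'])
  have key : ∀ z, z ≠ x → z ≠ y → ¬ G.Adj x z ∧ ¬ G.Adj y z := by
    intro z hzx hzy
    have h1z := congrFun h1 z
    have h2z := congrFun h2 z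
    simp only [mulVec_sub, mulVec_add, mulVec_single_one, Pi.sub_apply, Pi.add_apply, col_apply,
      Matrix.add_apply, Matrix.sub_apply, adjMatrix_apply, Matrix.one_apply, Pi.zero_apply, hzx,
      hzy, if_false, G.adj_comm z] at h1z h2z
    by_cases h3 : G.Adj x z <;> by_cases h4 : G.Adj y z <;> simp [h3, h4] at h1z h2z ⊢
  have := H.conn.mem_of_closed {z | z = x ∨ z = y} (x := x) (Or.inl rfl) (by
    intro z hz z' hzz'
    by_contra hne
    replace hne : z' ≠ x ∧ z' ≠ y := not_or.mp hne
    rcases hz with rfl | rfl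
    · exact (key z' hne.1 hne.2).1 hzz'
    · exact (key z' hne.1 hne.2).2 hzz') u
  rcases this with h | h
  · exact e1 h.symm
  · exact e4 h.symm

end PlanarSpectrum

/-- An induced path `u - c - w` whose ends have private neighbours `a` and `b`. -/
structure Fork {W : Type*} (G : SimpleGraph W) (a u c w b : W) : Prop where
  path : G.IndPath u c w
  hau : G.Adj a u
  hac : ¬ G.Adj a c
  haw : ¬ G.Adj a w
  hbw : G.Adj b w
  hbc : ¬ G.Adj b c
  hbu : ¬ G.Adj b u

namespace PlanarSpectrum

variable (H : G.PlanarSpectrum)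
include H

/-- The vector `a - b + w - u` is orthogonal to `u - c + w` with respect to `A + 1`. -/
theorem fork_plus {a u c w b : V} (hF : G.Fork a u c w b) :
    (G.adjMatrix ℝ + 1) *ᵥ (Pi.single a 1 - Pi.single b 1 + Pi.single w 1 - Pi.single u 1) = 0 := by
  obtain ⟨⟨huc, hcw, huw, huw'⟩, hau, hac, haw, hbw, hbc, hbu⟩ := hF
  have e1 : a ≠ w := by rintro rfl; exact huw' hau.symm
  have e2 : a ≠ c := by rintro rfl; exact haw hcw
  have e3 : a ≠ b := by rintro rfl; exact hbu hau
  have e4 : b ≠ u := by rintro rfl; exact huw' hbw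
  have e5 : b ≠ c := by rintro rfl; exact hbu huc.symm
  have huw'' : ¬ G.Adj w u := fun h => huw' h.symm
  have hac' : ¬ G.Adj c a := fun h => hac h.symm
  have haw' : ¬ G.Adj w a := fun h => haw h.symm
  have hbc' : ¬ G.Adj c b := fun h => hbc h.symm
  have hbu' : ¬ G.Adj u b := fun h => hbu h.symm
  refine H.plus_radical ⟨huc, hcw, huw, huw'⟩ _ ?_ ?_
  · simp [mulVec_sub, mulVec_add, *, huc.ne', hcw.ne, e1.symm,
      e2.symm, e4.symm, e5.symm, huw.symm, huc.symm, hau.symm, hbw.symm, hau.ne', hbw.ne']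
  · by_cases hab : G.Adj a b
    · simp [mulVec_sub, mulVec_add, add_dotProduct, sub_dotProduct, *, hab.symm,
        e1.symm, e3.symm, e4.symm, huw.symm, hau.symm, hbw.symm, hau.ne', hbw.ne', hau.ne, hbw.ne]
    · have hab' : ¬ G.Adj b a := fun h => hab h.symm
      simp [mulVec_sub, mulVec_add, add_dotProduct, sub_dotProduct, *,
        e1.symm, e3.symm, e4.symm, huw.symm, hau.symm, hbw.symm, hau.ne', hbw.ne', hau.ne, hbw.ne]

theorem fork_not_adj {a u c w b : V} (hF : G.Fork a u c w b) : ¬ G.Adj a b := by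
  intro hab
  have h := congrFun (H.fork_plus hF) a
  obtain ⟨⟨huc, hcw, huw, huw'⟩, hau, hac, haw, hbw, hbc, hbu⟩ := hF
  have e1 : a ≠ w := by rintro rfl; exact huw' hau.symm
  simp [mulVec_sub, mulVec_add, hab, hau, haw, e1, hab.ne, hau.ne] at h

/-- The vector `a - b - w + u` is orthogonal to `u + c + w` with respect to `1 - A`. -/
theorem fork_minus {a u c w b : V} (hF : G.Fork a u c w b) :
    (1 - G.adjMatrix ℝ) *ᵥ (Pi.single a 1 - Pi.single b 1 - Pi.single w 1 + Pi.single u 1) = 0 := by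
  have hab := H.fork_not_adj hF
  obtain ⟨⟨huc, hcw, huw, huw'⟩, hau, hac, haw, hbw, hbc, hbu⟩ := hF
  have e1 : a ≠ w := by rintro rfl; exact huw' hau.symm
  have e2 : a ≠ c := by rintro rfl; exact haw hcw
  have e3 : a ≠ b := by rintro rfl; exact hbu hau
  have e4 : b ≠ u := by rintro rfl; exact huw' hbw
  have e5 : b ≠ c := by rintro rfl; exact hbu huc.symm
  have huw'' : ¬ G.Adj w u := fun h => huw' h.symm
  have hac' : ¬ G.Adj c a := fun h => hac h.symm
  have haw' : ¬ G.Adj w a := fun h => haw h.symm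
  have hbc' : ¬ G.Adj c b := fun h => hbc h.symm
  have hbu' : ¬ G.Adj u b := fun h => hbu h.symm
  have hab' : ¬ G.Adj b a := fun h => hab h.symm
  refine H.minus_radical ⟨huc, hcw, huw, huw'⟩ _ ?_ ?_
  · simp [mulVec_sub, mulVec_add, *, huc.ne', hcw.ne, e1.symm,
      e2.symm, e4.symm, e5.symm, huw.symm, huc.symm, hau.symm, hbw.symm, hau.ne', hbw.ne']
  · simp [mulVec_sub, mulVec_add, add_dotProduct, sub_dotProduct, *,
      e1.symm, e3.symm, e4.symm, huw.symm, hau.symm, hbw.symm, hau.ne', hbw.ne', hau.ne, hbw.ne]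

/-- In a fork `a - u - c - w - b` the vertices `a, b` have the same further neighbours, and so have
`u, w`. -/
theorem fork_adj_iff {a u c w b : V} (hF : G.Fork a u c w b) {z : V} (hza : z ≠ a) (hzu : z ≠ u)
    (hzw : z ≠ w) (hzb : z ≠ b) : (G.Adj z a ↔ G.Adj z b) ∧ (G.Adj z u ↔ G.Adj z w) := by
  have h1 := congrFun (H.fork_plus hF) z
  have h2 := congrFun (H.fork_minus hF) z
  simp only [mulVec_sub, mulVec_add, mulVec_single_one, Pi.sub_apply, Pi.add_apply, col_apply,
    Matrix.add_apply, Matrix.sub_apply, adjMatrix_apply, Matrix.one_apply, Pi.zero_apply, hza,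
    hzu, hzw, hzb, if_false] at h1 h2
  by_cases ha : G.Adj z a <;> by_cases hb : G.Adj z b <;> by_cases hu : G.Adj z u <;>
    by_cases hw : G.Adj z w <;> simp [ha, hb, hu, hw] at h1 h2 ⊢
  all_goals linarith

end PlanarSpectrum
end SimpleGraph

/-! ### Graphs without forks are joins of disjoint unions of cliques -/

namespace SimpleGraph

open Finset

variable {V : Type*} [Fintype V] [DecidableEq V]

instance (G : SimpleGraph V) [DecidableRel G.Adj] : DecidableRel G.Twin :=
  fun x y => inferInstanceAs (Decidable (∀ z, (z = x ∨ G.Adj x z) ↔ (z = y ∨ G.Adj y z)))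

/-- The number of vertices with the same closed neighbourhood as `x`, including `x`. -/
def twinCard (G : SimpleGraph V) [DecidableRel G.Adj] (x : V) : ℤ := #{z | G.Twin x z}

variable {G : SimpleGraph V} [DecidableRel G.Adj]

theorem one_le_twinCard (x : V) : 1 ≤ G.twinCard x := by
  have : 0 < #{z | G.Twin x z} := card_pos.mpr ⟨x, by simp [Twin.refl]⟩
  unfold twinCard; omega

theorem Twin.eq_of_twinCard {x y : V} (h : G.Twin x y) (h1 : G.twinCard x = 1) : x = y := by
  have : #{z | G.Twin x z} = 1 := by unfold twinCard at h1; omega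
  obtain ⟨w, hw⟩ := card_eq_one.mp this
  have hx : x ∈ ({w} : Finset V) := by rw [← hw]; simp [Twin.refl]
  have hy : y ∈ ({w} : Finset V) := by rw [← hw]; simp [h]
  rw [mem_singleton] at hx hy
  rw [hx, hy]

/-- The degree of `x`, with the neighbours split into twins and others. -/
theorem gram_self_eq_twinCard (x : V) :
    G.gram x x = G.twinCard x + #{z | G.Adj x z ∧ ¬ G.Twin x z} - 2 := by
  have h : ({z | G.Adj x z} : Finset V)
      = ({z | G.Twin x z} : Finset V).erase x ∪ ({z | G.Adj x z ∧ ¬ G.Twin x z} : Finset V) := by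
    ext z
    simp only [mem_filter, mem_univ, true_and, mem_union, mem_erase]
    constructor
    · intro hz
      by_cases ht : G.Twin x z
      · exact Or.inl ⟨hz.ne', ht⟩
      · exact Or.inr ⟨hz, ht⟩
    · rintro (⟨h1, h2⟩ | h)
      · exact h2.adj h1.symm
      · exact h.1
  have hx : x ∈ ({z | G.Twin x z} : Finset V) := by simp [Twin.refl]
  rw [gram_self, h, card_union_of_disjoint, card_erase_of_mem hx]
  · have := card_pos.mpr ⟨x, hx⟩
    unfold twinCard
    omega
  · rw [Finset.disjoint_left]
    intro z hz hz'
    simp only [mem_filter, mem_univ, true_and, mem_erase] at hz hz'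
    exact hz'.2 hz.2

namespace PlanarSpectrum

variable (H : G.PlanarSpectrum)
include H

/-- Two adjacent vertices that are not twins have only their own twins as common neighbours. -/
theorem gram_adj {x y : V} (hxy : G.Adj x y) (ht : ¬ G.Twin x y) :
    G.gram x y = G.twinCard x + G.twinCard y - 2 := by
  have h : ({z | G.Adj x z ∧ G.Adj y z} : Finset V)
      = ({z | G.Twin x z} : Finset V).erase x ∪ ({z | G.Twin y z} : Finset V).erase y := by
    ext z
    simp only [mem_filter, mem_univ, true_and, mem_union, mem_erase]
    constructor
    · rintro ⟨h1, h2⟩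
      rcases H.twin_of_triangle hxy h1 h2 with h | h | h
      · exact absurd h ht
      · exact Or.inl ⟨h1.ne', h.symm⟩
      · exact Or.inr ⟨h2.ne', h.symm⟩
    · rintro (⟨h1, h2⟩ | ⟨h1, h2⟩)
      · have hzy : z ≠ y := by rintro rfl; exact ht h2
        exact ⟨h2.adj h1.symm, (h2.adj_of_adj hxy hzy.symm).symm⟩
      · have hzx : z ≠ x := by rintro rfl; exact ht h2.symm
        exact ⟨(h2.adj_of_adj hxy.symm hzx.symm).symm, h2.adj h1.symm⟩
  have hx : x ∈ ({z | G.Twin x z} : Finset V) := by simp [Twin.refl]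
  have hy : y ∈ ({z | G.Twin y z} : Finset V) := by simp [Twin.refl]
  rw [gram_of_ne hxy.ne, h, card_union_of_disjoint, card_erase_of_mem hx, card_erase_of_mem hy]
  · have := card_pos.mpr ⟨x, hx⟩
    have := card_pos.mpr ⟨y, hy⟩
    unfold twinCard
    omega
  · rw [Finset.disjoint_left]
    intro z hz hz'
    simp only [mem_filter, mem_univ, true_and, mem_erase] at hz hz'
    exact ht (hz.2.trans hz'.2.symm)

variable (hB : ∀ a u c w b, ¬ G.Fork a u c w b)
include hB

/-- Without forks the neighbourhoods along an induced path with four vertices are nested. -/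
theorem nested_of_path {a b c d z : V} (hab : G.Adj a b) (hbc : G.Adj b c) (hcd : G.Adj c d)
    (hac : ¬ G.Adj a c) (hbd : ¬ G.Adj b d) (had : ¬ G.Adj a d) (hz : G.Adj d z) :
    G.Twin d z ∨ G.Adj b z := by
  have hbd' : b ≠ d := by rintro rfl; exact had hab
  have hP : G.IndPath d c b := ⟨hcd.symm, hbc.symm, hbd'.symm, fun h => hbd h.symm⟩
  by_contra! hno
  obtain ⟨h1, h2⟩ := hno
  by_cases hzc : G.Adj z c
  · exact h1 (H.twin_left hP hz.symm hzc fun h => h2 h.symm).symm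
  · exact hB a b c d z ⟨hP.symm, hab, hac, had, hz.symm, hzc, fun h => h2 h.symm⟩

theorem gram_ends {a b c d : V} (hab : G.Adj a b) (hbc : G.Adj b c) (hcd : G.Adj c d)
    (hac : ¬ G.Adj a c) (hbd : ¬ G.Adj b d) (had : ¬ G.Adj a d) : G.gram a d = 0 := by
  have had' : a ≠ d := by rintro rfl; exact hac hcd.symm
  have hbd' : b ≠ d := by rintro rfl; exact had hab
  rw [gram_of_ne had']
  rw [Nat.cast_eq_zero, card_eq_zero, filter_eq_empty_iff]
  rintro z - ⟨h1, h2⟩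
  rcases H.nested_of_path hB hab hbc hcd hac hbd had h2 with h | h
  · exact had (h.symm.adj_of_adj h1.symm had').symm
  · rcases H.twin_of_triangle hab h1 h with h' | h' | h'
    · exact hac (h'.symm.adj_of_adj hbc (by rintro rfl; exact had hcd))
    · exact had (h'.adj_of_adj h2.symm had'.symm)
    · exact hbd (h'.adj_of_adj h2.symm hbd'.symm)

theorem gram_self_end {a b c d : V} (hab : G.Adj a b) (hbc : G.Adj b c) (hcd : G.Adj c d)
    (hac : ¬ G.Adj a c) (hbd : ¬ G.Adj b d) (had : ¬ G.Adj a d) :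
    G.gram d d = G.twinCard d + G.gram b d - 2 ∧ G.twinCard c ≤ G.gram b d := by
  have hbd' : b ≠ d := by rintro rfl; exact had hab
  constructor
  · rw [gram_self_eq_twinCard, gram_of_ne hbd']
    congr 3
    congr 1
    ext z
    simp only [mem_filter, mem_univ, true_and]
    constructor
    · rintro ⟨h1, h2⟩
      exact ⟨(H.nested_of_path hB hab hbc hcd hac hbd had h1).resolve_left h2, h1⟩
    · rintro ⟨h1, h2⟩
      exact ⟨h2, fun h => hbd (h.symm.adj_of_adj h1.symm hbd').symm⟩
  · rw [gram_of_ne hbd']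
    unfold twinCard
    norm_cast
    refine card_le_card fun z hz => ?_
    simp only [mem_filter, mem_univ, true_and] at hz ⊢
    by_cases hzb : z = b
    · subst hzb
      exact absurd (hz.adj_of_adj hcd hbd'.symm) hbd
    by_cases hzd : z = d
    · subst hzd
      exact absurd (hz.adj_of_adj hbc.symm hbd').symm hbd
    exact ⟨(hz.adj_of_adj hbc.symm (Ne.symm hzb)).symm, (hz.adj_of_adj hcd (Ne.symm hzd)).symm⟩

/-- The numerical data of an induced path with four vertices are rigid. -/
theorem path_data {a b c d : V} (hab : G.Adj a b) (hbc : G.Adj b c) (hcd : G.Adj c d)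
    (hac : ¬ G.Adj a c) (hbd : ¬ G.Adj b d) (had : ¬ G.Adj a d) :
    G.twinCard a = 1 ∧ G.twinCard b = 1 ∧ G.twinCard c = 1 ∧ G.twinCard d = 1 ∧
      G.gram d d = 1 ∧ G.gram b d = 2 ∧ G.gram b b = 4 := by
  have had' : a ≠ d := by rintro rfl; exact hac hcd.symm
  have hac' : a ≠ c := by rintro rfl; exact had hcd
  have hbd' : b ≠ d := by rintro rfl; exact had hab
  have h0 := H.gram_ends hB hab hbc hcd hac hbd had
  obtain ⟨h1, h2⟩ := H.gram_self_end hB hab hbc hcd hac hbd had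
  obtain ⟨h3, h4⟩ := H.gram_self_end hB hcd.symm hbc.symm hab.symm (fun h => hbd h.symm)
    (fun h => hac h.symm) (fun h => had h.symm)
  have tab : ¬ G.Twin b a := fun h => hac (h.adj_of_adj hbc hac'.symm)
  have tbc : ¬ G.Twin b c := fun h => hac (h.adj_of_adj hab.symm hac').symm
  have tcd : ¬ G.Twin c d := fun h => hbd (h.adj_of_adj hbc.symm hbd').symm
  have h5 := H.gram_adj hab.symm tab
  have h6 := H.gram_adj hbc tbc
  have h7 := H.gram_adj hcd tcd
  have h8 := H.gram_expand h0 b c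
  have h9 := H.gram_expand h0 b b
  have ha := H.gram_self_pos a
  have hd := H.gram_self_pos d
  have a1 := one_le_twinCard (G := G) a
  have b1 := one_le_twinCard (G := G) b
  have c1 := one_le_twinCard (G := G) c
  have d1 := one_le_twinCard (G := G) d
  rw [h5, h6, h7] at h8
  rw [h5] at h9
  generalize G.twinCard a = ta at *
  generalize G.twinCard b = tb at *
  generalize G.twinCard c = tc at *
  generalize G.twinCard d = td at *
  generalize G.gram a a = P at *
  generalize G.gram d d = R at *
  generalize G.gram c a = B at *
  generalize G.gram b d = C at *
  generalize G.gram b b = M at *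
  have key : ∀ {t t' P B : ℤ}, 1 ≤ t → 1 ≤ t' → 0 < P → P = t + B - 2 → t' ≤ B →
      0 ≤ (t' + t - 2) * B - (t' - 1) * P ∧
        ((t' + t - 2) * B - (t' - 1) * P = 0 → t = 1 ∧ t' = 1) := by
    intro t t' P B ht ht' hP hPe hB
    rcases eq_or_lt_of_le ht with rfl | ht
    · have : (t' + 1 - 2) * B - (t' - 1) * P = t' - 1 := by rw [hPe]; ring
      rw [this]
      exact ⟨by omega, fun h => ⟨rfl, by omega⟩⟩
    · have e : (t' + t - 2) * B - (t' - 1) * P = P + (t - 2) * (B - t') := by rw [hPe]; ring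
      have : 0 ≤ (t - 2) * (B - t') := mul_nonneg (by omega) (by omega)
      rw [e]
      exact ⟨by omega, fun h => by omega⟩
  obtain ⟨k1, k2⟩ := key a1 b1 ha h3 h4
  obtain ⟨k3, k4⟩ := key d1 c1 hd h1 h2
  have hsum : R * ((tb + ta - 2) * B - (tb - 1) * P) + P * ((tc + td - 2) * C - (tc - 1) * R)
      = 0 := by linear_combination -h8
  have m1 := mul_nonneg hd.le k1
  have m2 := mul_nonneg ha.le k3
  have z1 : (tb + ta - 2) * B - (tb - 1) * P = 0 := by
    have : R * ((tb + ta - 2) * B - (tb - 1) * P) = 0 := by linarith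
    exact (mul_eq_zero.mp this).resolve_left hd.ne'
  have z2 : (tc + td - 2) * C - (tc - 1) * R = 0 := by
    have : P * ((tc + td - 2) * C - (tc - 1) * R) = 0 := by linarith
    exact (mul_eq_zero.mp this).resolve_left ha.ne'
  obtain ⟨rfl, rfl⟩ := k2 z1
  obtain ⟨rfl, rfl⟩ := k4 z2
  -- `R = C - 1` divides `C ^ 2 = R * M`, hence `C = 2`; the bound on `B` is the mirror image
  have hRM : R * M = C * C := by
    have : P * (R * M - C * C) = 0 := by linear_combination h9
    linarith [(mul_eq_zero.mp this).resolve_left ha.ne']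
  have hCR : C = R + 1 := by omega
  have hR1 : R ∣ 1 := ⟨M - R - 2, by rw [hCR] at hRM; linear_combination -hRM⟩
  have hR : R = 1 := Int.eq_one_of_dvd_one hd.le hR1
  subst hR
  refine ⟨rfl, rfl, rfl, rfl, rfl, by omega, ?_⟩
  rw [hCR] at hRM
  linarith

/-- A graph without forks has no induced path with four vertices. -/
theorem false_of_path {a b c d : V} (hab : G.Adj a b) (hbc : G.Adj b c) (hcd : G.Adj c d)
    (hac : ¬ G.Adj a c) (hbd : ¬ G.Adj b d) (had : ¬ G.Adj a d) : False := by
  obtain ⟨ta, tb, tc, td, -, hbd2, hbb⟩ := H.path_data hB hab hbc hcd hac hbd had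
  obtain ⟨-, -, -, -, haa, hca2, -⟩ := H.path_data hB hcd.symm hbc.symm hab.symm
    (fun h => hbd h.symm) (fun h => hac h.symm) (fun h => had h.symm)
  have h0 := H.gram_ends hB hab hbc hcd hac hbd had
  have hca : c ≠ a := by rintro rfl; exact had hcd
  have hbd' : b ≠ d := by rintro rfl; exact had hab
  have had' : a ≠ d := by rintro rfl; exact hac hcd.symm
  -- the second common neighbour `b'` of `a` and `c` is another choice for `b`
  rw [gram_of_ne hca] at hca2
  have hcard : 1 < #{z | G.Adj c z ∧ G.Adj a z} := by omega
  obtain ⟨b', hb', hne⟩ := exists_mem_ne hcard b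
  simp only [mem_filter, mem_univ, true_and] at hb'
  obtain ⟨hcb', hab'⟩ := hb'
  have notri : ∀ {x y z : V}, G.twinCard x = 1 → G.twinCard y = 1 → G.Adj x y → G.Adj x z →
      ¬ G.Adj y z := by
    intro x y z hx hy hxy hxz hyz
    rcases H.twin_of_triangle hxy hxz hyz with h | h | h
    · exact hxy.ne (h.eq_of_twinCard hx)
    · exact hxz.ne (h.symm.eq_of_twinCard hx)
    · exact hyz.ne (h.symm.eq_of_twinCard hy)
  have hb'd : ¬ G.Adj b' d := fun h => notri tc td hcd hcb' h.symm
  have hbb' : ¬ G.Adj b b' := notri ta tb hab hab'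
  obtain ⟨-, tb', -, -, -, hb'd2, hb'b'⟩ := H.path_data hB hab' hcb'.symm hcd hac hb'd had
  have g1 : G.gram b a = 0 := by
    have := H.gram_adj hab.symm fun h => hab.ne' (h.eq_of_twinCard tb)
    omega
  have hdd := (H.gram_self_end hB hab hbc hcd hac hbd had).1
  have g2 := H.gram_expand h0 b b'
  rw [g1, haa, hbd2, hb'd2, hdd, td, hbd2] at g2
  have g3 : G.gram b b' = 4 := by linarith
  have hpriv : ∀ {b b' : V}, b ≠ b' → G.gram b b' = 4 → G.gram b b = 4 →
      ∃ z, G.Adj b z ∧ ¬ G.Adj b' z := by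
    intro b b' hne h1 h2
    by_contra! hno
    rw [gram_self] at h2
    rw [gram_of_ne hne] at h1
    have : ({z | G.Adj b z ∧ G.Adj b' z} : Finset V) = ({z | G.Adj b z} : Finset V) := by
      ext z
      simp only [mem_filter, mem_univ, true_and]
      exact ⟨fun h => h.1, fun h => ⟨h, hno z h⟩⟩
    rw [this] at h1
    omega
  obtain ⟨z, hz, hz'⟩ := hpriv hne.symm g3 hbb
  obtain ⟨w, hw, hw'⟩ := hpriv hne (by rw [gram_comm]; exact g3) hb'b'
  exact hB z b a b' w ⟨⟨hab.symm, hab', hne.symm, hbb'⟩, hz.symm,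
    fun h => notri ta tb hab h.symm hz, fun h => hz' h.symm, hw.symm,
    fun h => notri ta tb' hab' h.symm hw, fun h => hw' h.symm⟩

end PlanarSpectrum

/-- `G` is the join of the disjoint unions of cliques induced on `S` and on its complement: all
edges between the two sides are present, and adjacent vertices of one side are twins. -/
structure IsCliqueJoin {W : Type*} (G : SimpleGraph W) (S : Set W) : Prop where
  cross : ∀ x ∈ S, ∀ y ∉ S, G.Adj x y
  not_twin : ∀ x ∈ S, ∀ y ∉ S, ¬ G.Twin x y
  twin : ∀ x y, (x ∈ S ↔ y ∈ S) → G.Adj x y → G.Twin x y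

theorem IsCliqueJoin.compl {W : Type*} {G : SimpleGraph W} {S : Set W} (h : G.IsCliqueJoin S) :
    G.IsCliqueJoin Sᶜ where
  cross x hx y hy := (h.cross y (by simpa using hy) x hx).symm
  not_twin x hx y hy := fun ht => h.not_twin y (by simpa using hy) x hx ht.symm
  twin x y hxy := h.twin x y (by simpa [not_iff_not] using hxy)

theorem IsCliqueJoin.mem_iff {W : Type*} {G : SimpleGraph W} {S : Set W} (h : G.IsCliqueJoin S)
    {x y : W} (ht : G.Twin x y) : x ∈ S ↔ y ∈ S := by
  constructor
  · intro hx
    by_contra hy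
    exact h.not_twin x hx y hy ht
  · intro hy
    by_contra hx
    exact h.not_twin y hy x hx ht.symm

namespace PlanarSpectrum

variable (H : G.PlanarSpectrum) (hB : ∀ a u c w b, ¬ G.Fork a u c w b)
include H hB

/-- One side consists of the neighbours of the middle vertex of an induced path that are not its
twins. -/
theorem exists_isCliqueJoin : ∃ S : Set V, G.IsCliqueJoin S ∧
    (∃ x ∈ S, ∃ y ∈ S, ¬ G.Twin x y) ∧ ∃ z, z ∉ S := by
  obtain ⟨u, c, w, hP⟩ := H.exists_indPath
  have hdist := H.conn.mem_of_closed {y | y = c ∨ G.Adj c y ∨ ∃ x, G.Adj c x ∧ G.Adj x y}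
    (x := c) (Or.inl rfl) (by
      intro y hy z hyz
      by_cases hcz : z = c
      · exact Or.inl hcz
      right
      by_contra hno
      obtain ⟨h1, h2⟩ := not_or.mp hno
      rcases hy with rfl | hy | ⟨x, hcx, hxy⟩
      · exact h1 hyz
      · exact h2 ⟨y, hy, hyz⟩
      · have hcy : ¬ G.Adj c y := fun h => h2 ⟨y, h, hyz⟩
        have hxz : ¬ G.Adj x z := fun h => h2 ⟨x, hcx, h⟩
        exact H.false_of_path hB hcx hxy hyz hcy hxz h1)
  have hcross : ∀ x ∈ {x | G.Adj c x ∧ ¬ G.Twin c x}, ∀ y ∉ {x | G.Adj c x ∧ ¬ G.Twin c x},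
      G.Adj x y := by
    rintro x ⟨hcx, hx⟩ y hy
    by_cases hcy : G.Adj c y
    · have ht : G.Twin c y := by
        by_contra ht
        exact hy ⟨hcy, ht⟩
      exact (ht.adj_of_adj hcx (by rintro rfl; exact hx ht)).symm
    rcases hdist y with rfl | h | ⟨x', hcx', hx'y⟩
    · exact hcx.symm
    · exact absurd h hcy
    by_contra hxy
    have hxx : x ≠ x' := by rintro rfl; exact hxy hx'y
    have hyc : y ≠ c := by rintro rfl; exact hxy hcx.symm
    by_cases hadj : G.Adj x' x
    · rcases H.twin_of_triangle hcx hcx' hadj.symm with h | h | h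
      · exact hx h
      · exact hcy (h.adj_of_adj hx'y hyc)
      · exact hxy (h.adj_of_adj hx'y (by rintro rfl; exact hcy hcx))
    · exact H.false_of_path hB hx'y.symm hcx'.symm hcx (fun h => hcy h.symm) hadj
        fun h => hxy h.symm
  have hnt : ∀ x ∈ {x | G.Adj c x ∧ ¬ G.Twin c x}, ∀ y ∉ {x | G.Adj c x ∧ ¬ G.Twin c x},
      ¬ G.Twin x y := by
    rintro x ⟨hcx, hx⟩ y hy ht
    by_cases hyc : y = c
    · subst hyc; exact hx ht.symm
    have hcy := (ht.adj_of_adj hcx.symm (Ne.symm hyc)).symm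
    exact hy ⟨hcy, fun h => hx (h.trans ht.symm)⟩
  have huS : G.Adj c u ∧ ¬ G.Twin c u := ⟨hP.huc.symm, fun h =>
    hP.nadj (h.adj_of_adj hP.hcw hP.ne.symm)⟩
  have hwS : G.Adj c w ∧ ¬ G.Twin c w := ⟨hP.hcw, fun h =>
    hP.nadj (h.adj_of_adj hP.huc.symm hP.ne).symm⟩
  refine ⟨{x | G.Adj c x ∧ ¬ G.Twin c x}, ⟨hcross, hnt, ?_⟩,
    ⟨u, huS, w, hwS, fun h => hP.nadj (h.adj hP.ne)⟩, ⟨c, fun h => h.2 (Twin.refl G c)⟩⟩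
  intro x y hxy hadj
  by_cases hx : x ∈ {x | G.Adj c x ∧ ¬ G.Twin c x}
  · have hy := hxy.mp hx
    rcases H.twin_of_triangle hadj hx.1.symm hy.1.symm with h | h | h
    · exact h
    · exact absurd h hx.2
    · exact absurd h hy.2
  · have hy := fun h => hx (hxy.mpr h)
    rcases H.twin_of_triangle hadj (hcross u huS x hx).symm (hcross u huS y hy).symm with h | h | h
    · exact h
    · exact absurd h (hnt u huS x hx)
    · exact absurd h (hnt u huS y hy)

end PlanarSpectrum
end SimpleGraph

/-! ### The clique sizes in a join of disjoint unions of cliques -/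

namespace SimpleGraph

open Finset

variable {V : Type*} [Fintype V] [DecidableEq V] {G : SimpleGraph V} [DecidableRel G.Adj]

namespace IsCliqueJoin

variable {S : Set V} (J : G.IsCliqueJoin S)
include J

theorem gram_self {x : V} (hx : x ∈ S) : G.gram x x = G.twinCard x + Sᶜ.ncard - 2 := by
  rw [gram_self_eq_twinCard, ← Set.ncard_coe_finset]
  congr 4
  ext z
  simp only [coe_filter, mem_univ, true_and]
  constructor
  · rintro ⟨h1, h2⟩ hz
    exact h2 (J.twin x z (by simp [hx, hz]) h1)
  · intro hz
    exact ⟨J.cross x hx z hz, J.not_twin x hx z hz⟩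

theorem gram_of_not_twin {x y : V} (hx : x ∈ S) (hy : y ∈ S) (ht : ¬ G.Twin x y) :
    G.gram x y = Sᶜ.ncard := by
  have hxy : x ≠ y := by rintro rfl; exact ht (Twin.refl G x)
  rw [gram_of_ne hxy, ← Set.ncard_coe_finset]
  congr 2
  ext z
  simp only [coe_filter, mem_univ, true_and]
  constructor
  · rintro ⟨h1, h2⟩ hz
    exact ht ((J.twin x z (by simp [hx, hz]) h1).trans (J.twin y z (by simp [hy, hz]) h2).symm)
  · intro hz
    exact ⟨J.cross x hx z hz, J.cross y hy z hz⟩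

theorem twinCard_le {x : V} (hx : x ∈ S) : G.twinCard x ≤ S.ncard := by
  unfold twinCard
  rw [← Set.ncard_coe_finset]
  refine Nat.cast_le.mpr (Set.ncard_le_ncard fun z hz => ?_)
  simp only [coe_filter, mem_univ, true_and] at hz
  exact (J.mem_iff hz).mp hx

theorem twinCard_add_le {x y : V} (hx : x ∈ S) (hy : y ∈ S) (ht : ¬ G.Twin x y) :
    G.twinCard x + G.twinCard y ≤ S.ncard := by
  unfold twinCard
  rw [← Nat.cast_add, ← card_union_of_disjoint, ← Set.ncard_coe_finset]
  · refine Nat.cast_le.mpr (Set.ncard_le_ncard fun z hz => ?_)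
    simp only [coe_union, coe_filter, mem_univ, true_and] at hz
    rcases hz with hz | hz
    · exact (J.mem_iff hz).mp hx
    · exact (J.mem_iff hz).mp hy
  · rw [Finset.disjoint_left]
    intro z hz hz'
    simp only [mem_filter, mem_univ, true_and] at hz hz'
    exact ht (hz.trans hz'.symm)

theorem twinCard_add_eq {x y : V} (hx : x ∈ S) (hy : y ∈ S) (ht : ¬ G.Twin x y)
    (hall : ∀ z ∈ S, G.Twin x z ∨ G.Twin y z) : G.twinCard x + G.twinCard y = S.ncard := by
  refine le_antisymm (J.twinCard_add_le hx hy ht) ?_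
  unfold twinCard
  have : S ⊆ ((univ.filter (G.Twin x) ∪ univ.filter (G.Twin y) : Finset V) : Set V) := by
    intro z hz
    simpa using hall z hz
  have := Set.ncard_le_ncard this (Set.toFinite _)
  rw [Set.ncard_coe_finset] at this
  have := this.trans (card_union_le _ _)
  exact_mod_cast this

variable (H : G.PlanarSpectrum)
include H

/-- Two classes on one side both have size two, or one of them is a single vertex. -/
theorem twinCard_pair {x x' y : V} (hx : x ∈ S) (hx' : x' ∈ S) (hy : y ∉ S)
    (ht : ¬ G.Twin x x') :
    (G.twinCard x = 2 ∧ G.twinCard x' = 2) ∨ G.twinCard x = 1 ∨ G.twinCard x' = 1 := by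
  have hm := H.minor x x' y x x' y
  rw [gram_comm x' x, gram_comm y x, gram_comm y x', J.gram_self hx, J.gram_self hx',
    J.gram_of_not_twin hx hx' ht, J.compl.gram_self hy, H.gram_adj (J.cross x hx y hy)
    (J.not_twin x hx y hy), H.gram_adj (J.cross x' hx' y hy) (J.not_twin x' hx' y hy),
    compl_compl] at hm
  have h1 := one_le_twinCard (G := G) x
  have h2 := one_le_twinCard (G := G) x'
  have h3 := one_le_twinCard (G := G) y
  have h4 := J.compl.twinCard_le (x := y) hy
  have h5 := J.twinCard_add_le hx hx' ht
  generalize G.twinCard x = s at *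
  generalize G.twinCard x' = s' at *
  generalize G.twinCard y = t at *
  generalize (S.ncard : ℤ) = N at *
  generalize (Sᶜ.ncard : ℤ) = T at *
  by_contra! hno
  obtain ⟨h6, h7, h8⟩ := hno
  obtain ⟨a, rfl⟩ : ∃ a, s = a + 2 := ⟨s - 2, by ring⟩
  obtain ⟨b, rfl⟩ : ∃ b, s' = b + 2 := ⟨s' - 2, by ring⟩
  have ha : 0 ≤ a := by omega
  have hb : 0 ≤ b := by omega
  have hab : 0 < a + b := by omega
  have hπ := mul_nonneg ha hb
  have hΔ : 0 ≤ T * (a + b) + a * b := by nlinarith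
  have e1 : (t - 2 + N) * (T * (a + b) + a * b)
      = t * t * (a + b) + 4 * t * (a * b) + T * (a - b) ^ 2 + a * b * (a + b) := by
    linear_combination hm
  have e2 : (t + 2 + (a + b)) * (T * (a + b) + a * b) ≤ (t - 2 + N) * (T * (a + b) + a * b) :=
    mul_le_mul_of_nonneg_right (by linarith) hΔ
  have e3 : 0 ≤ t * (a + b) * (T - t) := by
    refine mul_nonneg (mul_nonneg (by linarith) hab.le) (by linarith)
  have e4 : 0 ≤ a * b * (T - t) := mul_nonneg hπ (by linarith)
  have e5 : 0 < T * (a + b) := mul_pos (by linarith) hab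
  have e6 : 0 ≤ a * b * T := mul_nonneg hπ (by linarith)
  nlinarith

theorem two_lt_twinCard {x x' : V} (hx : x ∈ S) (hx' : x' ∈ S) (ht : ¬ G.Twin x x')
    (h1 : G.twinCard x = 1) : 2 < G.twinCard x' ∧ 2 ≤ (Sᶜ.ncard : ℤ) := by
  have hm := H.gram_sq_le x x'
  have hp := H.gram_self_pos x
  rw [J.gram_self hx, J.gram_self hx', J.gram_of_not_twin hx hx' ht, h1] at hm
  rw [J.gram_self hx, h1] at hp
  generalize G.twinCard x' = s' at *
  generalize (Sᶜ.ncard : ℤ) = T at *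
  refine ⟨?_, by omega⟩
  by_contra! hs
  nlinarith

/-- If a single vertex is a class of its side, then that side has only one further class. -/
theorem twin_or_twin {x x' y : V} (hx : x ∈ S) (hx' : x' ∈ S) (hy : y ∉ S) (ht : ¬ G.Twin x x')
    (h1 : G.twinCard x = 1) (z : V) (hz : z ∈ S) : G.Twin x z ∨ G.Twin x' z := by
  by_contra! hno
  obtain ⟨hxz, hx'z⟩ := hno
  have hm := H.minor x y x' x y z
  have hY := H.gram_sq_le x y
  have s1 := (J.two_lt_twinCard H hx hx' ht h1)
  have s2 := (J.two_lt_twinCard H hx hz hxz h1).1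
  have h4 := J.compl.twinCard_le (x := y) hy
  rw [gram_comm y x, gram_comm y z, gram_comm x' x, J.gram_self hx, J.gram_of_not_twin hx hx' ht,
    J.gram_of_not_twin hx hz hxz, J.gram_of_not_twin hx' hz hx'z,
    H.gram_adj (J.cross x hx y hy) (J.not_twin x hx y hy),
    H.gram_adj (J.cross x' hx' y hy) (J.not_twin x' hx' y hy),
    H.gram_adj (J.cross z hz y hy) (J.not_twin z hz y hy), h1] at hm
  rw [J.gram_self hx, H.gram_adj (J.cross x hx y hy) (J.not_twin x hx y hy), h1] at hY
  have h3 := one_le_twinCard (G := G) y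
  generalize G.twinCard x' = s at *
  generalize G.twinCard z = s' at *
  generalize G.twinCard y = t at *
  generalize G.gram y y = Y at *
  generalize (Sᶜ.ncard : ℤ) = T at *
  -- both factors on the right are positive, while the scalar product on the left is negative
  have e : ((T - 1) * Y - (t - 1) ^ 2) * (-T)
      = ((T - 1) * (s - 2) + (T - t)) * ((T - 1) * (s' - 2) + (T - t)) := by
    linear_combination (T - 1) * hm
  have p1 : 0 < (T - 1) * (s - 2) + (T - t) := by nlinarith
  have p2 : 0 < (T - 1) * (s' - 2) + (T - t) := by nlinarith
  have p3 := mul_pos p1 p2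
  have p4 : 0 ≤ ((T - 1) * Y - (t - 1) ^ 2) := by nlinarith
  nlinarith

/-- If one side consists of a single vertex and another clique with `s` vertices, then the size
`t` of each clique on the other side satisfies a quadratic equation. -/
theorem quadratic_of_single {x x' y : V} (hx : x ∈ S) (hx' : x' ∈ S) (hy : y ∉ S)
    (ht : ¬ G.Twin x x') (h1 : G.twinCard x = 1) :
    (G.twinCard x' - 3) * ((G.twinCard y - 1) * (G.twinCard y - Sᶜ.ncard))
      - (G.twinCard y - 1) * (2 * G.twinCard x' - 3) + (Sᶜ.ncard - 1) * (G.twinCard x' + 1)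
      + G.twinCard x' = 0 := by
  have hN := J.twinCard_add_eq hx hx' ht (J.twin_or_twin H hx hx' hy ht h1)
  have hm := H.minor x x' y x x' y
  rw [gram_comm x' x, gram_comm y x, gram_comm y x', J.gram_self hx, J.gram_self hx',
    J.gram_of_not_twin hx hx' ht, J.compl.gram_self hy, H.gram_adj (J.cross x hx y hy)
    (J.not_twin x hx y hy), H.gram_adj (J.cross x' hx' y hy) (J.not_twin x' hx' y hy),
    compl_compl, ← hN, h1] at hm
  linear_combination -hm

end IsCliqueJoin

/-- A side with at least two classes: all of them have size two, or one of exactly two classes is a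
single vertex. -/
theorem IsCliqueJoin.side_cases {S : Set V} (J : G.IsCliqueJoin S) (H : G.PlanarSpectrum)
    {x₀ x₁ y : V} (hx₀ : x₀ ∈ S) (hx₁ : x₁ ∈ S) (ht : ¬ G.Twin x₀ x₁) (hy : y ∉ S) :
    (∀ x ∈ S, G.twinCard x = 2) ∨ ∃ x ∈ S, ∃ x' ∈ S, ¬ G.Twin x x' ∧ G.twinCard x = 1 := by
  by_cases h : ∃ x ∈ S, G.twinCard x = 1
  · right
    obtain ⟨x, hx, h1⟩ := h
    by_cases h0 : G.Twin x x₀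
    · exact ⟨x, hx, x₁, hx₁, fun h => ht (h0.symm.trans h), h1⟩
    · exact ⟨x, hx, x₀, hx₀, h0, h1⟩
  · left
    push Not at h
    intro x hx
    by_cases h0 : G.Twin x x₀
    · rcases J.twinCard_pair H hx hx₁ hy fun h => ht (h0.symm.trans h) with h' | h' | h'
      · exact h'.1
      · exact absurd h' (h x hx)
      · exact absurd h' (h x₁ hx₁)
    · rcases J.twinCard_pair H hx hx₀ hy h0 with h' | h' | h'
      · exact h'.1
      · exact absurd h' (h x hx)
      · exact absurd h' (h x₀ hx₀)

/-- The classification of graphs without forks. -/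
theorem PlanarSpectrum.join_cases (H : G.PlanarSpectrum) (hB : ∀ a u c w b, ¬ G.Fork a u c w b) :
    ∃ S : Set V, G.IsCliqueJoin S ∧ S.Nonempty ∧ Sᶜ.Nonempty ∧
      ((∀ x, G.twinCard x = 2) ∨
        ((∀ x ∈ S, G.twinCard x = 2) ∧ ∀ y ∉ S, ∀ z ∉ S, G.Twin y z) ∨
        ∃ x ∈ S, ∃ x' ∈ S, ¬ G.Twin x x' ∧ (∀ z ∈ S, G.Twin x z ∨ G.Twin x' z) ∧
          (∀ y ∉ S, ∀ z ∉ S, G.Twin y z) ∧ G.twinCard x = 1 ∧ ∀ y ∉ S,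
            (G.twinCard y = 3 ∧ G.twinCard x' = 8) ∨ (G.twinCard y = 4 ∧ G.twinCard x' = 6) ∨
              (G.twinCard y = 6 ∧ G.twinCard x' = 5)) := by
  obtain ⟨S, J, ⟨x₀, hx₀, x₁, hx₁, hx⟩, y₀, hy₀⟩ := H.exists_isCliqueJoin hB
  -- a side with two classes one of which is a single vertex excludes classes of size one and two
  -- on the other side
  have key : ∀ {S : Set V}, G.IsCliqueJoin S → ∀ {x x' y}, x ∈ S → x' ∈ S → ¬ G.Twin x x' →
      G.twinCard x = 1 → y ∉ S → G.twinCard y ≠ 1 ∧ G.twinCard y ≠ 2 := by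
    intro S J x x' y hx hx' ht h1 hy
    have h := J.quadratic_of_single H hx hx' hy ht h1
    obtain ⟨h2, h3⟩ := J.two_lt_twinCard H hx hx' ht h1
    constructor <;> intro h4 <;> rw [h4] at h <;> nlinarith
  by_cases hQ : ∀ y ∉ S, ∀ z ∉ S, G.Twin y z
  · rcases J.side_cases H hx₀ hx₁ hx hy₀ with h | ⟨x, hx, x', hx', ht, h1⟩
    · exact ⟨S, J, ⟨x₀, hx₀⟩, ⟨y₀, hy₀⟩, Or.inr (Or.inl ⟨h, hQ⟩)⟩
    · refine ⟨S, J, ⟨x₀, hx₀⟩, ⟨y₀, hy₀⟩, Or.inr (Or.inr ⟨x, hx, x', hx', ht,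
        J.twin_or_twin H hx hx' hy₀ ht h1, hQ, h1, fun y hy => ?_⟩)⟩
      have h := J.quadratic_of_single H hx hx' hy ht h1
      have hT : G.twinCard y = Sᶜ.ncard := by
        refine le_antisymm (J.compl.twinCard_le (x := y) hy) ?_
        unfold twinCard
        rw [← Set.ncard_coe_finset]
        refine Nat.cast_le.mpr (Set.ncard_le_ncard fun z hz => ?_)
        simpa using hQ y hy z hz
      obtain ⟨h2, h3⟩ := J.two_lt_twinCard H hx hx' ht h1
      rw [← hT] at h h3
      have hfac : (G.twinCard y - 2) * (G.twinCard x' - 4) = 4 := by linear_combination -h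
      have hpos : 0 < G.twinCard x' - 4 := by
        by_contra hneg
        nlinarith
      have hle : G.twinCard x' - 4 ≤ 4 := by
        by_contra hgt
        have : 0 < G.twinCard y - 2 := by
          by_contra hneg
          nlinarith
        nlinarith
      have hx4 : G.twinCard x' = 5 ∨ G.twinCard x' = 6 ∨ G.twinCard x' = 7 ∨
        G.twinCard x' = 8 := by omega
      rcases hx4 with h | h | h | h <;> rw [h] at hfac <;> omega
  · push Not at hQ
    obtain ⟨y, hy, z, hz, hyz⟩ := hQ
    have hS : x₀ ∉ Sᶜ := by simpa using hx₀
    rcases J.side_cases H hx₀ hx₁ hx hy₀ with h | ⟨x, hx, x', hx', ht, h1⟩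
    · rcases J.compl.side_cases H (x₀ := y) (x₁ := z) hy hz hyz hS with
        h' | ⟨u, hu, u', hu', ht, h1⟩
      · refine ⟨S, J, ⟨x₀, hx₀⟩, ⟨y₀, hy₀⟩, Or.inl fun x => ?_⟩
        by_cases hx : x ∈ S
        · exact h x hx
        · exact h' x hx
      · exact absurd (h x₀ hx₀) (key J.compl hu hu' ht h1 hS).2
    · rcases J.compl.side_cases H (x₀ := y) (x₁ := z) hy hz hyz hS with
        h' | ⟨u, hu, u', hu', -, h2⟩
      · exact absurd (h' y hy) (key J hx hx' ht h1 hy).2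
      · exact absurd h2 (key J hx hx' ht h1 hu).1

end SimpleGraph

/-! ### The frame of a fork -/

namespace SimpleGraph

open Finset

/-- Two disjoint edges `a - u` and `b - w` without further edges between them such that `a, b` have
the same nonempty set of other neighbours, `u, w` have the same nonempty set of other neighbours,
and these two sets are disjoint. -/
structure Frame {V : Type*} (G : SimpleGraph V) (a u w b : V) : Prop where
  au : G.Adj a u
  bw : G.Adj b w
  ab : ¬ G.Adj a b
  uw : ¬ G.Adj u w
  aw : ¬ G.Adj a w
  bu : ¬ G.Adj b u
  ne_ab : a ≠ b
  ne_uw : u ≠ w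
  iff_ab : ∀ z, z ≠ u → z ≠ w → (G.Adj a z ↔ G.Adj b z)
  iff_uw : ∀ z, z ≠ a → z ≠ b → (G.Adj u z ↔ G.Adj w z)
  disj : ∀ z, G.Adj a z → ¬ G.Adj u z
  ex_ab : ∃ z, G.Adj a z ∧ G.Adj b z
  ex_uw : ∃ z, G.Adj u z ∧ G.Adj w z

/-- The two edges of a frame may be read backwards. -/
theorem Frame.swap {V : Type*} {G : SimpleGraph V} {a u w b : V} (F : G.Frame a u w b) :
    G.Frame u a b w where
  au := F.au.symm
  bw := F.bw.symm
  ab := F.uw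
  uw := F.ab
  aw := fun h => F.bu h.symm
  bu := fun h => F.aw h.symm
  ne_ab := F.ne_uw
  ne_uw := F.ne_ab
  iff_ab := F.iff_uw
  iff_uw := F.iff_ab
  disj := fun z h h' => F.disj z h' h
  ex_ab := F.ex_uw
  ex_uw := F.ex_ab

variable {V : Type*} [Fintype V] [DecidableEq V]

section

variable (G : SimpleGraph V) [DecidableRel G.Adj]

/-- The common neighbours of two vertices. -/
def common (x y : V) : Finset V := {z | G.Adj x z ∧ G.Adj y z}

/-- The number of neighbours of `x` in `S`. -/
def degIn (x : V) (S : Finset V) : ℕ := #{z ∈ S | G.Adj x z}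

/-- The vertices outside a frame that are not adjacent to it. -/
def far (a u w b : V) : Finset V :=
  {x | (¬ G.Adj a x ∧ ¬ G.Adj b x) ∧ ¬ G.Adj u x ∧ ¬ G.Adj w x}

/-- The far vertices with a neighbour in `common a b` and a far neighbour. -/
def matched (a u w b : V) : Finset V :=
  {x ∈ G.far a u w b | (∃ z ∈ G.common a b, G.Adj x z) ∧ ∃ y ∈ G.far a u w b, G.Adj x y}

/-- The far vertices with a neighbour in `common a b` and no far neighbour. -/
def pendant (a u w b : V) : Finset V :=
  {x ∈ G.far a u w b | (∃ z ∈ G.common a b, G.Adj x z) ∧ ∀ y ∈ G.far a u w b, ¬ G.Adj x y}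

end

variable {G : SimpleGraph V} [DecidableRel G.Adj]

theorem mem_common {x y z : V} : z ∈ G.common x y ↔ G.Adj x z ∧ G.Adj y z := by
  simp [common]

theorem mem_far {a u w b x : V} : x ∈ G.far a u w b ↔
    (¬ G.Adj a x ∧ ¬ G.Adj b x) ∧ ¬ G.Adj u x ∧ ¬ G.Adj w x := by
  simp [far]

theorem far_swap (a u w b : V) : G.far u a b w = G.far a u w b := by
  ext x
  simp only [mem_far]
  exact and_comm

theorem degIn_pos {x : V} {S : Finset V} : 0 < G.degIn x S ↔ ∃ z ∈ S, G.Adj x z := by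
  rw [degIn, card_pos]
  simp [Finset.Nonempty]

theorem degIn_le (x : V) (S : Finset V) : G.degIn x S ≤ #S := card_filter_le _ _

theorem degIn_eq_card {x : V} {S : Finset V} : G.degIn x S = #S ↔ ∀ z ∈ S, G.Adj x z := by
  rw [degIn, card_filter_eq_iff]

theorem degIn_eq_zero {x : V} {S : Finset V} : G.degIn x S = 0 ↔ ∀ z ∈ S, ¬ G.Adj x z := by
  rw [degIn, card_eq_zero, filter_eq_empty_iff]

theorem degIn_union (x : V) {S T : Finset V} (h : Disjoint S T) :
    G.degIn x (S ∪ T) = G.degIn x S + G.degIn x T := by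
  rw [degIn, filter_union, card_union_of_disjoint (disjoint_filter_filter h)]
  rfl

/-- The degree of `x`, computed on any set containing all neighbours. -/
theorem gram_self_eq_degIn {x : V} {S : Finset V} (h : ∀ z, G.Adj x z → z ∈ S) :
    G.gram x x = G.degIn x S - 1 := by
  rw [gram_self, degIn]
  congr 3
  ext z
  simp only [mem_filter, mem_univ, true_and]
  exact ⟨fun hz => ⟨h z hz, hz⟩, fun hz => hz.2⟩

/-- The outer four vertices of a fork form a frame. -/
theorem PlanarSpectrum.frame_of_fork (H : G.PlanarSpectrum) {a u c w b : V}
    (hF : G.Fork a u c w b) : G.Frame a u w b := by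
  have hiff := fun z => H.fork_adj_iff hF (z := z)
  have hab := H.fork_not_adj hF
  obtain ⟨⟨huc, hcw, huw, huw'⟩, hau, hac, haw, hbw, hbc, hbu⟩ := hF
  have e3 : a ≠ b := by rintro rfl; exact hbu hau
  have h1 : ∀ z, z ≠ u → z ≠ w → (G.Adj a z ↔ G.Adj b z) := by
    intro z hzu hzw
    by_cases hza : z = a
    · subst hza; simp [G.adj_comm b, hab]
    by_cases hzb : z = b
    · subst hzb; simp [hab]
    rw [G.adj_comm a, G.adj_comm b]
    exact (hiff z hza hzu hzw hzb).1
  have h2 : ∀ z, z ≠ a → z ≠ b → (G.Adj u z ↔ G.Adj w z) := by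
    intro z hza hzb
    by_cases hzu : z = u
    · subst hzu; simp [G.adj_comm w, huw']
    by_cases hzw : z = w
    · subst hzw; simp [huw']
    rw [G.adj_comm u, G.adj_comm w]
    exact (hiff z hza hzu hzw hzb).2
  refine ⟨hau, hbw, hab, huw', haw, hbu, e3, huw, h1, h2, ?_, ?_, ⟨c, huc, hcw.symm⟩⟩
  · intro z hza hzu
    have hzb : G.Adj b z := (h1 z hzu.ne' (by rintro rfl; exact haw hza)).mp hza
    have hzw : G.Adj w z := (h2 z hza.ne' (by rintro rfl; exact hab hza)).mp hzu
    rcases H.twin_of_triangle hau hza hzu with h | h | h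
    · exact hac (h.symm.adj_of_adj huc (by rintro rfl; exact haw hcw))
    · exact hab (h.adj_of_adj hzb.symm e3.symm)
    · exact huw' (h.adj_of_adj hzw.symm huw.symm)
  · have hpos := H.gram_self_pos a
    rw [gram_self] at hpos
    have hcard : 1 < #{z | G.Adj a z} := by omega
    obtain ⟨z, hz, hzu⟩ := exists_mem_ne hcard u
    simp only [mem_filter, mem_univ, true_and] at hz
    exact ⟨z, hz, (h1 z hzu (by rintro rfl; exact haw hz)).mp hz⟩

namespace Frame

variable {a u w b : V} (F : G.Frame a u w b)
include F

theorem adj_a_iff {z : V} : G.Adj a z ↔ z = u ∨ z ∈ G.common a b := by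
  rw [mem_common]
  constructor
  · intro h
    by_cases hzu : z = u
    · exact Or.inl hzu
    · exact Or.inr ⟨h, (F.iff_ab z hzu (by rintro rfl; exact F.aw h)).mp h⟩
  · rintro (rfl | h)
    · exact F.au
    · exact h.1

theorem adj_b_iff {z : V} : G.Adj b z ↔ z = w ∨ z ∈ G.common a b := by
  rw [mem_common]
  constructor
  · intro h
    by_cases hzw : z = w
    · exact Or.inl hzw
    · exact Or.inr ⟨(F.iff_ab z (by rintro rfl; exact F.bu h) hzw).mpr h, h⟩
  · rintro (rfl | h)
    · exact F.bw
    · exact h.2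

theorem u_notMem : u ∉ G.common a b := fun h => F.bu (mem_common.mp h).2

theorem w_notMem : w ∉ G.common a b := fun h => F.aw (mem_common.mp h).1

theorem a_notMem : a ∉ G.common a b := fun h => G.irrefl (mem_common.mp h).1

theorem b_notMem : b ∉ G.common a b := fun h => G.irrefl (mem_common.mp h).2

theorem not_adj_of_mem {z : V} (hz : z ∈ G.common a b) : ¬ G.Adj u z ∧ ¬ G.Adj w z := by
  have h1 := F.disj z (mem_common.mp hz).1
  refine ⟨h1, fun h2 => h1 ((F.iff_uw z ?_ ?_).mpr h2)⟩
  · rintro rfl; exact F.a_notMem hz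
  · rintro rfl; exact F.b_notMem hz

theorem disjoint_common : Disjoint (G.common a b) (G.common u w) := by
  rw [Finset.disjoint_left]
  intro z hz hz'
  exact (F.not_adj_of_mem hz).1 (mem_common.mp hz').1

theorem disjoint_common_far : Disjoint (G.common a b) (G.far a u w b) := by
  rw [Finset.disjoint_left]
  intro z hz hz'
  exact (mem_far.mp hz').1.1 (mem_common.mp hz).1

theorem vertex_cases (x : V) : x = a ∨ x = b ∨ x = u ∨ x = w ∨ x ∈ G.common a b ∨
    x ∈ G.common u w ∨ x ∈ G.far a u w b := by
  by_cases h1 : G.Adj a x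
  · rcases F.adj_a_iff.mp h1 with h | h <;> tauto
  by_cases h2 : G.Adj b x
  · rcases F.adj_b_iff.mp h2 with h | h <;> tauto
  by_cases h3 : G.Adj u x
  · rcases F.swap.adj_a_iff.mp h3 with h | h <;> tauto
  by_cases h4 : G.Adj w x
  · rcases F.swap.adj_b_iff.mp h4 with h | h <;> tauto
  have : x ∈ G.far a u w b := mem_far.mpr ⟨⟨h1, h2⟩, h3, h4⟩
  tauto

theorem gram_aa : G.gram a a = #(G.common a b) := by
  have h : ({z | G.Adj a z} : Finset V) = insert u (G.common a b) := by
    ext z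
    simp [F.adj_a_iff]
  rw [gram_self, h, card_insert_of_notMem F.u_notMem]
  push_cast; ring

theorem gram_au : G.gram a u = 0 := by
  rw [gram_of_ne F.au.ne, Nat.cast_eq_zero, card_eq_zero, filter_eq_empty_iff]
  rintro z - ⟨h1, h2⟩
  exact F.disj z h1 h2

theorem card_pos : 0 < #(G.common a b) := by
  obtain ⟨z, hz⟩ := F.ex_ab
  exact Finset.card_pos.mpr ⟨z, mem_common.mpr hz⟩

/-- Scalar products with `a` count neighbours in `common a b`, provided that `u` is not a
neighbour. -/
theorem gram_a_of_not_adj {x : V} (hxa : x ≠ a) (hxu : ¬ G.Adj u x) :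
    G.gram x a = G.degIn x (G.common a b) := by
  rw [gram_of_ne hxa, degIn]
  congr 2
  ext z
  simp only [mem_filter, mem_univ, true_and, F.adj_a_iff]
  constructor
  · rintro ⟨h1, rfl | h2⟩
    · exact absurd h1.symm hxu
    · exact ⟨h2, h1⟩
  · rintro ⟨h1, h2⟩
    exact ⟨h2, Or.inr h1⟩

/-- Scalar products with `u` for the common neighbours of `a, b` count `a` and the neighbours in
`common u w`. -/
theorem gram_u_of_mem {z : V} (hz : z ∈ G.common a b) :
    G.gram z u = 1 + G.degIn z (G.common u w) := by
  have hzu : z ≠ u := by rintro rfl; exact F.u_notMem hz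
  have h : ({y | G.Adj z y ∧ G.Adj u y} : Finset V)
      = insert a ({y ∈ G.common u w | G.Adj z y} : Finset V) := by
    ext y
    simp only [mem_filter, mem_univ, true_and, mem_insert, F.swap.adj_a_iff]
    constructor
    · rintro ⟨h1, rfl | h2⟩
      · exact Or.inl rfl
      · exact Or.inr ⟨h2, h1⟩
    · rintro (rfl | ⟨h1, h2⟩)
      · exact ⟨(mem_common.mp hz).1.symm, Or.inl rfl⟩
      · exact ⟨h2, Or.inr h1⟩
  rw [gram_of_ne hzu, h, card_insert_of_notMem]
  · rw [degIn]; push_cast; ring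
  · intro h
    exact F.swap.u_notMem (mem_filter.mp h).1

variable (H : G.PlanarSpectrum)
include H

/-- The scalar products in the orthogonal coordinates given by `a` and `u`. -/
theorem gram_expand (x y : V) :
    (#(G.common a b) : ℤ) * #(G.common u w) * G.gram x y =
      #(G.common u w) * (G.gram x a * G.gram y a) +
        #(G.common a b) * (G.gram x u * G.gram y u) := by
  have := H.gram_expand F.gram_au x y
  rwa [F.gram_aa, F.swap.gram_aa] at this

/-- The twins of a common neighbour `z` of `a, b` are `z` and its neighbours in `common a b`. -/
theorem twin_iff {z y : V} (hz : z ∈ G.common a b) :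
    G.Twin z y ↔ y = z ∨ (y ∈ G.common a b ∧ G.Adj z y) := by
  obtain ⟨hza, hzb⟩ := mem_common.mp hz
  constructor
  · intro h
    by_cases hyz : y = z
    · exact Or.inl hyz
    have hya : y ≠ a := by rintro rfl; exact F.ab (h.adj_of_adj hzb.symm F.ne_ab.symm)
    have hyb : y ≠ b := by rintro rfl; exact F.ab (h.adj_of_adj hza.symm F.ne_ab).symm
    exact Or.inr ⟨mem_common.mpr ⟨(h.adj_of_adj hza.symm hya.symm).symm,
      (h.adj_of_adj hzb.symm hyb.symm).symm⟩, h.adj (Ne.symm hyz)⟩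
  · rintro (rfl | ⟨hy, hadj⟩)
    · exact Twin.refl G _
    obtain ⟨hya, hyb⟩ := mem_common.mp hy
    rcases H.twin_of_triangle hadj hza.symm hya.symm with h | h | h
    · exact h
    · exact absurd (h.symm.adj_of_adj hzb.symm F.ne_ab.symm) F.ab
    · exact absurd (h.symm.adj_of_adj hyb.symm F.ne_ab.symm) F.ab

theorem twinCard_of_mem {z : V} (hz : z ∈ G.common a b) :
    G.twinCard z = G.degIn z (G.common a b) + 1 := by
  have h : ({y | G.Twin z y} : Finset V) =
      insert z ({y ∈ G.common a b | G.Adj z y} : Finset V) := by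
    ext y
    simp [F.twin_iff H hz]
  rw [twinCard, h, card_insert_of_notMem (by simp)]
  rfl

/-- Comparison of the two ways to compute the scalar product of adjacent vertices of the two
neighbourhoods. -/
theorem cross_relation {z c : V} (hz : z ∈ G.common a b) (hc : c ∈ G.common u w)
    (hzc : G.Adj z c) :
    (#(G.common a b) : ℤ) * #(G.common u w) *
        (G.degIn z (G.common a b) + G.degIn c (G.common u w)) =
      #(G.common u w) * (G.degIn z (G.common a b) * (1 + G.degIn c (G.common a b))) +
      #(G.common a b) * ((1 + G.degIn z (G.common u w)) * G.degIn c (G.common u w)) := by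
  have hza : z ≠ a := by rintro rfl; exact F.a_notMem hz
  have hcu : c ≠ u := by rintro rfl; exact F.swap.a_notMem hc
  have ht : ¬ G.Twin z c := by
    intro h
    rcases (F.twin_iff H hz).mp h with rfl | h
    · exact G.irrefl hzc
    · exact Finset.disjoint_left.mp F.disjoint_common h.1 hc
  have h := F.gram_expand H z c
  rw [H.gram_adj hzc ht, F.twinCard_of_mem H hz, F.swap.twinCard_of_mem H hc,
    F.gram_a_of_not_adj hza (F.not_adj_of_mem hz).1, F.gram_u_of_mem hz, F.swap.gram_u_of_mem hc,
    F.swap.gram_a_of_not_adj hcu (F.swap.not_adj_of_mem hc).1] at h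
  linear_combination h

/-- A far vertex does not have neighbours in both neighbourhoods of the frame. -/
theorem far_not_both {x z c : V} (hx : x ∈ G.far a u w b) (hz : z ∈ G.common a b)
    (hc : c ∈ G.common u w) (hxz : G.Adj x z) (hxc : G.Adj x c) : False := by
  obtain ⟨⟨hxa, -⟩, hxu, -⟩ := mem_far.mp hx
  obtain ⟨hza, -⟩ := mem_common.mp hz
  obtain ⟨hcu, -⟩ := mem_common.mp hc
  have hzu := (F.not_adj_of_mem hz).1
  have hca := (F.swap.not_adj_of_mem hc).1
  have hax : a ≠ x := by rintro rfl; exact hxu F.au.symm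
  have hux : u ≠ x := by rintro rfl; exact hxa F.au
  by_cases hzc : G.Adj z c
  · rcases H.twin_of_triangle hxz hxc hzc with h | h | h
    · exact hxa (h.symm.adj_of_adj hza.symm hax).symm
    · exact hxu (h.adj_of_adj hcu.symm hux).symm
    · exact hzu (h.adj_of_adj hcu.symm (by rintro rfl; exact F.u_notMem hz)).symm
  · -- otherwise `a, z, x, c, u` is an induced pentagon
    exact H.fork_not_adj (a := x) (u := z) (c := a) (w := u) (b := c)
      ⟨⟨hza.symm, F.au, by rintro rfl; exact F.u_notMem hz, fun h => hzu h.symm⟩, hxz,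
        fun h => hxa h.symm, fun h => hxu h.symm, hcu.symm, fun h => hca h.symm,
        fun h => hzc h.symm⟩ hxc

/-- A far vertex without neighbours in the two neighbourhoods of the frame would have scalar product
zero with `a` and `u`, so its planar vector would vanish. -/
theorem far_cases {x : V} (hx : x ∈ G.far a u w b) :
    (∃ z ∈ G.common a b, G.Adj x z) ∨ ∃ c ∈ G.common u w, G.Adj x c := by
  by_contra! hno
  obtain ⟨h1, h2⟩ := hno
  obtain ⟨⟨hxa, -⟩, hxu, -⟩ := mem_far.mp hx
  have hax : x ≠ a := by rintro rfl; exact hxu F.au.symm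
  have hux : x ≠ u := by rintro rfl; exact hxa F.au
  have h := F.gram_expand H x x
  rw [F.gram_a_of_not_adj hax hxu, F.swap.gram_a_of_not_adj hux hxa, degIn_eq_zero.mpr h1,
    degIn_eq_zero.mpr h2] at h
  have h3 := H.gram_self_pos x
  have h4 := F.card_pos
  have h5 := F.swap.card_pos
  have : (0 : ℤ) < (#(G.common a b) : ℤ) * #(G.common u w) * G.gram x x := by positivity
  rw [h] at this
  simp at this

/-- A far vertex with a neighbour in `common a b` either has no far neighbour, and then just two
of the four elements of `common a b` are its neighbours, or it has one far neighbour and is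
adjacent to all of `common a b`. -/
theorem far_degIn {x : V} (hx : x ∈ G.far a u w b) (hxz : ∃ z ∈ G.common a b, G.Adj x z) :
    (G.degIn x (G.far a u w b) = 0 ∧ G.degIn x (G.common a b) = 2 ∧ #(G.common a b) = 4) ∨
      (G.degIn x (G.far a u w b) = 1 ∧ G.degIn x (G.common a b) = #(G.common a b)) := by
  obtain ⟨⟨hxa, hxb⟩, hxu, hxw⟩ := mem_far.mp hx
  have hax : x ≠ a := by rintro rfl; exact hxu F.au.symm
  have hux : x ≠ u := by rintro rfl; exact hxa F.au
  have hC : ∀ c ∈ G.common u w, ¬ G.Adj x c := by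
    intro c hc hxc
    obtain ⟨z, hz, hxz⟩ := hxz
    exact F.far_not_both H hx hz hc hxz hxc
  have hself : G.gram x x = G.degIn x (G.common a b) + G.degIn x (G.far a u w b) - 1 := by
    rw [gram_self_eq_degIn (S := G.common a b ∪ G.far a u w b),
      degIn_union x F.disjoint_common_far]
    · push_cast; ring
    · intro y hxy
      rw [mem_union]
      rcases F.vertex_cases y with rfl | rfl | rfl | rfl | h | h | h
      · exact absurd hxy.symm hxa
      · exact absurd hxy.symm hxb
      · exact absurd hxy.symm hxu
      · exact absurd hxy.symm hxw
      · exact Or.inl h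
      · exact absurd hxy (hC y h)
      · exact Or.inr h
  have h := F.gram_expand H x x
  rw [F.gram_a_of_not_adj hax hxu, F.swap.gram_a_of_not_adj hux hxa, degIn_eq_zero.mpr hC,
    hself] at h
  have h1 := degIn_le x (G.common a b) (G := G)
  have h2 : 0 < G.degIn x (G.common a b) := degIn_pos.mpr hxz
  have h3 := F.swap.card_pos
  generalize G.degIn x (G.far a u w b) = j at *
  generalize G.degIn x (G.common a b) = k at *
  generalize #(G.common u w) = m at *
  generalize #(G.common a b) = n at *
  have h4 : (n : ℤ) * (k + j - 1) = k * k := by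
    have h3' : (m : ℤ) ≠ 0 := by exact_mod_cast h3.ne'
    refine mul_left_cancel₀ h3' ?_
    push_cast at h
    linear_combination h
  zify at h1 h2
  have hj : (j : ℤ) ≤ 1 := by
    by_contra hj
    nlinarith
  have hj' : j = 0 ∨ j = 1 := by omega
  rcases hj' with rfl | rfl
  · left
    have hk : (k : ℤ) - 1 ∣ 1 := ⟨n - k - 1, by push_cast at h4; linear_combination -h4⟩
    have hk1 : (k : ℤ) ≠ 1 := by
      intro hk
      rw [hk] at h4
      norm_num at h4
    have hk2 := Int.eq_one_of_dvd_one (by omega) hk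
    have hk3 : (k : ℤ) = 2 := by omega
    rw [hk3] at h4
    push_cast at h4
    refine ⟨rfl, by omega, by omega⟩
  · right
    refine ⟨rfl, ?_⟩
    have : (n : ℤ) = k := by
      refine mul_right_cancel₀ (b := (k : ℤ)) (by omega) ?_
      push_cast at h4
      linear_combination h4
    omega

end Frame
end SimpleGraph

/-! ### Counting the neighbours of a frame -/

namespace SimpleGraph

open Finset

variable {V : Type*} [Fintype V] [DecidableEq V] {G : SimpleGraph V} [DecidableRel G.Adj]

theorem mem_matched {a u w b x : V} : x ∈ G.matched a u w b ↔ x ∈ G.far a u w b ∧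
    (∃ z ∈ G.common a b, G.Adj x z) ∧ ∃ y ∈ G.far a u w b, G.Adj x y := by
  simp [matched]

theorem mem_pendant {a u w b x : V} : x ∈ G.pendant a u w b ↔ x ∈ G.far a u w b ∧
    (∃ z ∈ G.common a b, G.Adj x z) ∧ ∀ y ∈ G.far a u w b, ¬ G.Adj x y := by
  simp [pendant]

theorem disjoint_matched_pendant (a u w b : V) :
    Disjoint (G.matched a u w b) (G.pendant a u w b) := by
  rw [Finset.disjoint_left]
  intro x hx hx'
  obtain ⟨y, hy, hxy⟩ := (mem_matched.mp hx).2.2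
  exact (mem_pendant.mp hx').2.2 y hy hxy

/-- The degree equations of the frame with a single matched pair have one solution. -/
theorem eq_of_single_matched {n m p q f g : ℤ} (hn : 1 ≤ n) (hm : 1 ≤ m) (hp : p + 1 ≤ n)
    (hq : q + 1 ≤ m) (hp0 : 0 ≤ p) (hq0 : 0 ≤ q) (hf : 0 ≤ f) (hg : 0 ≤ g)
    (h1 : n * m * f + m * (p * (n - p)) = n) (h2 : m * n * g + n * (q * (m - q)) = m)
    (h3 : 0 < f → n = 4) (h4 : 0 < g → m = 4) : n = 2 ∧ m = 2 ∧ p = 1 ∧ q = 1 := by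
  have key : ∀ {n m p q f g : ℤ}, 1 ≤ n → 1 ≤ m → p + 1 ≤ n → q + 1 ≤ m → 0 ≤ p → 0 ≤ q → 0 ≤ f →
      0 ≤ g → n * m * f + m * (p * (n - p)) = n → m * n * g + n * (q * (m - q)) = m →
      (0 < f → n = 4) → f = 0 := by
    intro n m p q f g hn hm hp hq hp0 hq0 hf hg h1 h2 h3
    by_contra hf0
    have hf1 : 1 ≤ f := by omega
    have hn4 := h3 (by omega)
    subst hn4
    have : 0 ≤ m * (p * (4 - p)) := mul_nonneg (by linarith) (mul_nonneg hp0 (by linarith))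
    have hm1 : m = 1 := by nlinarith
    subst hm1
    have : q = 0 := by omega
    subst this
    omega
  have hf0 := key hn hm hp hq hp0 hq0 hf hg h1 h2 h3
  have hg0 := key hm hn hq hp hq0 hp0 hg hf h2 h1 h4
  subst hf0 hg0
  have hp1 : p ≠ 0 := by rintro rfl; linarith
  have hq1 : q ≠ 0 := by rintro rfl; linarith
  have hpp : 0 ≤ (p - 1) * (n - p - 1) := mul_nonneg (by omega) (by omega)
  have hqq : 0 ≤ (q - 1) * (m - q - 1) := mul_nonneg (by omega) (by omega)
  have x1 : n - 1 ≤ p * (n - p) := by linarith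
  have y1 : m - 1 ≤ q * (m - q) := by linarith
  have x2 : 2 * (p * (n - p)) ≤ m * (p * (n - p)) :=
    mul_le_mul_of_nonneg_right (by omega) (by omega)
  have y2 : 2 * (q * (m - q)) ≤ n * (q * (m - q)) :=
    mul_le_mul_of_nonneg_right (by omega) (by omega)
  omega

namespace Frame

variable {a u w b : V} (F : G.Frame a u w b) (H : G.PlanarSpectrum)
include F H

theorem matched_adj_common {x z : V} (hx : x ∈ G.matched a u w b) (hz : z ∈ G.common a b) :
    G.Adj x z := by
  obtain ⟨h1, h2, h3⟩ := mem_matched.mp hx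
  rcases F.far_degIn H h1 h2 with h | h
  · exact absurd h.1 (degIn_pos.mpr h3).ne'
  · exact degIn_eq_card.mp h.2 z hz

theorem matched_degIn {x : V} (hx : x ∈ G.matched a u w b) : G.degIn x (G.far a u w b) = 1 := by
  obtain ⟨h1, h2, h3⟩ := mem_matched.mp hx
  rcases F.far_degIn H h1 h2 with h | h
  · exact absurd h.1 (degIn_pos.mpr h3).ne'
  · exact h.1

/-- A far neighbour of a matched vertex is matched on the other side; otherwise both would be far
away from the path `u - c - w`. -/
theorem mem_matched_of_adj {x y : V} (hx : x ∈ G.matched a u w b) (hy : y ∈ G.far a u w b)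
    (hxy : G.Adj x y) : y ∈ G.matched u a b w := by
  obtain ⟨h1, ⟨z, hz, hxz⟩, -⟩ := mem_matched.mp hx
  refine mem_matched.mpr ⟨by rwa [far_swap], ?_, x, by rwa [far_swap], hxy.symm⟩
  by_contra! hno
  obtain ⟨c, hcu, hcw⟩ := F.ex_uw
  have hc : c ∈ G.common u w := mem_common.mpr ⟨hcu, hcw⟩
  have hx' := (mem_far.mp h1).2
  have hy' := (mem_far.mp hy).2
  exact H.false_of_far_edge ⟨hcu, hcw.symm, F.ne_uw, F.uw⟩ hxy (fun h => hx'.1 h.symm)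
    (fun h => F.far_not_both H h1 hz hc hxz h) (fun h => hx'.2 h.symm) (fun h => hy'.1 h.symm)
    (hno c hc) (fun h => hy'.2 h.symm)

theorem disjoint_matched : Disjoint (G.matched a u w b) (G.matched u a b w) := by
  rw [Finset.disjoint_left]
  intro x hx hx'
  obtain ⟨h1, ⟨z, hz, hxz⟩, -⟩ := mem_matched.mp hx
  obtain ⟨-, ⟨c, hc, hxc⟩, -⟩ := mem_matched.mp hx'
  exact F.far_not_both H h1 hz hc hxz hxc

theorem card_matched_le : #(G.matched a u w b) ≤ #(G.matched u a b w) := by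
  refine card_le_card_of_forall_subsingleton G.Adj (fun x hx => ?_) fun y hy x hx x' hx' => ?_
  · obtain ⟨h1, h2, y, hy, hxy⟩ := mem_matched.mp hx
    exact ⟨y, F.mem_matched_of_adj H hx hy hxy, hxy⟩
  · have h := F.swap.matched_degIn H hy
    rw [far_swap, degIn] at h
    obtain ⟨x₀, hx₀⟩ := card_eq_one.mp h
    have key : ∀ x, x ∈ G.matched a u w b → G.Adj x y → x = x₀ := by
      intro x hx hxy
      rw [← mem_singleton, ← hx₀]
      exact mem_filter.mpr ⟨(mem_matched.mp hx).1, hxy.symm⟩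
    rw [key x hx.1 hx.2, key x' hx'.1 hx'.2]

theorem card_matched_swap : #(G.matched u a b w) = #(G.matched a u w b) :=
  le_antisymm (F.swap.card_matched_le H) (F.card_matched_le H)

theorem far_eq : G.far a u w b = (G.matched a u w b ∪ G.pendant a u w b) ∪
    (G.matched u a b w ∪ G.pendant u a b w) := by
  ext x
  simp only [mem_union, mem_matched, mem_pendant, far_swap a u w b]
  constructor
  · intro hx
    by_cases h : ∃ y ∈ G.far a u w b, G.Adj x y
    · rcases F.far_cases H hx with h' | h'
      · exact Or.inl (Or.inl ⟨hx, h', h⟩)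
      · exact Or.inr (Or.inl ⟨hx, h', h⟩)
    · push Not at h
      rcases F.far_cases H hx with h' | h'
      · exact Or.inl (Or.inr ⟨hx, h', h⟩)
      · exact Or.inr (Or.inr ⟨hx, h', h⟩)
  · rintro ((h | h) | h | h) <;> exact h.1

theorem degIn_far {z : V} (hz : z ∈ G.common a b) :
    G.degIn z (G.far a u w b) = #(G.matched a u w b) + G.degIn z (G.pendant a u w b) := by
  have h1 : G.degIn z (G.matched a u w b) = #(G.matched a u w b) :=
    degIn_eq_card.mpr fun x hx => (F.matched_adj_common H hx hz).symm
  rw [← h1, ← degIn_union z (disjoint_matched_pendant a u w b), degIn, degIn]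
  congr 1
  ext x
  simp only [mem_filter, mem_union, mem_matched, mem_pendant]
  constructor
  · rintro ⟨hx, hzx⟩
    have : ∃ z ∈ G.common a b, G.Adj x z := ⟨z, hz, hzx.symm⟩
    by_cases h : ∃ y ∈ G.far a u w b, G.Adj x y
    · exact ⟨Or.inl ⟨hx, this, h⟩, hzx⟩
    · push Not at h
      exact ⟨Or.inr ⟨hx, this, h⟩, hzx⟩
  · rintro ⟨h | h, h'⟩ <;> exact ⟨h.1, h'⟩

theorem gram_self_of_mem {z : V} (hz : z ∈ G.common a b) :
    G.gram z z = G.degIn z (G.common a b) + G.degIn z (G.common u w) + #(G.matched a u w b) +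
      G.degIn z (G.pendant a u w b) + 1 := by
  obtain ⟨hza, hzb⟩ := mem_common.mp hz
  have hd2 : Disjoint (G.common u w) (G.far a u w b) := by
    rw [← far_swap]; exact F.swap.disjoint_common_far
  have hd1 : Disjoint (G.common a b) (G.common u w ∪ G.far a u w b) :=
    disjoint_union_right.mpr ⟨F.disjoint_common, F.disjoint_common_far⟩
  have ha : a ∉ G.common a b ∪ (G.common u w ∪ G.far a u w b) := by
    simp only [mem_union, not_or]
    exact ⟨F.a_notMem, F.swap.u_notMem, fun h => (mem_far.mp h).2.1 F.au.symm⟩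
  have hb : b ∉ G.common a b ∪ (G.common u w ∪ G.far a u w b) := by
    simp only [mem_union, not_or]
    exact ⟨F.b_notMem, F.swap.w_notMem, fun h => (mem_far.mp h).2.2 F.bw.symm⟩
  have hd0 : Disjoint ({a, b} : Finset V) (G.common a b ∪ (G.common u w ∪ G.far a u w b)) := by
    rw [Finset.disjoint_left]
    intro x hx
    rcases mem_insert.mp hx with rfl | hx
    · exact ha
    · rw [mem_singleton.mp hx]; exact hb
  have hab : G.degIn z {a, b} = 2 := by
    rw [← card_pair F.ne_ab, degIn_eq_card]
    intro x hx
    rcases mem_insert.mp hx with rfl | hx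
    · exact hza.symm
    · rw [mem_singleton.mp hx]; exact hzb.symm
  rw [gram_self_eq_degIn (S := {a, b} ∪ (G.common a b ∪ (G.common u w ∪ G.far a u w b))),
    degIn_union z hd0, degIn_union z hd1, degIn_union z hd2, hab, F.degIn_far H hz]
  · push_cast; ring
  · intro y hzy
    simp only [mem_union, mem_insert, mem_singleton]
    rcases F.vertex_cases y with h | h | rfl | rfl | h | h | h
    · tauto
    · tauto
    · exact absurd hzy.symm (F.not_adj_of_mem hz).1
    · exact absurd hzy.symm (F.not_adj_of_mem hz).2
    · tauto
    · tauto
    · tauto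

theorem degIn_common_lt {z : V} (hz : z ∈ G.common a b) :
    G.degIn z (G.common a b) < #(G.common a b) := by
  refine lt_of_le_of_ne (degIn_le z _) fun h => ?_
  exact G.irrefl (degIn_eq_card.mp h z hz)

/-- A vertex `z` of `common a b` is adjacent to all of `common u w`, or to all of it but one vertex,
and in the latter case it has no further neighbours besides `a` and `b`. -/
theorem common_cases {z : V} (hz : z ∈ G.common a b) :
    (G.degIn z (G.common u w) + 1 = #(G.common u w) ∧ G.degIn z (G.common a b) = 0 ∧
      #(G.matched a u w b) = 0 ∧ G.degIn z (G.pendant a u w b) = 0) ∨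
    (G.degIn z (G.common u w) = #(G.common u w) ∧
      (#(G.common a b) : ℤ) * #(G.common u w) + #(G.common a b) =
        #(G.common a b) * #(G.common u w) *
          (#(G.matched a u w b) + G.degIn z (G.pendant a u w b)) +
        #(G.common u w) * (G.degIn z (G.common a b) *
          (#(G.common a b) - G.degIn z (G.common a b)))) := by
  have hza : z ≠ a := by rintro rfl; exact F.a_notMem hz
  have h := F.gram_expand H z z
  rw [F.gram_self_of_mem H hz, F.gram_a_of_not_adj hza (F.not_adj_of_mem hz).1,
    F.gram_u_of_mem hz] at h
  have h1 := F.degIn_common_lt H hz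
  have h2 := degIn_le z (G.common u w) (G := G)
  have h3 := F.card_pos
  have h4 := F.swap.card_pos
  generalize G.degIn z (G.common u w) = e at *
  generalize G.degIn z (G.common a b) = p at *
  generalize G.degIn z (G.pendant a u w b) = f at *
  generalize #(G.matched a u w b) = k at *
  generalize #(G.common u w) = m at *
  generalize #(G.common a b) = n at *
  have hn : (0 : ℤ) < n := by exact_mod_cast h3
  have hm : (0 : ℤ) < m := by exact_mod_cast h4
  have hp : (p : ℤ) + 1 ≤ n := by exact_mod_cast h1
  have he : (e : ℤ) ≤ m := by exact_mod_cast h2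
  have hp0 : (0 : ℤ) ≤ p := Int.natCast_nonneg p
  have he0 : (0 : ℤ) ≤ e := Int.natCast_nonneg e
  have hk0 : (0 : ℤ) ≤ k := Int.natCast_nonneg k
  have hf0 : (0 : ℤ) ≤ f := Int.natCast_nonneg f
  have hpn : (0 : ℤ) ≤ m * (p * (n - p)) := by
    refine mul_nonneg hm.le (mul_nonneg hp0 (by linarith))
  have hmn : (0 : ℤ) ≤ n * m * (k + f) := by positivity
  have hrel : (n : ℤ) * ((1 + e) * (m - 1 - e)) + m * (p * (n - p)) + n * m * (k + f) = 0 := by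
    linear_combination h
  have hem : (m : ℤ) ≤ e + 1 := by
    by_contra hlt
    have : (0 : ℤ) < n * ((1 + e) * (m - 1 - e)) :=
      mul_pos hn (mul_pos (by linarith) (by linarith))
    linarith
  have hcases : (e : ℤ) = m ∨ (e : ℤ) + 1 = m := by omega
  rcases hcases with h5 | h5
  · right
    refine ⟨by exact_mod_cast h5, ?_⟩
    rw [h5] at hrel
    linear_combination -hrel
  · left
    rw [← h5] at hrel hpn hmn
    have hz1 : ((e : ℤ) + 1) * (p * (n - p)) = 0 := by linarith
    have hz2 : (n : ℤ) * (e + 1) * (k + f) = 0 := by linarith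
    have hz3 : (p : ℤ) = 0 := by
      rcases mul_eq_zero.mp hz1 with h | h
      · omega
      · rcases mul_eq_zero.mp h with h | h
        · exact h
        · omega
    have hz4 : (k : ℤ) + f = 0 := by
      rcases mul_eq_zero.mp hz2 with h | h
      · rcases mul_eq_zero.mp h with h | h <;> omega
      · exact h
    omega

theorem card_common_of_pendant {z : V} (h : 0 < G.degIn z (G.pendant a u w b)) :
    #(G.common a b) = 4 := by
  obtain ⟨x, hx, -⟩ := degIn_pos.mp h
  obtain ⟨h1, h2, h3⟩ := mem_pendant.mp hx
  rcases F.far_degIn H h1 h2 with h | h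
  · exact h.2.2
  · have := degIn_eq_zero.mpr h3
    omega

/-- The number of matched vertices determines the frame unless it is zero. -/
theorem card_matched : #(G.matched a u w b) = 0 ∨
    (#(G.matched a u w b) = 2 ∧ #(G.common a b) = 1 ∧ #(G.common u w) = 1) := by
  obtain ⟨z, hz'⟩ := F.ex_ab
  obtain ⟨c, hc'⟩ := F.ex_uw
  have hz := mem_common.mpr hz'
  have hc := mem_common.mpr hc'
  by_cases hk : #(G.matched a u w b) = 0
  · exact Or.inl hk
  right
  have h1 := F.card_pos
  have h2 := F.swap.card_pos
  have hp := F.degIn_common_lt H hz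
  have hq := F.swap.degIn_common_lt H hc
  have hf := F.card_common_of_pendant H (z := z)
  have hf' := F.swap.card_common_of_pendant H (z := c)
  rcases F.common_cases H hz with h | ⟨he, h3⟩
  · exact absurd h.2.2.1 hk
  rcases F.swap.common_cases H hc with h | ⟨he', h4⟩
  · rw [F.card_matched_swap H] at h
    exact absurd h.2.2.1 hk
  rw [F.card_matched_swap H] at h4
  have h5 := F.cross_relation H hz hc (degIn_eq_card.mp he c hc)
  rw [he, he'] at h5
  generalize G.degIn z (G.common a b) = p at *
  generalize G.degIn c (G.common u w) = q at *
  generalize G.degIn z (G.pendant a u w b) = f at *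
  generalize G.degIn c (G.pendant u a b w) = g at *
  generalize #(G.matched a u w b) = k at *
  generalize #(G.common u w) = m at *
  generalize #(G.common a b) = n at *
  have hn : (1 : ℤ) ≤ n := by exact_mod_cast h1
  have hm : (1 : ℤ) ≤ m := by exact_mod_cast h2
  have hp1 : (p : ℤ) + 1 ≤ n := by exact_mod_cast hp
  have hq1 : (q : ℤ) + 1 ≤ m := by exact_mod_cast hq
  have hk1 : (1 : ℤ) ≤ k := by omega
  have hp0 : (0 : ℤ) ≤ p := Int.natCast_nonneg p
  have hq0 : (0 : ℤ) ≤ q := Int.natCast_nonneg q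
  have hf0 : (0 : ℤ) ≤ f := Int.natCast_nonneg f
  have hg0 : (0 : ℤ) ≤ g := Int.natCast_nonneg g
  have hpn : (0 : ℤ) ≤ p * (n - p) := mul_nonneg hp0 (by linarith)
  have hqm : (0 : ℤ) ≤ q * (m - q) := mul_nonneg hq0 (by linarith)
  -- the contradiction for exactly one matched vertex
  have hmn : (n : ℤ) * m * (k - 1 + f) + m * (p * (n - p)) = n := by linear_combination -h3
  have hnm : (m : ℤ) * n * (k - 1 + g) + n * (q * (m - q)) = m := by linear_combination -h4
  by_cases hk2 : k = 1
  · exfalso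
    subst hk2
    have hmn' : (n : ℤ) * m * f + m * (p * (n - p)) = n := by push_cast at hmn; linarith
    have hnm' : (m : ℤ) * n * g + n * (q * (m - q)) = m := by push_cast at hnm; linarith
    obtain ⟨hn2, hm2, hp3, hq3⟩ := eq_of_single_matched hn hm hp1 hq1 hp0 hq0 hf0 hg0 hmn' hnm'
      (by omega) (by omega)
    rw [hn2, hm2, hp3, hq3] at h5
    norm_num at h5
  · have hk2' : (2 : ℤ) ≤ k := by omega
    have a1 : (n : ℤ) * m * 1 ≤ n * m * (k - 1 + f) :=
      mul_le_mul_of_nonneg_left (by linarith) (by positivity)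
    have a2 : (m : ℤ) * n * 1 ≤ m * n * (k - 1 + g) :=
      mul_le_mul_of_nonneg_left (by linarith) (by positivity)
    have a3 : 0 ≤ (m : ℤ) * (p * (n - p)) := mul_nonneg (by linarith) hpn
    have a4 : 0 ≤ (n : ℤ) * (q * (m - q)) := mul_nonneg (by linarith) hqm
    have b1 : (m : ℤ) = 1 := by nlinarith
    have b2 : (n : ℤ) = 1 := by nlinarith
    rw [b1, b2] at hmn
    have : (p : ℤ) = 0 := by linarith
    rw [this] at hmn
    omega

end Frame
end SimpleGraph

/-! ### Blow-ups -/

namespace SimpleGraph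

open Finset

/-- `G` arises from a pattern `K` on `ι` by replacing each `i` by `t i` vertices: there is a map of
the vertices to `ι` with fibres of size `t i` such that distinct vertices are adjacent if and only
if their images are related by `K`. For reflexive `K` the fibres are cliques. -/
def IsBlowup {V ι : Type*} [Fintype V] [DecidableEq ι] (G : SimpleGraph V) (K : ι → ι → Prop)
    (t : ι → ℕ) : Prop :=
  ∃ φ : V → ι, (∀ i, #{x | φ x = i} = t i) ∧ ∀ x y, G.Adj x y ↔ x ≠ y ∧ K (φ x) (φ y)

/-- A blow-up is determined by the pattern and the fibre sizes. -/
theorem IsBlowup.nonempty_iso {V W ι : Type*} [Fintype V] [Fintype W] [DecidableEq ι]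
    {G : SimpleGraph V} {H : SimpleGraph W} {K : ι → ι → Prop} {t : ι → ℕ}
    (hG : G.IsBlowup K t) (hH : H.IsBlowup K t) : Nonempty (G ≃g H) := by
  obtain ⟨φ, h1, h2⟩ := hG
  obtain ⟨ψ, h3, h4⟩ := hH
  have e : ∀ i, Nonempty ({x // φ x = i} ≃ {y // ψ y = i}) := fun i => by
    rw [← Fintype.card_eq, Fintype.card_subtype, Fintype.card_subtype, h1, h3]
  let E := Equiv.ofFiberEquiv (f := φ) (g := ψ) fun i => Classical.choice (e i)
  have hE : ∀ x, ψ (E x) = φ x := fun x => Equiv.ofFiberEquiv_map _ x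
  refine ⟨⟨E, fun {x y} => ?_⟩⟩
  rw [h2, h4, hE, hE, E.injective.ne_iff]

theorem IsBlowup.congr {V ι κ : Type*} [Fintype V] [DecidableEq ι] [DecidableEq κ]
    {G : SimpleGraph V} {K : ι → ι → Prop} {t : ι → ℕ} (hG : G.IsBlowup K t) (e : ι ≃ κ)
    {K' : κ → κ → Prop} {t' : κ → ℕ} (hK : ∀ i j, K i j ↔ K' (e i) (e j))
    (ht : ∀ i, t i = t' (e i)) : G.IsBlowup K' t' := by
  obtain ⟨φ, h1, h2⟩ := hG
  refine ⟨fun x => e (φ x), fun k => ?_, fun x y => by rw [h2, hK]⟩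
  obtain ⟨i, rfl⟩ := e.surjective k
  rw [← ht, ← h1]
  simp

/-- The pattern of the join of two disjoint unions of cliques. -/
def joinRel (α β : Type*) (i j : α ⊕ β) : Prop := i = j ∨ i.isLeft ≠ j.isLeft

instance (α β : Type*) [DecidableEq α] [DecidableEq β] : DecidableRel (joinRel α β) :=
  fun i j => inferInstanceAs (Decidable (i = j ∨ i.isLeft ≠ j.isLeft))

/-- The pattern with two classes indexed by `α`, completely joined up to a perfect matching, and one
further class joined to the first. -/
def crownRel (α : Type*) : α ⊕ α ⊕ Unit → α ⊕ α ⊕ Unit → Prop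
  | .inl i, .inl j => i = j
  | .inl i, .inr (.inl j) => i ≠ j
  | .inl _, .inr (.inr _) => True
  | .inr (.inl i), .inl j => i ≠ j
  | .inr (.inl i), .inr (.inl j) => i = j
  | .inr (.inl _), .inr (.inr _) => False
  | .inr (.inr _), .inl _ => True
  | .inr (.inr _), .inr (.inl _) => False
  | .inr (.inr _), .inr (.inr _) => True

/-- The pattern of the bipartite graph with biadjacency relation `N`. -/
def bipRel {α β : Type*} (N : α → β → Prop) : α ⊕ β → α ⊕ β → Prop
  | .inl i, .inl j => i = j
  | .inl i, .inr j => N i j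
  | .inr i, .inl j => N j i
  | .inr i, .inr j => i = j

/-- The biadjacency relation of the graph on ten vertices consisting of two adjacent hubs and four
independent edges, each of which joins a neighbour of one hub to a neighbour of the other. -/
def hubRel (i j : Option (Fin 4)) : Prop := i = none ∨ j = none ∨ i = j

/-- The biadjacency relation `[[J, J - I], [J - I, 0]]` with blocks of size three. -/
def blockRel (i j : Fin 3 × Bool) : Prop :=
  (i.2 = true ∧ j.2 = true) ∨ (i.2 ≠ j.2 ∧ i.1 ≠ j.1)

instance : DecidableRel hubRel :=
  fun i j => inferInstanceAs (Decidable (i = none ∨ j = none ∨ i = j))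

instance : DecidableRel blockRel :=
  fun i j => inferInstanceAs (Decidable ((i.2 = true ∧ j.2 = true) ∨ (i.2 ≠ j.2 ∧ i.1 ≠ j.1)))

/-- A bipartite graph with an explicit list of its vertices is a blow-up of its own pattern. That
the listed vertices are distinct is read off from their neighbourhoods. -/
theorem isBlowup_bipRel {V α β : Type*} [Fintype V] [DecidableEq α] [DecidableEq β]
    {G : SimpleGraph V} {N : α → β → Prop} (f : α → V) (g : β → V)
    (hrow : ∀ i i', (∀ j, N i j ↔ N i' j) → i = i') (hcol : ∀ j j', (∀ i, N i j ↔ N i j') → j = j')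
    (hex : ∀ i, ∃ j, N i j) (hsurj : ∀ x, (∃ i, x = f i) ∨ ∃ j, x = g j)
    (hff : ∀ i j, ¬ G.Adj (f i) (f j)) (hgg : ∀ i j, ¬ G.Adj (g i) (g j))
    (hN : ∀ i j, G.Adj (f i) (g j) ↔ N i j) :
    G.IsBlowup (bipRel N) fun _ => 1 := by
  have hf : Function.Injective f := fun i i' h => hrow i i' fun j => by rw [← hN, ← hN, h]
  have hg : Function.Injective g := fun j j' h => hcol j j' fun i => by rw [← hN, ← hN, h]
  have hfg : ∀ i j, f i ≠ g j := by
    intro i j h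
    obtain ⟨j', hj'⟩ := hex i
    rw [← hN, h] at hj'
    exact hgg j j' hj'
  have hbij : Function.Bijective (Sum.elim f g) := by
    refine ⟨hf.sumElim hg hfg, fun x => ?_⟩
    rcases hsurj x with ⟨i, rfl⟩ | ⟨j, rfl⟩
    · exact ⟨.inl i, rfl⟩
    · exact ⟨.inr j, rfl⟩
  refine ⟨(Equiv.ofBijective _ hbij).symm, fun i => ?_, fun x y => ?_⟩
  · rw [card_eq_one]
    refine ⟨Equiv.ofBijective _ hbij i, ?_⟩
    ext x
    simp [Equiv.symm_apply_eq]
  · obtain ⟨i, rfl⟩ := (Equiv.ofBijective _ hbij).surjective x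
    obtain ⟨j, rfl⟩ := (Equiv.ofBijective _ hbij).surjective y
    rw [Equiv.symm_apply_apply, Equiv.symm_apply_apply, (Equiv.injective _).ne_iff]
    rcases i with i | i <;> rcases j with j | j <;>
      simp [bipRel, hff, hgg, hN, G.adj_comm (g _), eq_comm]

/-- A graph with two independent sets `P`, `Q`, completely joined up to a perfect matching, and a
clique `Y` joined to `P` is a blow-up of the crown pattern. -/
theorem isBlowup_crownRel {V : Type*} [Fintype V] [DecidableEq V] {G : SimpleGraph V}
    (P Q Y : Finset V) (hcov : ∀ x, x ∈ P ∨ x ∈ Q ∨ x ∈ Y) (dPQ : Disjoint P Q)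
    (dPY : Disjoint P Y) (dQY : Disjoint Q Y) (hPP : ∀ x ∈ P, ∀ y ∈ P, ¬ G.Adj x y)
    (hQQ : ∀ x ∈ Q, ∀ y ∈ Q, ¬ G.Adj x y) (hYY : ∀ x ∈ Y, ∀ y ∈ Y, x ≠ y → G.Adj x y)
    (hPY : ∀ x ∈ P, ∀ y ∈ Y, G.Adj x y) (hQY : ∀ x ∈ Q, ∀ y ∈ Y, ¬ G.Adj x y)
    (hQ : ∀ q ∈ Q, ∃ p ∈ P, ¬ G.Adj p q ∧ ∀ p' ∈ P, ¬ G.Adj p' q → p' = p)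
    (hP : ∀ p ∈ P, ∃ q ∈ Q, ¬ G.Adj p q ∧ ∀ q' ∈ Q, ¬ G.Adj p q' → q' = q) :
    G.IsBlowup (crownRel (Fin #P))
      (Sum.elim (fun _ => 1) (Sum.elim (fun _ => 1) fun _ => #Y)) := by
  classical
  choose! σ hσ hσ' hσu using hQ
  let φ : V → P ⊕ P ⊕ Unit := fun x =>
    if h : x ∈ P then .inl ⟨x, h⟩
    else if h : x ∈ Q then .inr (.inl ⟨σ x, hσ x h⟩) else .inr (.inr ())
  have hφP : ∀ x (h : x ∈ P), φ x = .inl ⟨x, h⟩ := fun x h => dif_pos h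
  have hφQ : ∀ x (h : x ∈ Q), φ x = .inr (.inl ⟨σ x, hσ x h⟩) := fun x h => by
    have : x ∉ P := fun h' => Finset.disjoint_left.mp dPQ h' h
    simp [φ, this, h]
  have hφY : ∀ x (_ : x ∈ Y), φ x = .inr (.inr ()) := fun x h => by
    have h1 : x ∉ P := fun h' => Finset.disjoint_left.mp dPY h' h
    have h2 : x ∉ Q := fun h' => Finset.disjoint_left.mp dQY h' h
    simp [φ, h1, h2]
  have hσinj : ∀ q ∈ Q, ∀ q' ∈ Q, σ q = σ q' → q = q' := by
    intro q hq q' hq' h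
    obtain ⟨q₀, -, -, hq₀⟩ := hP (σ q) (hσ q hq)
    rw [hq₀ q hq (hσ' q hq), hq₀ q' hq' (h ▸ hσ' q' hq')]
  have hPQ : ∀ p ∈ P, ∀ q ∈ Q, G.Adj p q ↔ p ≠ σ q := by
    intro p hp q hq
    constructor
    · rintro h rfl
      exact hσ' q hq h
    · intro h
      by_contra h'
      exact h (hσu q hq p hp h')
  have hbl : G.IsBlowup (crownRel P)
      (Sum.elim (fun _ => 1) (Sum.elim (fun _ => 1) fun _ => #Y)) := by
    refine ⟨φ, ?_, ?_⟩
    · rintro (⟨p, hp⟩ | ⟨p, hp⟩ | ⟨⟩)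
      · refine card_eq_one.mpr ⟨p, ?_⟩
        ext x
        simp only [mem_filter, mem_univ, true_and, mem_singleton]
        rcases hcov x with h | h | h
        · simp [hφP x h]
        · simp only [hφQ x h, reduceCtorEq, false_iff]
          rintro rfl
          exact Finset.disjoint_left.mp dPQ hp h
        · simp only [hφY x h, reduceCtorEq, false_iff]
          rintro rfl
          exact Finset.disjoint_left.mp dPY hp h
      · obtain ⟨q, hq, hpq, -⟩ := hP p hp
        have hpσ : p = σ q := by
          by_contra h
          exact hpq ((hPQ p hp q hq).mpr h)
        refine card_eq_one.mpr ⟨q, ?_⟩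
        ext x
        simp only [mem_filter, mem_univ, true_and, mem_singleton]
        rcases hcov x with h | h | h
        · simp only [hφP x h, reduceCtorEq, false_iff]
          rintro rfl
          exact Finset.disjoint_left.mp dPQ h hq
        · simp only [hφQ x h, Sum.inr.injEq, Sum.inl.injEq, Subtype.mk.injEq, hpσ]
          exact ⟨hσinj x h q hq, fun h => by rw [h]⟩
        · simp only [hφY x h, Sum.inr.injEq, reduceCtorEq, false_iff]
          rintro rfl
          exact Finset.disjoint_left.mp dQY hq h
      · change _ = #Y
        congr 1
        ext x
        simp only [mem_filter, mem_univ, true_and]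
        rcases hcov x with h | h | h
        · simp [hφP x h, Finset.disjoint_left.mp dPY h]
        · simp [hφQ x h, Finset.disjoint_left.mp dQY h]
        · simp [hφY x h, h]
    · intro x y
      rcases hcov x with hx | hx | hx <;> rcases hcov y with hy | hy | hy
      · simp [hφP x hx, hφP y hy, crownRel, hPP x hx y hy]
      · simp only [hφP x hx, hφQ y hy, crownRel, hPQ x hx y hy, Subtype.mk.injEq, ne_eq]
        exact ⟨fun h => ⟨fun h' => Finset.disjoint_left.mp dPQ hx (h' ▸ hy), h⟩, fun h => h.2⟩
      · simp only [hφP x hx, hφY y hy, crownRel, hPY x hx y hy, and_true, true_iff]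
        exact fun h' => Finset.disjoint_left.mp dPY hx (h' ▸ hy)
      · simp only [hφQ x hx, hφP y hy, crownRel, G.adj_comm x y, hPQ y hy x hx, Subtype.mk.injEq,
          ne_eq]
        exact ⟨fun h => ⟨fun h' => Finset.disjoint_left.mp dPQ hy (h' ▸ hx), fun h' => h h'.symm⟩,
          fun h h' => h.2 h'.symm⟩
      · simp only [hφQ x hx, hφQ y hy, crownRel, hQQ x hx y hy, Subtype.mk.injEq, false_iff]
        exact fun h => h.1 (hσinj x hx y hy h.2)
      · simp [hφQ x hx, hφY y hy, crownRel, hQY x hx y hy]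
      · simp only [hφY x hx, hφP y hy, crownRel, and_true, G.adj_comm x y, hPY y hy x hx, true_iff]
        exact fun h' => Finset.disjoint_left.mp dPY hy (h' ▸ hx)
      · simp [hφY x hx, hφQ y hy, crownRel, G.adj_comm x y, hQY y hy x hx]
      · simp only [hφY x hx, hφY y hy, crownRel, and_true]
        exact ⟨fun h => h.ne, hYY x hx y hy⟩
  refine hbl.congr (Equiv.sumCongr P.equivFin (Equiv.sumCongr P.equivFin (Equiv.refl _))) ?_ ?_
  · rintro (i | i | i) (j | j | j) <;> simp [crownRel]
  · rintro (i | i | i) <;> rfl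

variable {V : Type*} [Fintype V] [DecidableEq V] {G : SimpleGraph V} [DecidableRel G.Adj]

theorem IsCliqueJoin.adj_iff_joinRel {S : Set V} (J : G.IsCliqueJoin S) {α β : Type*}
    {φ : V → α ⊕ β} (htwin : ∀ x y, φ x = φ y ↔ G.Twin x y)
    (hside : ∀ x y, (φ x).isLeft ≠ (φ y).isLeft ↔ ¬ (x ∈ S ↔ y ∈ S)) (x y : V) :
    G.Adj x y ↔ x ≠ y ∧ joinRel α β (φ x) (φ y) := by
  rw [joinRel, htwin, hside]
  constructor
  · intro h
    refine ⟨h.ne, ?_⟩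
    by_cases hS : x ∈ S ↔ y ∈ S
    · exact Or.inl (J.twin x y hS h)
    · exact Or.inr hS
  · rintro ⟨h1, h | h⟩
    · exact h.adj h1
    · by_cases hx : x ∈ S
      · exact J.cross x hx y fun hy => h ⟨fun _ => hy, fun _ => hx⟩
      · have hy : y ∈ S := by
          by_contra hy
          exact h ⟨fun h => absurd h hx, fun h => absurd h hy⟩
        exact (J.cross y hy x hx).symm

/-- The clique classes of a join, enumerated on both sides. -/
theorem IsCliqueJoin.exists_map {S : Set V} (J : G.IsCliqueJoin S) :
    ∃ (p q : ℕ) (φ : V → Fin p ⊕ Fin q), Function.Surjective φ ∧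
      (∀ x y, φ x = φ y ↔ G.Twin x y) ∧ (∀ x, (φ x).isLeft = true ↔ x ∈ S) ∧
      ∀ x y, G.Adj x y ↔ x ≠ y ∧ joinRel _ _ (φ x) (φ y) := by
  classical
  let r₁ : Setoid S := ⟨fun x y => G.Twin x y, fun _ => Twin.refl G _, Twin.symm, Twin.trans⟩
  let r₂ : Setoid (Sᶜ : Set V) :=
    ⟨fun x y => G.Twin x y, fun _ => Twin.refl G _, Twin.symm, Twin.trans⟩
  let e₁ := Fintype.equivFin (Quotient r₁)
  let e₂ := Fintype.equivFin (Quotient r₂)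
  let φ : V → Fin (Fintype.card (Quotient r₁)) ⊕ Fin (Fintype.card (Quotient r₂)) := fun x =>
    if h : x ∈ S then .inl (e₁ (Quotient.mk r₁ ⟨x, h⟩)) else .inr (e₂ (Quotient.mk r₂ ⟨x, h⟩))
  have hφ₁ : ∀ x (h : x ∈ S), φ x = .inl (e₁ (Quotient.mk r₁ ⟨x, h⟩)) := fun x h => dif_pos h
  have hφ₂ : ∀ x (h : x ∉ S), φ x = .inr (e₂ (Quotient.mk r₂ ⟨x, h⟩)) := fun x h => dif_neg h
  have htwin : ∀ x y, φ x = φ y ↔ G.Twin x y := by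
    intro x y
    by_cases hx : x ∈ S <;> by_cases hy : y ∈ S
    · rw [hφ₁ x hx, hφ₁ y hy, Sum.inl.injEq, e₁.injective.eq_iff]
      exact Quotient.eq (r := r₁)
    · rw [hφ₁ x hx, hφ₂ y hy]
      simp [J.not_twin x hx y hy]
    · rw [hφ₂ x hx, hφ₁ y hy]
      simp only [reduceCtorEq, false_iff]
      exact fun h => J.not_twin y hy x hx h.symm
    · rw [hφ₂ x hx, hφ₂ y hy, Sum.inr.injEq, e₂.injective.eq_iff]
      exact Quotient.eq (r := r₂)
  have hleft : ∀ x, (φ x).isLeft = true ↔ x ∈ S := by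
    intro x
    by_cases hx : x ∈ S
    · simp [hφ₁ x hx, hx]
    · simp [hφ₂ x hx, hx]
  refine ⟨_, _, φ, ?_, htwin, hleft, ?_⟩
  · rintro (i | i)
    · obtain ⟨⟨x, hx⟩, hq⟩ := Quotient.exists_rep (e₁.symm i)
      refine ⟨x, ?_⟩
      rw [hφ₁ x hx]
      exact congrArg Sum.inl (by rw [hq]; simp)
    · obtain ⟨⟨x, hx⟩, hq⟩ := Quotient.exists_rep (e₂.symm i)
      refine ⟨x, ?_⟩
      rw [hφ₂ x hx]
      exact congrArg Sum.inr (by rw [hq]; simp)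
  · exact J.adj_iff_joinRel htwin fun x y => by
      rw [← hleft, ← hleft, Ne, Bool.eq_iff_iff]

theorem card_fiber_eq_twinCard {ι : Type*} [DecidableEq ι] {φ : V → ι}
    (hφ : ∀ x y, φ x = φ y ↔ G.Twin x y) (x : V) :
    (#{y | φ y = φ x} : ℤ) = G.twinCard x := by
  unfold twinCard
  congr 2
  ext y
  simp only [mem_filter, mem_univ, true_and, hφ]
  exact ⟨Twin.symm, Twin.symm⟩

/-- The graphs without forks as blow-ups. -/
theorem PlanarSpectrum.join_isBlowup (H : G.PlanarSpectrum)
    (hB : ∀ a u c w b, ¬ G.Fork a u c w b) :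
    (∃ p q : ℕ, 1 ≤ p ∧ 1 ≤ q ∧ G.IsBlowup (joinRel (Fin p) (Fin q)) fun _ => 2) ∨
    (∃ l k : ℕ, 1 ≤ l ∧ 1 ≤ k ∧
      G.IsBlowup (joinRel (Fin 1) (Fin k)) (Sum.elim (fun _ => l) fun _ => 2)) ∨
    ∃ c b : ℕ, ((c = 3 ∧ b = 8) ∨ (c = 4 ∧ b = 6) ∨ (c = 6 ∧ b = 5)) ∧
      G.IsBlowup (joinRel (Fin 1) (Fin 2)) (Sum.elim (fun _ => c) ![1, b]) := by
  obtain ⟨S, J, ⟨x₀, hx₀⟩, ⟨y₀, hy₀⟩, h | ⟨h1, h2⟩ | ⟨x, hx, x', hx', hnt, h1, h2, h3, h4⟩⟩ :=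
    H.join_cases hB
  · left
    obtain ⟨p, q, φ, hs, ht, hl, hadj⟩ := J.exists_map
    refine ⟨p, q, ?_, ?_, φ, fun i => ?_, hadj⟩
    · have := (hl x₀).mpr hx₀
      rcases hi : φ x₀ with i | i
      · exact i.pos
      · simp [hi] at this
    · have := (hl y₀).not.mpr hy₀
      rcases hi : φ y₀ with i | i
      · simp [hi] at this
      · exact i.pos
    · obtain ⟨x, rfl⟩ := hs i
      have := card_fiber_eq_twinCard ht x
      rw [h x] at this
      exact_mod_cast this
  · right; left
    obtain ⟨k, q, φ, hs, ht, hl, hadj⟩ := J.exists_map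
    have hk : 1 ≤ k := by
      have := (hl x₀).mpr hx₀
      rcases hi : φ x₀ with i | i
      · exact i.pos
      · simp [hi] at this
    have hq : q = 1 := by
      have hy := (hl y₀).not.mpr hy₀
      rcases hi : φ y₀ with i | i
      · simp [hi] at hy
      · have : ∀ j, j = i := by
          intro j
          obtain ⟨y, hy⟩ := hs (.inr j)
          have hyS : y ∉ S := by rw [← hl, hy]; simp
          have := (ht y y₀).mpr (h2 y hyS y₀ hy₀)
          rw [hy, hi] at this
          exact Sum.inr.inj this
        have h0 := this ⟨0, i.pos⟩
        have h1 := this ⟨q - 1, by have := i.pos; omega⟩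
        rw [← h0] at h1
        have := congrArg Fin.val h1
        have := i.pos
        simp at *
        omega
    subst hq
    have hb : G.IsBlowup (joinRel (Fin k) (Fin 1))
        (Sum.elim (fun _ => 2) fun _ => #{y | φ y = φ y₀}) := by
      refine ⟨φ, fun i => ?_, hadj⟩
      obtain ⟨x, rfl⟩ := hs i
      rcases hi : φ x with i | i
      · have hxS : x ∈ S := by rw [← hl, hi]; simp
        have := card_fiber_eq_twinCard ht x
        rw [h1 x hxS, hi] at this
        exact_mod_cast this
      · have hy := (hl y₀).not.mpr hy₀
        rcases hj : φ y₀ with j | j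
        · simp [hj] at hy
        · rw [Subsingleton.elim j i]
          rfl
    refine ⟨#{y | φ y = φ y₀}, k, card_pos.mpr ⟨y₀, by simp⟩, hk,
      hb.congr (Equiv.sumComm _ _) ?_ ?_⟩
    · rintro (i | i) (j | j) <;> simp [joinRel]
    · rintro (i | i) <;> rfl
  · right; right
    have hc : ∃ c b : ℕ, (c : ℤ) = G.twinCard y₀ ∧ (b : ℤ) = G.twinCard x' := ⟨_, _, rfl, rfl⟩
    obtain ⟨c, b, hc, hb⟩ := hc
    refine ⟨c, b, ?_, ?_⟩
    · have := h4 y₀ hy₀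
      rw [← hc, ← hb] at this
      exact_mod_cast this
    classical
    have hxS : ∀ {z}, G.Twin x z → z ∈ S := fun h => (J.mem_iff h).mp hx
    have hx'S : ∀ {z}, G.Twin x' z → z ∈ S := fun h => (J.mem_iff h).mp hx'
    let φ : V → Fin 1 ⊕ Fin 2 := fun z =>
      if z ∈ S then (if G.Twin x z then .inr 0 else .inr 1) else .inl 0
    have hφ0 : ∀ z, φ z = .inl 0 ↔ z ∉ S := by
      intro z
      by_cases hz : z ∈ S <;> by_cases hz' : G.Twin x z <;> simp [φ, hz, hz']
    have hφ1 : ∀ z, φ z = .inr 0 ↔ G.Twin x z := by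
      intro z
      by_cases hz' : G.Twin x z
      · simp [φ, hxS hz', hz']
      · by_cases hz : z ∈ S <;> simp [φ, hz, hz']
    have hφ2 : ∀ z, φ z = .inr 1 ↔ G.Twin x' z := by
      intro z
      by_cases hz : z ∈ S
      · by_cases hz' : G.Twin x z
        · have : ¬ G.Twin x' z := fun h => hnt (hz'.trans h.symm)
          simp [φ, hz, hz', this]
        · simp [φ, hz, hz', (h1 z hz).resolve_left hz']
      · have : ¬ G.Twin x' z := fun h => hz (hx'S h)
        simp [φ, hz, this]
    have hcases : ∀ z, φ z = .inl 0 ∨ φ z = .inr 0 ∨ φ z = .inr 1 := by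
      intro z
      by_cases hz : z ∈ S <;> by_cases hz' : G.Twin x z <;> simp [φ, hz, hz']
    have htwin : ∀ z z', φ z = φ z' ↔ G.Twin z z' := by
      intro z z'
      rcases hcases z with h | h | h
      · rw [h, eq_comm, hφ0]
        rw [hφ0] at h
        exact ⟨fun h' => h2 z h z' h', fun h' => fun hS => h ((J.mem_iff h').mpr hS)⟩
      · rw [h, eq_comm, hφ1]
        rw [hφ1] at h
        exact ⟨fun h' => h.symm.trans h', fun h' => h.trans h'⟩
      · rw [h, eq_comm, hφ2]
        rw [hφ2] at h
        exact ⟨fun h' => h.symm.trans h', fun h' => h.trans h'⟩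
    have hside : ∀ z, (φ z).isLeft = true ↔ z ∉ S := by
      intro z
      rw [← hφ0]
      rcases hcases z with h | h | h <;> simp [h]
    refine ⟨φ, ?_, J.adj_iff_joinRel htwin fun z z' => ?_⟩
    · have hy₀' := (hφ0 y₀).mpr hy₀
      have hx₁ := (hφ1 x).mpr (Twin.refl G x)
      have hx₂ := (hφ2 x').mpr (Twin.refl G x')
      have k0 := card_fiber_eq_twinCard htwin y₀
      have k1 := card_fiber_eq_twinCard htwin x
      have k2 := card_fiber_eq_twinCard htwin x'
      rw [hy₀', ← hc] at k0
      rw [hx₁, h3] at k1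
      rw [hx₂, ← hb] at k2
      rintro (i | i)
      · rw [Subsingleton.elim i 0]
        exact_mod_cast k0
      · fin_cases i
        · exact_mod_cast k1
        · exact_mod_cast k2
    · rw [Ne, Bool.eq_iff_iff, hside, hside, not_iff_not]
      exact not_iff_not

end SimpleGraph

/-! ### Frames with matched far vertices -/

namespace SimpleGraph

open Finset

variable {V : Type*} [Fintype V] [DecidableEq V] {G : SimpleGraph V} [DecidableRel G.Adj]

theorem eq_of_degIn_eq_one {x y y' : V} {S : Finset V} (h : G.degIn x S = 1) (hy : y ∈ S)
    (hy' : y' ∈ S) (hxy : G.Adj x y) (hxy' : G.Adj x y') : y = y' :=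
  card_le_one.mp h.le y (mem_filter.mpr ⟨hy, hxy⟩) y' (mem_filter.mpr ⟨hy', hxy'⟩)

namespace Frame

variable {a u w b : V} (F : G.Frame a u w b) (H : G.PlanarSpectrum)
include F H

theorem pendant_eq_empty (h : #(G.common a b) ≠ 4) : G.pendant a u w b = ∅ := by
  refine eq_empty_of_forall_notMem fun x hx => h ?_
  obtain ⟨z, hz, hxz⟩ := (mem_pendant.mp hx).2.1
  exact F.card_common_of_pendant H (z := z) (degIn_pos.mpr ⟨x, hx, hxz.symm⟩)

/-- The two edges of the frame and the two edges between matched far vertices are the four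
independent edges; the hubs are the vertices of `common a b` and `common u w`. -/
theorem isBlowup_hub (hm : #(G.matched a u w b) = 2) (hz : #(G.common a b) = 1)
    (hc : #(G.common u w) = 1) : G.IsBlowup (bipRel hubRel) fun _ => 1 := by
  have hP := F.pendant_eq_empty H (by omega)
  have hP' := F.swap.pendant_eq_empty H (by omega)
  have hm' := F.card_matched_swap H
  rw [hm] at hm'
  obtain ⟨z, hZ⟩ := card_eq_one.mp hz
  obtain ⟨c, hC⟩ := card_eq_one.mp hc
  have hz0 : z ∈ G.common a b := hZ ▸ mem_singleton_self z
  have hc0 : c ∈ G.common u w := hC ▸ mem_singleton_self c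
  obtain ⟨x₁, x₂, hx12, hX⟩ := card_eq_two.mp hm
  have hx₁ : x₁ ∈ G.matched a u w b := by simp [hX]
  have hx₂ : x₂ ∈ G.matched a u w b := by simp [hX]
  obtain ⟨y₁, hy₁, h11⟩ := (mem_matched.mp hx₁).2.2
  obtain ⟨y₂, hy₂, h22⟩ := (mem_matched.mp hx₂).2.2
  have hy₁' := F.mem_matched_of_adj H hx₁ hy₁ h11
  have hy₂' := F.mem_matched_of_adj H hx₂ hy₂ h22
  have fx₁ := (mem_matched.mp hx₁).1
  have fx₂ := (mem_matched.mp hx₂).1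
  have hdeg : ∀ y ∈ G.matched u a b w, G.degIn y (G.far a u w b) = 1 := fun y hy => by
    rw [← far_swap]; exact F.swap.matched_degIn H hy
  have hy12 : y₁ ≠ y₂ := by
    rintro rfl
    exact hx12 (eq_of_degIn_eq_one (hdeg y₁ hy₁') fx₁ fx₂ h11.symm h22.symm)
  have hY : G.matched u a b w = {y₁, y₂} := by
    refine (eq_of_subset_of_card_le ?_ ?_).symm
    · simp [insert_subset_iff, hy₁', hy₂']
    · rw [hm', card_pair hy12]
  have hdisj : ∀ x ∈ G.matched a u w b, ∀ y ∈ G.matched u a b w, x ≠ y := fun x hx y hy h =>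
    Finset.disjoint_left.mp (F.disjoint_matched H) hx (h ▸ hy)
  have n12 : ¬ G.Adj x₁ y₂ := fun h =>
    hy12 (eq_of_degIn_eq_one (F.matched_degIn H hx₁) hy₁ hy₂ h11 h)
  have n21 : ¬ G.Adj x₂ y₁ := fun h =>
    hy12 (eq_of_degIn_eq_one (F.matched_degIn H hx₂) hy₁ hy₂ h h22)
  have nx : ¬ G.Adj x₁ x₂ := fun h =>
    hdisj x₂ hx₂ y₁ hy₁' (eq_of_degIn_eq_one (F.matched_degIn H hx₁) fx₂ hy₁ h h11)
  have ny : ¬ G.Adj y₁ y₂ := fun h =>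
    hdisj x₁ hx₁ y₂ hy₂' (eq_of_degIn_eq_one (hdeg y₁ hy₁') fx₁ hy₂ h11.symm h)
  have hzc : G.Adj z c := by
    rcases F.common_cases H hz0 with h | h
    · omega
    · exact degIn_eq_card.mp h.1 c hc0
  have xz : ∀ x ∈ G.matched a u w b, G.Adj x z := fun x hx => F.matched_adj_common H hx hz0
  have yc : ∀ y ∈ G.matched u a b w, G.Adj y c := fun y hy => F.swap.matched_adj_common H hy hc0
  have yz : ∀ y ∈ G.matched u a b w, ¬ G.Adj y z := fun y hy h =>
    F.far_not_both H (far_swap (G := G) a u w b ▸ (mem_matched.mp hy).1) hz0 hc0 h (yc y hy)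
  have xc : ∀ x ∈ G.matched a u w b, ¬ G.Adj x c := fun x hx h =>
    F.far_not_both H (mem_matched.mp hx).1 hz0 hc0 (xz x hx) h
  obtain ⟨haz, hbz⟩ := mem_common.mp hz0
  obtain ⟨huc, hwc⟩ := mem_common.mp hc0
  obtain ⟨huz, hwz⟩ := F.not_adj_of_mem hz0
  obtain ⟨hac, hbc⟩ := F.swap.not_adj_of_mem hc0
  obtain ⟨⟨kx1, kx2⟩, kx3, kx4⟩ := mem_far.mp fx₁
  obtain ⟨⟨kx5, kx6⟩, kx7, kx8⟩ := mem_far.mp fx₂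
  obtain ⟨⟨ky1, ky2⟩, ky3, ky4⟩ := mem_far.mp hy₁
  obtain ⟨⟨ky5, ky6⟩, ky7, ky8⟩ := mem_far.mp hy₂
  have xz₁ := xz x₁ hx₁
  have xz₂ := xz x₂ hx₂
  have yz₁ := yz y₁ hy₁'
  have yz₂ := yz y₂ hy₂'
  have xc₁ := xc x₁ hx₁
  have xc₂ := xc x₂ hx₂
  have yc₁ := yc y₁ hy₁'
  have yc₂ := yc y₂ hy₂'
  refine isBlowup_bipRel (fun i => i.elim z ![u, w, y₁, y₂]) (fun i => i.elim c ![a, b, x₁, x₂])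
    (by decide) (by decide) (by decide) (fun v => ?_) ?_ ?_ ?_
  · have hv := F.vertex_cases v
    rw [F.far_eq H, hP, hP', hX, hY, hZ, hC] at hv
    simp only [mem_union, mem_insert, mem_singleton, notMem_empty, or_false] at hv
    rcases hv with rfl | rfl | rfl | rfl | rfl | rfl | (rfl | rfl) | (rfl | rfl)
    exacts [.inr ⟨some 0, rfl⟩, .inr ⟨some 1, rfl⟩, .inl ⟨some 0, rfl⟩, .inl ⟨some 1, rfl⟩,
      .inl ⟨none, rfl⟩, .inr ⟨none, rfl⟩, .inr ⟨some 2, rfl⟩, .inr ⟨some 3, rfl⟩,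
      .inl ⟨some 2, rfl⟩, .inl ⟨some 3, rfl⟩]
  · have h : ∀ i j : Fin 4, ¬ G.Adj (![u, w, y₁, y₂] i) (![u, w, y₁, y₂] j) := by
      intro i j
      fin_cases i <;> fin_cases j
      exacts [G.irrefl, F.uw, ky3, ky7, fun h => F.uw h.symm, G.irrefl, ky4, ky8,
        fun h => ky3 h.symm, fun h => ky4 h.symm, G.irrefl, ny,
        fun h => ky7 h.symm, fun h => ky8 h.symm, fun h => ny h.symm, G.irrefl]
    have h' : ∀ i : Fin 4, ¬ G.Adj (![u, w, y₁, y₂] i) z := by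
      intro i
      fin_cases i
      exacts [huz, hwz, yz₁, yz₂]
    rintro (_ | i) (_ | j)
    exacts [G.irrefl, fun k => h' j k.symm, h' i, h i j]
  · have h : ∀ i j : Fin 4, ¬ G.Adj (![a, b, x₁, x₂] i) (![a, b, x₁, x₂] j) := by
      intro i j
      fin_cases i <;> fin_cases j
      exacts [G.irrefl, F.ab, kx1, kx5, fun h => F.ab h.symm, G.irrefl, kx2, kx6,
        fun h => kx1 h.symm, fun h => kx2 h.symm, G.irrefl, nx,
        fun h => kx5 h.symm, fun h => kx6 h.symm, fun h => nx h.symm, G.irrefl]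
    have h' : ∀ i : Fin 4, ¬ G.Adj (![a, b, x₁, x₂] i) c := by
      intro i
      fin_cases i
      exacts [hac, hbc, xc₁, xc₂]
    rintro (_ | i) (_ | j)
    exacts [G.irrefl, fun k => h' j k.symm, h' i, h i j]
  · have h : ∀ i j : Fin 4, G.Adj (![u, w, y₁, y₂] i) (![a, b, x₁, x₂] j) ↔ i = j := by
      intro i j
      fin_cases i <;> fin_cases j
      exacts [iff_of_true F.au.symm rfl, iff_of_false (fun h => F.bu h.symm) (by decide),
        iff_of_false kx3 (by decide), iff_of_false kx7 (by decide),
        iff_of_false (fun h => F.aw h.symm) (by decide), iff_of_true F.bw.symm rfl,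
        iff_of_false kx4 (by decide), iff_of_false kx8 (by decide),
        iff_of_false (fun h => ky1 h.symm) (by decide),
        iff_of_false (fun h => ky2 h.symm) (by decide),
        iff_of_true h11.symm rfl, iff_of_false (fun h => n21 h.symm) (by decide),
        iff_of_false (fun h => ky5 h.symm) (by decide),
        iff_of_false (fun h => ky6 h.symm) (by decide),
        iff_of_false (fun h => n12 h.symm) (by decide), iff_of_true h22.symm rfl]
    have hz' : ∀ j : Fin 4, G.Adj z (![a, b, x₁, x₂] j) := by
      intro j
      fin_cases j
      exacts [haz.symm, hbz.symm, xz₁.symm, xz₂.symm]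
    have hc' : ∀ i : Fin 4, G.Adj (![u, w, y₁, y₂] i) c := by
      intro i
      fin_cases i
      exacts [huc, hwc, yc₁, yc₂]
    rintro (_ | i) (_ | j)
    · exact iff_of_true hzc (.inl rfl)
    · exact iff_of_true (hz' j) (.inl rfl)
    · exact iff_of_true (hc' i) (.inr (.inl rfl))
    · exact (h i j).trans (by simp [hubRel])

end Frame

end SimpleGraph

/-! ### Frames without matched far vertices -/

namespace SimpleGraph

open Finset

variable {V : Type*} [Fintype V] [DecidableEq V] {G : SimpleGraph V} [DecidableRel G.Adj]

theorem exists_unique_not_adj {x : V} {S : Finset V} (h : G.degIn x S + 1 = #S) :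
    ∃ z ∈ S, ¬ G.Adj x z ∧ ∀ z' ∈ S, ¬ G.Adj x z' → z' = z := by
  have h1 : #{z ∈ S | ¬ G.Adj x z} = 1 := by
    have := card_filter_add_card_filter_not (s := S) (fun z => G.Adj x z)
    rw [degIn] at h
    omega
  obtain ⟨z, hz⟩ := card_eq_one.mp h1
  have hz' : ∀ y, y ∈ S ∧ ¬ G.Adj x y ↔ y = z := fun y => by
    rw [← mem_filter (p := fun y => ¬ G.Adj x y), hz, mem_singleton]
  exact ⟨z, ((hz' z).mpr rfl).1, ((hz' z).mpr rfl).2, fun y hy hy' => (hz' y).mp ⟨hy, hy'⟩⟩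

variable (G) in
/-- The elements of `common a b` adjacent to all of `common u w`. -/
def full (a u w b : V) : Finset V := {z ∈ G.common a b | ∀ c ∈ G.common u w, G.Adj z c}

variable (G) in
/-- The elements of `common a b` not adjacent to all of `common u w`. -/
def deficient (a u w b : V) : Finset V := {z ∈ G.common a b | ¬ ∀ c ∈ G.common u w, G.Adj z c}

theorem mem_full {a u w b z : V} :
    z ∈ G.full a u w b ↔ z ∈ G.common a b ∧ ∀ c ∈ G.common u w, G.Adj z c := by
  simp only [full, mem_filter]

theorem mem_deficient {a u w b z : V} :
    z ∈ G.deficient a u w b ↔ z ∈ G.common a b ∧ ¬ ∀ c ∈ G.common u w, G.Adj z c := by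
  simp only [deficient, mem_filter]

theorem card_full_add_card_deficient (a u w b : V) :
    #(G.full a u w b) + #(G.deficient a u w b) = #(G.common a b) :=
  card_filter_add_card_filter_not _

namespace Frame

variable {a u w b : V} (F : G.Frame a u w b) (H : G.PlanarSpectrum)
include F H

/-- If no far vertex is matched, then one of the two sides has no vertex adjacent to all of the
other side. -/
theorem full_eq_empty_or (hm : #(G.matched a u w b) = 0) :
    G.full u a b w = ∅ ∨ G.full a u w b = ∅ := by
  by_contra! hno
  obtain ⟨⟨c, hc⟩, ⟨z, hz⟩⟩ := hno
  obtain ⟨hc, hcf⟩ := mem_full.mp hc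
  obtain ⟨hz, hzf⟩ := mem_full.mp hz
  have e1 := degIn_eq_card.mpr hcf
  have e2 := degIn_eq_card.mpr hzf
  have h5 := F.cross_relation H hz hc (hzf c hc)
  have h3 := (F.common_cases H hz).resolve_left (by omega) |>.2
  have h4 := (F.swap.common_cases H hc).resolve_left (by omega) |>.2
  rw [F.card_matched_swap H, hm] at h4
  rw [hm] at h3
  rw [e1, e2] at h5
  have hf := F.card_common_of_pendant H (z := z)
  have p1 : (0 : ℤ) < #(G.common a b) := by exact_mod_cast F.card_pos
  have p2 : (0 : ℤ) < #(G.common u w) := by exact_mod_cast F.swap.card_pos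
  generalize G.degIn z (G.common a b) = p at *
  generalize G.degIn c (G.common u w) = q at *
  generalize G.degIn z (G.pendant a u w b) = f at *
  generalize G.degIn c (G.pendant u a b w) = g at *
  generalize #(G.common a b) = n at *
  generalize #(G.common u w) = m at *
  have hp0 : (0 : ℤ) ≤ p := by positivity
  have hq0 : (0 : ℤ) ≤ q := by positivity
  have h6 : (m : ℤ) * p + n * q = 0 := by linear_combination -h5
  have hp : (p : ℤ) = 0 := by nlinarith
  have hq : (q : ℤ) = 0 := by nlinarith
  rw [hp] at h3
  rw [hq] at h4
  have h7 : (m : ℤ) * (f - 1) = 1 := by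
    apply mul_left_cancel₀ p1.ne'
    push_cast at h3
    linear_combination -h3
  have h8 : (n : ℤ) * (g - 1) = 1 := by
    apply mul_left_cancel₀ p2.ne'
    push_cast at h4
    linear_combination -h4
  have hn : (n : ℤ) = 1 := by
    rcases Int.eq_one_or_neg_one_of_mul_eq_one h8 with h | h <;> omega
  have hm1 : (m : ℤ) = 1 := by
    rcases Int.eq_one_or_neg_one_of_mul_eq_one h7 with h | h <;> omega
  rw [hm1] at h7
  have := hf (by omega)
  omega

theorem deficient_degIn {z : V} (hz : z ∈ G.deficient a u w b) :
    G.degIn z (G.common u w) + 1 = #(G.common u w) ∧ G.degIn z (G.common a b) = 0 ∧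
      #(G.matched a u w b) = 0 ∧ G.degIn z (G.pendant a u w b) = 0 := by
  obtain ⟨h1, h2⟩ := mem_deficient.mp hz
  exact (F.common_cases H h1).resolve_right fun h => h2 (degIn_eq_card.mp h.1)

/-- The scalar product of a full vertex with itself. -/
theorem full_relation (hm : #(G.matched a u w b) = 0) {z : V} (hz : z ∈ G.full a u w b) :
    (#(G.common a b) : ℤ) * #(G.common u w) + #(G.common a b) =
      #(G.common a b) * #(G.common u w) * G.degIn z (G.pendant a u w b) +
      #(G.common u w) * (G.degIn z (G.common a b) *
        (#(G.common a b) - G.degIn z (G.common a b))) := by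
  obtain ⟨h1, h2⟩ := mem_full.mp hz
  have h3 := degIn_eq_card.mpr h2
  have h4 := (F.common_cases H h1).resolve_left (by omega) |>.2
  rw [hm] at h4
  push_cast at h4
  rw [h4]
  ring

/-- The neighbours of a full vertex in `common a b` are full. -/
theorem mem_full_of_adj {z z' : V} (hz : z ∈ G.full a u w b) (hz' : z' ∈ G.common a b)
    (h : G.Adj z z') : z' ∈ G.full a u w b := by
  by_contra hn
  have hd : z' ∈ G.deficient a u w b :=
    mem_deficient.mpr ⟨hz', fun hf => hn (mem_full.mpr ⟨hz', hf⟩)⟩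
  exact degIn_eq_zero.mp (F.deficient_degIn H hd).2.1 z (mem_full.mp hz).1 h.symm

/-- Full vertices have a common far neighbour unless they are adjacent. -/
theorem full_pair (hm : #(G.matched a u w b) = 0) {z z' : V}
    (hz : z ∈ G.full a u w b) (hz' : z' ∈ G.full a u w b) (hne : z ≠ z') (hadj : ¬ G.Adj z z') :
    (#(G.common a b) : ℤ) * #(G.common u w) *
        #{x ∈ G.far a u w b | G.Adj z x ∧ G.Adj z' x} =
      #(G.common u w) * (G.degIn z (G.common a b) * G.degIn z' (G.common a b)) +
      #(G.common a b) := by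
  obtain ⟨h1, h2⟩ := mem_full.mp hz
  obtain ⟨h1', h2'⟩ := mem_full.mp hz'
  have hza : z ≠ a := by rintro rfl; exact F.a_notMem h1
  have hza' : z' ≠ a := by rintro rfl; exact F.a_notMem h1'
  have h := F.gram_expand H z z'
  rw [F.gram_a_of_not_adj hza (F.not_adj_of_mem h1).1, F.gram_a_of_not_adj hza'
    (F.not_adj_of_mem h1').1, F.gram_u_of_mem h1, F.gram_u_of_mem h1', gram_of_ne hne,
    degIn_eq_card.mpr h2, degIn_eq_card.mpr h2'] at h
  have hd2 : Disjoint (G.common u w) {x ∈ G.far a u w b | G.Adj z x ∧ G.Adj z' x} := by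
    refine disjoint_of_subset_right (filter_subset _ _) ?_
    rw [← far_swap]; exact F.swap.disjoint_common_far
  have hd1 : Disjoint ({a, b} : Finset V)
      (G.common u w ∪ {x ∈ G.far a u w b | G.Adj z x ∧ G.Adj z' x}) := by
    rw [Finset.disjoint_left]
    intro y hy hy'
    rcases mem_union.mp hy' with k | k
    · rcases mem_insert.mp hy with rfl | hy
      · exact F.swap.u_notMem k
      · rw [mem_singleton.mp hy] at k
        exact F.swap.w_notMem k
    · have := mem_far.mp (mem_filter.mp k).1
      rcases mem_insert.mp hy with rfl | hy
      · exact this.2.1 F.au.symm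
      · rw [mem_singleton.mp hy] at this
        exact this.2.2 F.bw.symm
  have hcard : #{y | G.Adj z y ∧ G.Adj z' y} =
      2 + (#(G.common u w) + #{x ∈ G.far a u w b | G.Adj z x ∧ G.Adj z' x}) := by
    rw [← card_union_of_disjoint hd2, ← card_pair F.ne_ab, ← card_union_of_disjoint hd1]
    congr 1
    ext y
    simp only [mem_filter, mem_univ, true_and, mem_union, mem_insert, mem_singleton]
    constructor
    · intro hy
      rcases F.vertex_cases y with rfl | rfl | rfl | rfl | hyZ | hyC | hyO
      · simp
      · simp
      · exact absurd hy.1.symm (F.not_adj_of_mem h1).1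
      · exact absurd hy.1.symm (F.not_adj_of_mem h1).2
      -- a common neighbour in `common a b` would be a twin of both
      · refine absurd (Twin.adj ?_ hne) hadj
        exact ((F.twin_iff H h1).mpr (.inr ⟨hyZ, hy.1⟩)).trans
          ((F.twin_iff H h1').mpr (.inr ⟨hyZ, hy.2⟩)).symm
      · exact .inr (.inl hyC)
      · exact .inr (.inr ⟨hyO, hy⟩)
    · rintro ((rfl | rfl) | hyC | hyO)
      · exact ⟨(mem_common.mp h1).1.symm, (mem_common.mp h1').1.symm⟩
      · exact ⟨(mem_common.mp h1).2.symm, (mem_common.mp h1').2.symm⟩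
      · exact ⟨h2 y hyC, h2' y hyC⟩
      · exact hyO.2
  rw [hcard] at h
  push_cast at h
  linear_combination h

section

variable (hm : #(G.matched a u w b) = 0) (hC : G.full u a b w = ∅)
include hm hC

theorem mem_deficient_swap {c : V} (hc : c ∈ G.common u w) : c ∈ G.deficient u a b w := by
  refine mem_deficient.mpr ⟨hc, fun h => ?_⟩
  have : c ∈ G.full u a b w := mem_full.mpr ⟨hc, h⟩
  simp [hC] at this

theorem far_eq_pendant : G.far a u w b = G.pendant a u w b := by
  have h1 := card_eq_zero.mp hm
  have h2 : G.matched u a b w = ∅ := by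
    rw [← card_eq_zero, F.card_matched_swap H, hm]
  have h3 : G.pendant u a b w = ∅ := by
    refine eq_empty_of_forall_notMem fun x hx => ?_
    obtain ⟨c, hc, hxc⟩ := (mem_pendant.mp hx).2.1
    exact degIn_eq_zero.mp (F.swap.deficient_degIn H (F.mem_deficient_swap H hm hC hc)).2.2.2
      x hx hxc.symm
  rw [F.far_eq H, h1, h2, h3]
  simp

theorem exists_deficient {c : V} (hc : c ∈ G.common u w) :
    ∃ z ∈ G.deficient a u w b, ¬ G.Adj c z ∧ ∀ z' ∈ G.common a b, ¬ G.Adj c z' → z' = z := by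
  obtain ⟨z, hz, h1, h2⟩ :=
    exists_unique_not_adj (F.swap.deficient_degIn H (F.mem_deficient_swap H hm hC hc)).1
  exact ⟨z, mem_deficient.mpr ⟨hz, fun h => h1 (h c hc).symm⟩, h1, h2⟩

theorem exists_common {z : V} (hz : z ∈ G.deficient a u w b) :
    ∃ c ∈ G.common u w, ¬ G.Adj c z ∧ ∀ c' ∈ G.common u w, ¬ G.Adj c' z → c' = c := by
  obtain ⟨c, hc, h1, h2⟩ := exists_unique_not_adj (F.deficient_degIn H hz).1
  exact ⟨c, hc, fun h => h1 h.symm, fun c' hc' h => h2 c' hc' fun h' => h h'.symm⟩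

/-- Nonadjacency matches `common u w` with the deficient part of `common a b`. -/
theorem card_deficient : #(G.deficient a u w b) = #(G.common u w) := by
  refine le_antisymm ?_ ?_
  · refine card_le_card_of_forall_subsingleton (fun z c => ¬ G.Adj c z) (fun z hz => ?_)
      fun c hc z hz z' hz' => ?_
    · obtain ⟨c, hc, h, -⟩ := F.exists_common H hm hC hz
      exact ⟨c, hc, h⟩
    · obtain ⟨z₀, -, -, h⟩ := F.exists_deficient H hm hC hc
      rw [h z (mem_deficient.mp hz.1).1 hz.2, h z' (mem_deficient.mp hz'.1).1 hz'.2]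
  · refine card_le_card_of_forall_subsingleton (fun c z => ¬ G.Adj c z) (fun c hc => ?_)
      fun z hz c hc c' hc' => ?_
    · obtain ⟨z, hz, h, -⟩ := F.exists_deficient H hm hC hc
      exact ⟨z, hz, h⟩
    · obtain ⟨c₀, -, -, h⟩ := F.exists_common H hm hC hz
      rw [h c hc.1 hc.2, h c' hc'.1 hc'.2]

theorem card_common_eq : #(G.common a b) = #(G.full a u w b) + #(G.common u w) := by
  rw [← card_full_add_card_deficient, F.card_deficient H hm hC]

theorem not_adj_of_mem_common {c c' : V} (hc : c ∈ G.common u w) (hc' : c' ∈ G.common u w) :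
    ¬ G.Adj c c' :=
  degIn_eq_zero.mp (F.swap.deficient_degIn H (F.mem_deficient_swap H hm hC hc)).2.1 c' hc'

/-- Without far vertices the full vertices form a clique, and the graph is a crown with this clique
attached. -/
theorem isBlowup_crown (hfar : G.far a u w b = ∅) :
    ∃ N y : ℕ, ((3 ≤ N ∧ y = 0) ∨ (N = 4 ∧ y = 4) ∨ (N = 5 ∧ y = 3)) ∧
      G.IsBlowup (crownRel (Fin N))
        (Sum.elim (fun _ => 1) (Sum.elim (fun _ => 1) fun _ => y)) := by
  have hclique : ∀ z ∈ G.full a u w b, ∀ z' ∈ G.full a u w b, z ≠ z' → G.Adj z z' := by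
    intro z hz z' hz' hne
    by_contra hadj
    have h := F.full_pair H hm hz hz' hne hadj
    rw [hfar, filter_empty, card_empty] at h
    have p1 : (0 : ℤ) < #(G.common a b) := by exact_mod_cast F.card_pos
    have : (0 : ℤ) ≤ #(G.common u w) * (G.degIn z (G.common a b) * G.degIn z' (G.common a b)) := by
      positivity
    simp at h
    linarith
  have hdd : ∀ z ∈ G.deficient a u w b, ∀ z' ∈ G.common a b, ¬ G.Adj z z' := fun z hz z' hz' =>
    degIn_eq_zero.mp (F.deficient_degIn H hz).2.1 z' hz'
  have hcard := F.card_common_eq H hm hC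
  have p2 := F.swap.card_pos
  have hPcard : #({a, b} ∪ G.common u w) = #(G.common u w) + 2 := by
    rw [card_union_of_disjoint, card_pair F.ne_ab, add_comm]
    simp [F.swap.u_notMem, F.swap.w_notMem]
  refine ⟨#({a, b} ∪ G.common u w), #(G.full a u w b), ?_, isBlowup_crownRel ({a, b} ∪ G.common u w)
    ({u, w} ∪ G.deficient a u w b) (G.full a u w b) ?_ ?_ ?_ ?_ ?_ ?_ hclique ?_ ?_ ?_ ?_⟩
  · rw [hPcard]
    rcases Nat.eq_zero_or_pos #(G.full a u w b) with h | h
    · left; omega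
    · right
      obtain ⟨z, hz⟩ := Finset.card_pos.mp h
      have hrel := F.full_relation H hm hz
      have hp : G.degIn z (G.common a b) + 1 = #(G.full a u w b) := by
        rw [degIn, ← card_insert_of_notMem (a := z) (by simp)]
        congr 1
        ext y
        simp only [mem_insert, mem_filter]
        constructor
        · rintro (rfl | hy)
          · exact hz
          · exact F.mem_full_of_adj H hz hy.1 hy.2
        · intro hy
          by_cases hyz : y = z
          · exact .inl hyz
          · exact .inr ⟨(mem_full.mp hy).1, hclique z hz y hy fun h => hyz h.symm⟩
      have hf : G.degIn z (G.pendant a u w b) = 0 := by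
        rw [← F.far_eq_pendant H hm hC, hfar, degIn_eq_zero]
        simp
      rw [hf, hcard, ← hp] at hrel
      rw [← hp]
      generalize G.degIn z (G.common a b) = p at *
      generalize #(G.common u w) = m at *
      have h1 : ((m : ℤ) + 1) * ((m - 1) * (p - 1) - 2) = 0 := by
        push_cast at hrel
        linear_combination -hrel
      have h2 : ((m : ℤ) - 1) * (p - 1) = 2 := by
        rcases mul_eq_zero.mp h1 with h | h
        · omega
        · linarith
      have hm2 : 1 < (m : ℤ) := by
        by_contra hlt
        have : (m : ℤ) = 1 := by omega
        rw [this] at h2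
        simp at h2
      have hp2 : 1 < (p : ℤ) := by nlinarith
      have hm3 : (m : ℤ) ≤ 3 := by nlinarith
      have : m = 2 ∨ m = 3 := by omega
      rcases this with rfl | rfl
      · left; push_cast at h2; omega
      · right; push_cast at h2; omega
  · intro x
    have hx := F.vertex_cases x
    rw [hfar] at hx
    simp only [notMem_empty, or_false] at hx
    rcases hx with rfl | rfl | rfl | rfl | h | h
    · simp
    · simp
    · simp
    · simp
    · by_cases hx : x ∈ G.full a u w b
      · exact .inr (.inr hx)
      · exact .inr (.inl (mem_union_right _ (mem_deficient.mpr ⟨h, fun h' => hx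
          (mem_full.mpr ⟨h, h'⟩)⟩)))
    · simp [h]
  · rw [Finset.disjoint_left]
    simp only [mem_union, mem_insert, mem_singleton]
    rintro x ((rfl | rfl) | hx) ((h | h) | h)
    · exact F.au.ne h
    · exact F.ab (h ▸ F.bw.symm)
    · exact F.a_notMem (mem_deficient.mp h).1
    · exact F.ab (h ▸ F.au)
    · exact F.bw.ne h
    · exact F.b_notMem (mem_deficient.mp h).1
    · exact F.swap.a_notMem (h ▸ hx)
    · exact F.swap.b_notMem (h ▸ hx)
    · exact Finset.disjoint_left.mp F.disjoint_common (mem_deficient.mp h).1 hx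
  · rw [Finset.disjoint_left]
    simp only [mem_union, mem_insert, mem_singleton]
    rintro x ((rfl | rfl) | hx) h
    · exact F.a_notMem (mem_full.mp h).1
    · exact F.b_notMem (mem_full.mp h).1
    · exact Finset.disjoint_left.mp F.disjoint_common (mem_full.mp h).1 hx
  · rw [Finset.disjoint_left]
    simp only [mem_union, mem_insert, mem_singleton]
    rintro x ((rfl | rfl) | hx) h
    · exact F.u_notMem (mem_full.mp h).1
    · exact F.w_notMem (mem_full.mp h).1
    · exact (mem_deficient.mp hx).2 (mem_full.mp h).2
  · have h1 := fun c hc => (F.swap.not_adj_of_mem (z := c) hc).1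
    have h2 := fun c hc => (F.swap.not_adj_of_mem (z := c) hc).2
    simp only [mem_union, mem_insert, mem_singleton]
    rintro x ((rfl | rfl) | hx) y ((rfl | rfl) | hy)
    exacts [G.irrefl, F.ab, h1 y hy, fun h => F.ab h.symm, G.irrefl, h2 y hy,
      fun h => h1 x hx h.symm, fun h => h2 x hx h.symm, F.not_adj_of_mem_common H hm hC hx hy]
  · have h1 := fun z (hz : z ∈ G.deficient a u w b) => (F.not_adj_of_mem (mem_deficient.mp hz).1).1
    have h2 := fun z (hz : z ∈ G.deficient a u w b) => (F.not_adj_of_mem (mem_deficient.mp hz).1).2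
    simp only [mem_union, mem_insert, mem_singleton]
    rintro x ((rfl | rfl) | hx) y ((rfl | rfl) | hy)
    exacts [G.irrefl, F.uw, h1 y hy, fun h => F.uw h.symm, G.irrefl, h2 y hy,
      fun h => h1 x hx h.symm, fun h => h2 x hx h.symm, hdd x hx y (mem_deficient.mp hy).1]
  · simp only [mem_union, mem_insert, mem_singleton]
    rintro x ((rfl | rfl) | hx) y hy
    exacts [(mem_common.mp (mem_full.mp hy).1).1, (mem_common.mp (mem_full.mp hy).1).2,
      ((mem_full.mp hy).2 x hx).symm]
  · simp only [mem_union, mem_insert, mem_singleton]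
    rintro x ((rfl | rfl) | hx) y hy
    exacts [(F.not_adj_of_mem (mem_full.mp hy).1).1, (F.not_adj_of_mem (mem_full.mp hy).1).2,
      hdd x hx y (mem_full.mp hy).1]
  · simp only [mem_union, mem_insert, mem_singleton]
    rintro q ((rfl | rfl) | hq)
    · refine ⟨b, by simp, F.bu, ?_⟩
      rintro p ((rfl | rfl) | hp) h
      exacts [absurd F.au h, rfl, absurd (mem_common.mp hp).1.symm h]
    · refine ⟨a, by simp, F.aw, ?_⟩
      rintro p ((rfl | rfl) | hp) h
      exacts [rfl, absurd F.bw h, absurd (mem_common.mp hp).2.symm h]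
    · obtain ⟨c, hc, h1, h2⟩ := F.exists_common H hm hC hq
      refine ⟨c, .inr hc, h1, ?_⟩
      have hqc := mem_common.mp (mem_deficient.mp hq).1
      rintro p ((rfl | rfl) | hp) h
      exacts [absurd hqc.1 h, absurd hqc.2 h, h2 p hp h]
  · simp only [mem_union, mem_insert, mem_singleton]
    rintro p ((rfl | rfl) | hp)
    · refine ⟨w, by simp, F.aw, ?_⟩
      rintro q ((rfl | rfl) | hq) h
      exacts [absurd F.au h, rfl, absurd (mem_common.mp (mem_deficient.mp hq).1).1 h]
    · refine ⟨u, by simp, F.bu, ?_⟩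
      rintro q ((rfl | rfl) | hq) h
      exacts [rfl, absurd F.bw h, absurd (mem_common.mp (mem_deficient.mp hq).1).2 h]
    · obtain ⟨z, hz, h1, h2⟩ := F.exists_deficient H hm hC hp
      refine ⟨z, .inr hz, h1, ?_⟩
      have hpc := mem_common.mp hp
      rintro q ((rfl | rfl) | hq) h
      exacts [absurd hpc.1.symm h, absurd hpc.2.symm h, h2 q (mem_deficient.mp hq).1 h]

/-- With far vertices there are three independent full vertices, and each two of them have one
common far neighbour. -/
theorem card_full_of_far (hfar : (G.far a u w b).Nonempty) :
    #(G.full a u w b) = 3 ∧ #(G.common u w) = 1 ∧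
      ∀ z ∈ G.full a u w b, G.degIn z (G.common a b) = 0 := by
  obtain ⟨x, hx⟩ := hfar
  rw [F.far_eq_pendant H hm hC] at hx
  have hcard := F.card_common_eq H hm hC
  have p2 := F.swap.card_pos
  obtain ⟨hxf, ⟨z₀, hz₀, hxz₀⟩, hxn⟩ := mem_pendant.mp hx
  have hα : #(G.common a b) = 4 :=
    F.card_common_of_pendant H (z := z₀) (degIn_pos.mpr ⟨x, hx, hxz₀.symm⟩)
  have hdeg : ∀ x ∈ G.pendant a u w b, G.degIn x (G.common a b) = 2 := by
    intro x hx
    obtain ⟨h1, h2, h3⟩ := mem_pendant.mp hx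
    rcases F.far_degIn H h1 h2 with h | h
    · exact h.2.1
    · have := degIn_eq_zero.mpr h3
      omega
  have hsub : ({z ∈ G.common a b | G.Adj x z} : Finset V) ⊆ G.full a u w b := by
    intro z hz
    obtain ⟨hz, hxz⟩ := mem_filter.mp hz
    by_contra hn
    have hd := F.deficient_degIn H
      (mem_deficient.mpr ⟨hz, fun h => hn (mem_full.mpr ⟨hz, h⟩)⟩)
    exact degIn_eq_zero.mp hd.2.2.2 x hx hxz.symm
  have hy2 : 2 ≤ #(G.full a u w b) := by
    rw [← hdeg x hx]
    exact card_le_card hsub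
  -- a full vertex with a pendant neighbour `x` has at most one twin besides itself
  have hp : ∀ z ∈ G.full a u w b, 0 < G.degIn z (G.pendant a u w b) →
      G.degIn z (G.common a b) ≤ 1 := by
    intro z hz h
    obtain ⟨x, hx, hzx⟩ := degIn_pos.mp h
    have hzc := (mem_full.mp hz).1
    have : G.degIn z (G.common a b) + 1 ≤ G.degIn x (G.common a b) := by
      rw [degIn, ← card_insert_of_notMem (a := z) (by simp), degIn]
      refine card_le_card fun y hy => ?_
      have hyz : y = z ∨ (y ∈ G.common a b ∧ G.Adj z y) := by simpa using hy
      have hyc : y ∈ G.common a b := by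
        rcases hyz with rfl | h
        exacts [hzc, h.1]
      have ht := (F.twin_iff H hzc).mpr hyz
      refine mem_filter.mpr ⟨hyc, ?_⟩
      have hxy : x ≠ y := by
        rintro rfl
        exact Finset.disjoint_left.mp F.disjoint_common_far hyc (mem_pendant.mp hx).1
      rcases hyz with rfl | h
      · exact hzx.symm
      · exact (ht.adj_of_adj hzx hxy).symm
    rw [hdeg x hx] at this
    omega
  have hrel := fun z hz => F.full_relation H hm (z := z) hz
  rw [hα] at hrel hcard
  have hf : ∀ z ∈ G.full a u w b, 0 < G.degIn z (G.pendant a u w b) := by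
    intro z hz
    have := hrel z hz
    by_contra h0
    have h0 : G.degIn z (G.pendant a u w b) = 0 := by omega
    rw [h0] at this
    have hm2 : #(G.common u w) = 1 ∨ #(G.common u w) = 2 := by omega
    generalize (G.degIn z (G.common a b) : ℤ) = p at *
    rcases hm2 with h | h <;> rw [h] at this <;> push_cast at this <;>
      nlinarith [sq_nonneg (p - 2)]
  have hp0 : ∀ z ∈ G.full a u w b, #(G.common u w) = 1 ∧ G.degIn z (G.common a b) = 0 := by
    intro z hz
    have h1 := hp z hz (hf z hz)
    have h2 := hrel z hz
    have hm2 : #(G.common u w) = 1 ∨ #(G.common u w) = 2 := by omega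
    generalize G.degIn z (G.common a b) = p at *
    interval_cases p <;> rcases hm2 with h | h <;> rw [h] at h2 <;> push_cast at h2 <;> omega
  have h1 : #(G.common u w) = 1 := by
    obtain ⟨z, hz⟩ := Finset.card_pos.mp (by omega : 0 < #(G.full a u w b))
    exact (hp0 z hz).1
  exact ⟨by omega, h1, fun z hz => (hp0 z hz).2⟩

/-- The common far neighbour of two full vertices. -/
theorem exists_far_common (hfar : (G.far a u w b).Nonempty) {z z' : V}
    (hz : z ∈ G.full a u w b) (hz' : z' ∈ G.full a u w b) (hne : z ≠ z') :
    ∃ x ∈ G.far a u w b, (G.Adj z x ∧ G.Adj z' x ∧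
      ∀ y ∈ G.common a b, y ≠ z → y ≠ z' → ¬ G.Adj y x) ∧
      ∀ x' ∈ G.far a u w b, G.Adj z x' → G.Adj z' x' → x' = x := by
  obtain ⟨h1, h2, h3⟩ := F.card_full_of_far H hm hC hfar
  have hcard := F.card_common_eq H hm hC
  have hadj : ¬ G.Adj z z' := degIn_eq_zero.mp (h3 z hz) z' (mem_full.mp hz').1
  have h := F.full_pair H hm hz hz' hne hadj
  rw [h3 z hz, h3 z' hz', hcard, h1, h2] at h
  have h' : #{x ∈ G.far a u w b | G.Adj z x ∧ G.Adj z' x} = 1 := by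
    push_cast at h
    omega
  obtain ⟨x, hx⟩ := card_eq_one.mp h'
  have hx' : ∀ y, (y ∈ G.far a u w b ∧ G.Adj z y ∧ G.Adj z' y) ↔ y = x := fun y => by
    rw [← mem_filter (p := fun x => G.Adj z x ∧ G.Adj z' x), hx, mem_singleton]
  obtain ⟨hxf, hzx, hzx'⟩ := (hx' x).mpr rfl
  refine ⟨x, hxf, ⟨hzx, hzx', fun y hy hyz hyz' hyx => ?_⟩, fun x' h k k' => (hx' x').mp ⟨h, k, k'⟩⟩
  have hxP : x ∈ G.pendant a u w b := F.far_eq_pendant H hm hC ▸ hxf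
  obtain ⟨-, k1, k2⟩ := mem_pendant.mp hxP
  have k3 : G.degIn x (G.common a b) = 2 := by
    rcases F.far_degIn H hxf k1 with k | k
    · exact k.2.1
    · have := degIn_eq_zero.mpr k2
      omega
  have k4 : ({y, z, z'} : Finset V) ⊆ {y ∈ G.common a b | G.Adj x y} := by
    simp [insert_subset_iff, hy, (mem_full.mp hz).1, (mem_full.mp hz').1, hyx.symm, hzx.symm,
      hzx'.symm]
  have k5 := card_le_card k4
  rw [card_eq_three.mpr ⟨y, z, z', hyz, hyz', hne, rfl⟩] at k5
  rw [degIn] at k3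
  omega

end

end Frame

end SimpleGraph

namespace SimpleGraph

open Finset

variable {V : Type*} [Fintype V] [DecidableEq V] {G : SimpleGraph V} [DecidableRel G.Adj]

namespace Frame

variable {a u w b : V} (F : G.Frame a u w b) (H : G.PlanarSpectrum)
include F H

/-- The three full vertices are joined to `a`, `b` and the vertex `c` of `common u w`. The three far
vertices and the full ones are completely joined up to a matching, and so are `a, b, c` and `w, u`
and the deficient vertex. -/
theorem isBlowup_block (hm : #(G.matched a u w b) = 0) (hC : G.full u a b w = ∅)
    (hfar : (G.far a u w b).Nonempty) : G.IsBlowup (bipRel blockRel) fun _ => 1 := by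
  obtain ⟨hy, hc, hp⟩ := F.card_full_of_far H hm hC hfar
  have hd := F.card_deficient H hm hC
  rw [hc] at hd
  obtain ⟨c, hc⟩ := card_eq_one.mp hc
  obtain ⟨z, hz⟩ := card_eq_one.mp hd
  obtain ⟨y₀, y₁, y₂, n01, n02, n12, hY⟩ := card_eq_three.mp hy
  have hc0 : c ∈ G.common u w := hc ▸ mem_singleton_self c
  have hzd : z ∈ G.deficient a u w b := hz ▸ mem_singleton_self z
  have hz0 := (mem_deficient.mp hzd).1
  have h0 : y₀ ∈ G.full a u w b := by simp [hY]
  have h1 : y₁ ∈ G.full a u w b := by simp [hY]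
  have h2 : y₂ ∈ G.full a u w b := by simp [hY]
  obtain ⟨x₀, f0, ⟨a01, a02, a00⟩, u0⟩ := F.exists_far_common H hm hC hfar h1 h2 n12
  obtain ⟨x₁, f1, ⟨a10, a12, a11⟩, u1⟩ := F.exists_far_common H hm hC hfar h0 h2 n02
  obtain ⟨x₂, f2, ⟨a20, a21, a22⟩, u2⟩ := F.exists_far_common H hm hC hfar h0 h1 n01
  replace a00 := a00 y₀ (mem_full.mp h0).1 n01 n02
  replace a11 := a11 y₁ (mem_full.mp h1).1 n01.symm n12
  replace a22 := a22 y₂ (mem_full.mp h2).1 n02.symm n12.symm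
  have hpend := F.far_eq_pendant H hm hC
  have zx : ∀ x ∈ G.far a u w b, ¬ G.Adj x z := fun x hx h =>
    degIn_eq_zero.mp (F.deficient_degIn H hzd).2.2.2 x (hpend ▸ hx) h.symm
  have hcov : ∀ x ∈ G.far a u w b, x = x₀ ∨ x = x₁ ∨ x = x₂ := by
    intro x hx
    have hxP : x ∈ G.pendant a u w b := hpend ▸ hx
    obtain ⟨-, k1, k2⟩ := mem_pendant.mp hxP
    have k3 : G.degIn x (G.common a b) = 2 := by
      rcases F.far_degIn H hx k1 with k | k
      · exact k.2.1
      · have := degIn_eq_zero.mpr k2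
        omega
    obtain ⟨v, v', hne, hv⟩ := card_eq_two.mp k3
    have hmem : ∀ y, y = v ∨ y = v' → (y = y₀ ∨ y = y₁ ∨ y = y₂) ∧ G.Adj y x := by
      intro y hy
      have hy' : y ∈ ({z ∈ G.common a b | G.Adj x z} : Finset V) := by rw [hv]; simpa using hy
      obtain ⟨hyc, hxy⟩ := mem_filter.mp hy'
      refine ⟨?_, hxy.symm⟩
      by_contra hn
      have hyd : y ∈ G.deficient a u w b := by
        refine mem_deficient.mpr ⟨hyc, fun hf => hn ?_⟩
        have : y ∈ G.full a u w b := mem_full.mpr ⟨hyc, hf⟩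
        simpa [hY] using this
      rw [hz, mem_singleton] at hyd
      exact zx x hx (hyd ▸ hxy)
    obtain ⟨hv, kv⟩ := hmem v (.inl rfl)
    obtain ⟨hv', kv'⟩ := hmem v' (.inr rfl)
    rcases hv with rfl | rfl | rfl <;> rcases hv' with rfl | rfl | rfl
    exacts [absurd rfl hne, .inr (.inr (u2 x hx kv kv')), .inr (.inl (u1 x hx kv kv')),
      .inr (.inr (u2 x hx kv' kv)), absurd rfl hne, .inl (u0 x hx kv kv'),
      .inr (.inl (u1 x hx kv' kv)), .inl (u0 x hx kv' kv), absurd rfl hne]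
  have fu : ∀ x ∈ G.far a u w b, ¬ G.Adj u x := fun x hx => (mem_far.mp hx).2.1
  have fw : ∀ x ∈ G.far a u w b, ¬ G.Adj w x := fun x hx => (mem_far.mp hx).2.2
  have fa : ∀ x ∈ G.far a u w b, ¬ G.Adj a x := fun x hx => (mem_far.mp hx).1.1
  have fb : ∀ x ∈ G.far a u w b, ¬ G.Adj b x := fun x hx => (mem_far.mp hx).1.2
  have ff : ∀ x ∈ G.far a u w b, ∀ y ∈ G.far a u w b, ¬ G.Adj x y := fun x hx =>
    (mem_pendant.mp (hpend ▸ hx)).2.2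
  have fc : ∀ x ∈ G.far a u w b, ¬ G.Adj c x := fun x hx h => by
    obtain ⟨v, hv, hxv⟩ := (mem_pendant.mp (hpend ▸ hx)).2.1
    exact F.far_not_both H hx hv hc0 hxv h.symm
  have yy : ∀ y ∈ G.full a u w b, ∀ y' ∈ G.common a b, ¬ G.Adj y y' := fun y hy =>
    degIn_eq_zero.mp (hp y hy)
  have ya : ∀ y ∈ G.full a u w b, G.Adj a y := fun y hy => (mem_common.mp (mem_full.mp hy).1).1
  have yb : ∀ y ∈ G.full a u w b, G.Adj b y := fun y hy => (mem_common.mp (mem_full.mp hy).1).2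
  have yc : ∀ y ∈ G.full a u w b, G.Adj c y := fun y hy => ((mem_full.mp hy).2 c hc0).symm
  have yu : ∀ y ∈ G.full a u w b, ¬ G.Adj y u := fun y hy h =>
    (F.not_adj_of_mem (mem_full.mp hy).1).1 h.symm
  have yw : ∀ y ∈ G.full a u w b, ¬ G.Adj y w := fun y hy h =>
    (F.not_adj_of_mem (mem_full.mp hy).1).2 h.symm
  have zc : ¬ G.Adj c z := fun h => by
    have := (mem_deficient.mp hzd).2
    simp [hc, h.symm] at this
  obtain ⟨haz, hbz⟩ := mem_common.mp hz0
  obtain ⟨huc, hwc⟩ := mem_common.mp hc0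
  obtain ⟨huz, hwz⟩ := F.not_adj_of_mem hz0
  obtain ⟨hac, hbc⟩ := F.swap.not_adj_of_mem hc0
  have yF : ∀ i : Fin 3, ![y₀, y₁, y₂] i ∈ G.full a u w b := by
    intro i; fin_cases i; exacts [h0, h1, h2]
  have xF : ∀ i : Fin 3, ![x₀, x₁, x₂] i ∈ G.far a u w b := by
    intro i; fin_cases i; exacts [f0, f1, f2]
  refine isBlowup_bipRel (fun i => bif i.2 then ![a, b, c] i.1 else ![x₀, x₁, x₂] i.1)
    (fun i => bif i.2 then ![y₀, y₁, y₂] i.1 else ![w, u, z] i.1)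
    (by decide) (by decide) (by decide) (fun v => ?_) ?_ ?_ ?_
  · rcases F.vertex_cases v with rfl | rfl | rfl | rfl | hv | hv | hv
    · exact .inl ⟨(0, true), rfl⟩
    · exact .inl ⟨(1, true), rfl⟩
    · exact .inr ⟨(1, false), rfl⟩
    · exact .inr ⟨(0, false), rfl⟩
    · by_cases hf : v ∈ G.full a u w b
      · rw [hY] at hf
        simp only [mem_insert, mem_singleton] at hf
        rcases hf with rfl | rfl | rfl
        exacts [.inr ⟨(0, true), rfl⟩, .inr ⟨(1, true), rfl⟩, .inr ⟨(2, true), rfl⟩]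
      · have : v ∈ G.deficient a u w b :=
          mem_deficient.mpr ⟨hv, fun h => hf (mem_full.mpr ⟨hv, h⟩)⟩
        rw [hz, mem_singleton] at this
        exact .inr ⟨(2, false), this⟩
    · rw [hc, mem_singleton] at hv
      exact .inl ⟨(2, true), hv⟩
    · rcases hcov v hv with rfl | rfl | rfl
      exacts [.inl ⟨(0, false), rfl⟩, .inl ⟨(1, false), rfl⟩, .inl ⟨(2, false), rfl⟩]
  · have h : ∀ i j : Fin 3, ¬ G.Adj (![a, b, c] i) (![a, b, c] j) := by
      intro i j
      fin_cases i <;> fin_cases j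
      exacts [G.irrefl, F.ab, hac, fun h => F.ab h.symm, G.irrefl, hbc, fun h => hac h.symm,
        fun h => hbc h.symm, G.irrefl]
    have h' : ∀ i : Fin 3, ∀ x ∈ G.far a u w b, ¬ G.Adj (![a, b, c] i) x := by
      intro i
      fin_cases i
      exacts [fa, fb, fc]
    rintro ⟨i, _ | _⟩ ⟨j, _ | _⟩
    exacts [ff _ (xF i) _ (xF j), fun k => h' j _ (xF i) k.symm, h' i _ (xF j), h i j]
  · have h : ∀ i j : Fin 3, ¬ G.Adj (![w, u, z] i) (![w, u, z] j) := by
      intro i j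
      fin_cases i <;> fin_cases j
      exacts [G.irrefl, fun h => F.uw h.symm, hwz, F.uw, G.irrefl, huz, fun h => hwz h.symm,
        fun h => huz h.symm, G.irrefl]
    have h' : ∀ i : Fin 3, ∀ y ∈ G.full a u w b, ¬ G.Adj y (![w, u, z] i) := by
      intro i
      fin_cases i
      exacts [yw, yu, fun y hy => yy y hy z hz0]
    rintro ⟨i, _ | _⟩ ⟨j, _ | _⟩
    exacts [h i j, fun k => h' i _ (yF j) k.symm, h' j _ (yF i),
      yy _ (yF i) _ (mem_full.mp (yF j)).1]
  · have h : ∀ i j : Fin 3, G.Adj (![a, b, c] i) (![w, u, z] j) ↔ i ≠ j := by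
      intro i j
      fin_cases i <;> fin_cases j
      exacts [iff_of_false F.aw (by decide), iff_of_true F.au (by decide),
        iff_of_true haz (by decide), iff_of_true F.bw (by decide), iff_of_false F.bu (by decide),
        iff_of_true hbz (by decide), iff_of_true hwc.symm (by decide),
        iff_of_true huc.symm (by decide), iff_of_false zc (by decide)]
    have h' : ∀ i j : Fin 3, G.Adj (![x₀, x₁, x₂] i) (![y₀, y₁, y₂] j) ↔ i ≠ j := by
      intro i j
      fin_cases i <;> fin_cases j
      exacts [iff_of_false (fun h => a00 h.symm) (by decide), iff_of_true a01.symm (by decide),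
        iff_of_true a02.symm (by decide), iff_of_true a10.symm (by decide),
        iff_of_false (fun h => a11 h.symm) (by decide), iff_of_true a12.symm (by decide),
        iff_of_true a20.symm (by decide), iff_of_true a21.symm (by decide),
        iff_of_false (fun h => a22 h.symm) (by decide)]
    have k : ∀ i : Fin 3, ∀ y ∈ G.full a u w b, G.Adj (![a, b, c] i) y := by
      intro i
      fin_cases i
      exacts [ya, yb, yc]
    have k' : ∀ i : Fin 3, ∀ x ∈ G.far a u w b, ¬ G.Adj x (![w, u, z] i) := by
      intro i
      fin_cases i
      exacts [fun x hx h => fw x hx h.symm, fun x hx h => fu x hx h.symm, zx]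
    rintro ⟨i, _ | _⟩ ⟨j, _ | _⟩
    · exact iff_of_false (k' j _ (xF i)) (by simp [blockRel])
    · exact (h' i j).trans (by simp [blockRel])
    · exact (h i j).trans (by simp [blockRel])
    · exact iff_of_true (k i _ (yF j)) (by simp [blockRel])

/-- The graphs with forks as blow-ups. -/
theorem isBlowup :
    (∃ N y : ℕ, ((3 ≤ N ∧ y = 0) ∨ (N = 4 ∧ y = 4) ∨ (N = 5 ∧ y = 3)) ∧
      G.IsBlowup (crownRel (Fin N))
        (Sum.elim (fun _ => 1) (Sum.elim (fun _ => 1) fun _ => y))) ∨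
    G.IsBlowup (bipRel hubRel) (fun _ => 1) ∨ G.IsBlowup (bipRel blockRel) fun _ => 1 := by
  rcases F.card_matched H with hm | ⟨h1, h2, h3⟩
  · have key : ∀ {a u w b : V}, G.Frame a u w b → #(G.matched a u w b) = 0 →
        G.full u a b w = ∅ → _ := fun {a u w b} (F : G.Frame a u w b) hm hC =>
      (G.far a u w b).eq_empty_or_nonempty.imp (F.isBlowup_crown H hm hC) (F.isBlowup_block H hm hC)
    rcases F.full_eq_empty_or H hm with h | h
    · exact (key F hm h).imp_right .inr
    · exact (key F.swap ((F.card_matched_swap H).trans hm) h).imp_right .inr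
  · exact .inr (.inl (F.isBlowup_hub H h1 h2 h3))

end Frame

end SimpleGraph

/-! ### Traces of blow-ups -/

namespace SimpleGraph

open Finset Matrix

/-- The entries of a pattern. -/
def entry {ι : Type*} (K : ι → ι → Prop) [DecidableRel K] (i j : ι) : ℤ := if K i j then 1 else 0

/-- Summation over the fibres of `φ`. -/
theorem sum_comp_of_card_fiber {V ι : Type*} [Fintype V] [Fintype ι] [DecidableEq ι] {φ : V → ι}
    {t : ι → ℕ} (h : ∀ i, #{x | φ x = i} = t i) (F : ι → ℤ) :
    ∑ x, F (φ x) = ∑ i, t i * F i := by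
  rw [← Finset.sum_fiberwise univ φ]
  refine sum_congr rfl fun i _ => ?_
  rw [← h, sum_congr rfl fun x hx => by rw [(mem_filter.mp hx).2], sum_const, nsmul_eq_mul]

/-- The traces of the first powers of `A + 1` for a blow-up of a reflexive pattern. -/
theorem IsBlowup.trace_pow {V ι : Type*} [Fintype V] [DecidableEq V] [Fintype ι] [DecidableEq ι]
    {G : SimpleGraph V} [DecidableRel G.Adj] {K : ι → ι → Prop} [DecidableRel K] {t : ι → ℕ}
    (hG : G.IsBlowup K t) (hK : ∀ i, K i i) :
    ((G.adjMatrix ℝ + 1) ^ 0).trace = ((∑ i, (t i : ℤ) : ℤ) : ℝ) ∧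
    ((G.adjMatrix ℝ + 1) ^ 2).trace =
      ((∑ i, t i * ∑ j, t j * (entry K i j * entry K j i) : ℤ) : ℝ) ∧
    ((G.adjMatrix ℝ + 1) ^ 3).trace =
      ((∑ i, t i * ∑ j, t j * ∑ k, t k * (entry K i j * entry K j k * entry K k i) : ℤ) : ℝ) := by
  obtain ⟨φ, ht, hadj⟩ := hG
  have hM : ∀ x y, (G.adjMatrix ℝ + 1) x y = ((entry K (φ x) (φ y) : ℤ) : ℝ) := by
    intro x y
    rw [Matrix.add_apply, adjMatrix_apply, one_apply, entry]
    by_cases h : x = y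
    · subst h; simp [hK]
    · simp [hadj, h]
  refine ⟨?_, ?_, ?_⟩
  · have := sum_comp_of_card_fiber ht fun _ => 1
    simp only [mul_one, sum_const, card_univ, nsmul_eq_mul] at this
    rw [pow_zero, trace_one, ← this]
    simp
  · rw [← sum_comp_of_card_fiber ht fun i => ∑ j, t j * (entry K i j * entry K j i)]
    simp_rw [← sum_comp_of_card_fiber ht fun j => entry K _ j * entry K j _]
    simp only [Matrix.trace, Matrix.diag, pow_two, Matrix.mul_apply, hM]
    push_cast
    rfl
  · rw [← sum_comp_of_card_fiber ht fun i =>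
      ∑ j, t j * ∑ k, t k * (entry K i j * entry K j k * entry K k i)]
    simp_rw [← sum_comp_of_card_fiber ht fun j =>
      ∑ k, t k * (entry K _ j * entry K j k * entry K k _)]
    simp_rw [← sum_comp_of_card_fiber ht fun k => entry K _ _ * entry K _ k * entry K k _]
    simp only [Matrix.trace, Matrix.diag, pow_succ, pow_zero, Matrix.mul_apply, hM, Matrix.one_mul,
      sum_mul]
    push_cast
    exact sum_congr rfl fun x _ => sum_comm

theorem sum_mul_mul_self {α : Type*} [Fintype α] (f : α → ℤ) (c : ℤ) :
    ∑ i, f i * (c * f i) = c * ∑ i, f i ^ 2 := by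
  rw [mul_sum]; exact sum_congr rfl fun i _ => by ring

theorem sum_mul_self_mul {α : Type*} [Fintype α] (f : α → ℤ) (c : ℤ) :
    ∑ i, f i * (f i * c) = c * ∑ i, f i ^ 2 := by
  rw [mul_sum]; exact sum_congr rfl fun i _ => by ring

/-- The second and third trace for the join of two disjoint unions of cliques of sizes `f` and `g`.
-/
theorem sum_joinRel {α β : Type*} [Fintype α] [Fintype β] [DecidableEq α] [DecidableEq β]
    (f : α → ℕ) (g : β → ℕ) (t : α ⊕ β → ℕ) (ht : t = Sum.elim f g) :
    (∑ i, (t i : ℤ) * ∑ j, (t j : ℤ) *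
        (entry (joinRel α β) i j * entry (joinRel α β) j i)) =
      ∑ i, (f i : ℤ) ^ 2 + ∑ i, (g i : ℤ) ^ 2 + 2 * ((∑ i, (f i : ℤ)) * ∑ i, (g i : ℤ)) ∧
    (∑ i, (t i : ℤ) * ∑ j, (t j : ℤ) * ∑ k, (t k : ℤ) *
        (entry (joinRel α β) i j * entry (joinRel α β) j k * entry (joinRel α β) k i)) =
      ∑ i, (f i : ℤ) ^ 3 + ∑ i, (g i : ℤ) ^ 3 + 3 * ((∑ i, (f i : ℤ) ^ 2) * ∑ i, (g i : ℤ)) +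
        3 * ((∑ i, (f i : ℤ)) * ∑ i, (g i : ℤ) ^ 2) := by
  subst ht
  constructor
  · simp [entry, joinRel, mul_add, sum_add_distrib, ← sum_mul]
    simp only [pow_two]
    ring
  · simp [entry, joinRel, mul_add, sum_add_distrib, ← sum_mul]
    rw [sum_mul_mul_self (fun i => (f i : ℤ)), sum_mul_mul_self (fun i => (g i : ℤ)),
      sum_mul_self_mul (fun i => (f i : ℤ)), sum_mul_self_mul (fun i => (g i : ℤ))]
    simp only [pow_succ, pow_zero, one_mul, mul_assoc]
    ring

instance (α : Type*) [DecidableEq α] : DecidableRel (crownRel α)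
  | .inl i, .inl j => inferInstanceAs (Decidable (i = j))
  | .inl i, .inr (.inl j) => inferInstanceAs (Decidable (i ≠ j))
  | .inl _, .inr (.inr _) => isTrue trivial
  | .inr (.inl i), .inl j => inferInstanceAs (Decidable (i ≠ j))
  | .inr (.inl i), .inr (.inl j) => inferInstanceAs (Decidable (i = j))
  | .inr (.inl _), .inr (.inr _) => isFalse id
  | .inr (.inr _), .inl _ => isTrue trivial
  | .inr (.inr _), .inr (.inl _) => isFalse id
  | .inr (.inr _), .inr (.inr _) => isTrue trivial

instance {α β : Type*} [DecidableEq α] [DecidableEq β] (N : α → β → Prop) [DecidableRel N] :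
    DecidableRel (bipRel N)
  | .inl i, .inl j => inferInstanceAs (Decidable (i = j))
  | .inl i, .inr j => inferInstanceAs (Decidable (N i j))
  | .inr i, .inl j => inferInstanceAs (Decidable (N j i))
  | .inr i, .inr j => inferInstanceAs (Decidable (i = j))

/-- The second and third trace for the crown pattern. -/
theorem sum_crownRel (N y : ℕ) (t : Fin N ⊕ Fin N ⊕ Unit → ℕ)
    (ht : t = Sum.elim (fun _ => 1) (Sum.elim (fun _ => 1) fun _ => y)) :
    (∑ i, (t i : ℤ) * ∑ j, (t j : ℤ) *
        (entry (crownRel (Fin N)) i j * entry (crownRel (Fin N)) j i)) =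
      2 * N ^ 2 + 2 * N * y + y ^ 2 ∧
    (∑ i, (t i : ℤ) * ∑ j, (t j : ℤ) * ∑ k, (t k : ℤ) *
        (entry (crownRel (Fin N)) i j * entry (crownRel (Fin N)) j k *
          entry (crownRel (Fin N)) k i)) =
      2 * N + 6 * N * (N - 1) + 3 * N * y + 3 * N * y ^ 2 + y ^ 3 := by
  subst ht
  -- adjacency in the two completely joined parts is `J - 1`
  have h1 : ∀ i j : Fin N, entry (crownRel (Fin N)) (.inl i) (.inl j) = if i = j then 1 else 0 :=
    fun _ _ => rfl
  have h2 : ∀ i j : Fin N, entry (crownRel (Fin N)) (.inr (.inl i)) (.inr (.inl j)) =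
      if i = j then 1 else 0 := fun _ _ => rfl
  have h3 : ∀ i j : Fin N, entry (crownRel (Fin N)) (.inl i) (.inr (.inl j)) =
      1 - if i = j then 1 else 0 := by
    intro i j
    by_cases h : i = j <;> simp [entry, crownRel, h]
  have h4 : ∀ i j : Fin N, entry (crownRel (Fin N)) (.inr (.inl i)) (.inl j) =
      1 - if i = j then 1 else 0 := by
    intro i j
    by_cases h : i = j <;> simp [entry, crownRel, h]
  have h5 : ∀ i : Fin N, entry (crownRel (Fin N)) (.inl i) (.inr (.inr ())) = 1 := fun _ => rfl
  have h6 : ∀ i : Fin N, entry (crownRel (Fin N)) (.inr (.inr ())) (.inl i) = 1 := fun _ => rfl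
  have h7 : ∀ i : Fin N, entry (crownRel (Fin N)) (.inr (.inl i)) (.inr (.inr ())) = 0 :=
    fun _ => rfl
  have h8 : ∀ i : Fin N, entry (crownRel (Fin N)) (.inr (.inr ())) (.inr (.inl i)) = 0 :=
    fun _ => rfl
  have h9 : entry (crownRel (Fin N)) (.inr (.inr ())) (.inr (.inr ())) = 1 := rfl
  constructor
  · simp [h1, h2, h3, h4, h5, h6, h7, h8, h9, mul_sub, sum_sub_distrib, sum_add_distrib, mul_add]
    ring
  · simp [h1, h2, h3, h4, h5, h6, h7, h8, h9, mul_sub, sub_mul, sum_sub_distrib, sum_add_distrib,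
      mul_add]
    ring

theorem sum_hubRel (t : Option (Fin 4) ⊕ Option (Fin 4) → ℕ) (ht : t = fun _ => 1) :
    (∑ i, (t i : ℤ) * ∑ j, (t j : ℤ) * (entry (bipRel hubRel) i j * entry (bipRel hubRel) j i)) =
      36 ∧
    (∑ i, (t i : ℤ) * ∑ j, (t j : ℤ) * ∑ k, (t k : ℤ) * (entry (bipRel hubRel) i j *
      entry (bipRel hubRel) j k * entry (bipRel hubRel) k i)) = 88 := by
  subst ht; decide +kernel

theorem sum_blockRel (t : (Fin 3 × Bool) ⊕ (Fin 3 × Bool) → ℕ) (ht : t = fun _ => 1) :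
    (∑ i, (t i : ℤ) * ∑ j, (t j : ℤ) *
      (entry (bipRel blockRel) i j * entry (bipRel blockRel) j i)) = 54 ∧
    (∑ i, (t i : ℤ) * ∑ j, (t j : ℤ) * ∑ k, (t k : ℤ) * (entry (bipRel blockRel) i j *
      entry (bipRel blockRel) j k * entry (bipRel blockRel) k i)) = 138 := by
  subst ht; decide +kernel

end SimpleGraph

/-! ### The list of graphs and their invariants -/

namespace SimpleGraph

open Finset Matrix

/-- The parameters of the graphs in the classification. -/
inductive Shape
  /-- The join of `p` disjoint copies of `K₂` with `q` disjoint copies of `K₂`. -/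
  | doubled (p q : ℕ)
  /-- The join of `K_l` with `k` disjoint copies of `K₂`. -/
  | fan (l k : ℕ)
  /-- The join of `K_c` with the disjoint union of `K₁` and `K_b`. -/
  | path (c b : ℕ)
  /-- The complete bipartite graph `K_{N,N}` without a perfect matching, and a clique on `y`
  vertices joined to one of its two parts. -/
  | crown (N y : ℕ)
  /-- The bipartite graph on ten vertices described at `hubRel`. -/
  | hub
  /-- The bipartite graph on twelve vertices described at `blockRel`. -/
  | block

namespace Shape

/-- The graphs of a given shape. -/
def Realizes {V : Type*} [Fintype V] (G : SimpleGraph V) : Shape → Prop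
  | doubled p q => G.IsBlowup (joinRel (Fin p) (Fin q)) (Sum.elim (fun _ => 2) fun _ => 2)
  | fan l k => G.IsBlowup (joinRel (Fin 1) (Fin k)) (Sum.elim (fun _ => l) fun _ => 2)
  | path c b => G.IsBlowup (joinRel (Fin 1) (Fin 2)) (Sum.elim (fun _ => c) ![1, b])
  | crown N y => G.IsBlowup (crownRel (Fin N))
      (Sum.elim (fun _ => 1) (Sum.elim (fun _ => 1) fun _ => y))
  | hub => G.IsBlowup (bipRel hubRel) fun _ => 1
  | block => G.IsBlowup (bipRel blockRel) fun _ => 1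

/-- The parameters that occur. The symmetry of `doubled` and its overlap `doubled 1 k` with
`fan 2 k` are removed. -/
def Valid : Shape → Prop
  | doubled p q => 1 ≤ p ∧ p ≤ q
  | fan l k => 1 ≤ l ∧ 1 ≤ k ∧ l ≠ 2
  | path c b => (c = 3 ∧ b = 8) ∨ (c = 4 ∧ b = 6) ∨ (c = 6 ∧ b = 5)
  | crown N y => (3 ≤ N ∧ y = 0) ∨ (N = 4 ∧ y = 4) ∨ (N = 5 ∧ y = 3)
  | hub => True
  | block => True

/-- The number of vertices. -/
def order : Shape → ℤ
  | doubled p q => 2 * p + 2 * q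
  | fan l k => l + 2 * k
  | path c b => c + 1 + b
  | crown N y => 2 * N + y
  | hub => 10
  | block => 12

/-- The trace of `(A + 1) ^ 2`. -/
def second : Shape → ℤ
  | doubled p q => 4 * p + 4 * q + 8 * p * q
  | fan l k => l ^ 2 + 4 * k + 4 * k * l
  | path c b => c ^ 2 + 1 + b ^ 2 + 2 * c * (1 + b)
  | crown N y => 2 * N ^ 2 + 2 * N * y + y ^ 2
  | hub => 36
  | block => 54

/-- The trace of `(A + 1) ^ 3`. -/
def third : Shape → ℤ
  | doubled p q => 8 * p + 8 * q + 48 * p * q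
  | fan l k => l ^ 3 + 8 * k + 6 * l ^ 2 * k + 12 * l * k
  | path c b => c ^ 3 + 1 + b ^ 3 + 3 * c ^ 2 * (1 + b) + 3 * c * (1 + b ^ 2)
  | crown N y => 2 * N + 6 * N * (N - 1) + 3 * N * y + 3 * N * y ^ 2 + y ^ 3
  | hub => 88
  | block => 138

theorem Realizes.nonempty_iso {V W : Type*} [Fintype V] [Fintype W] {G : SimpleGraph V}
    {H : SimpleGraph W} {s : Shape} (hG : s.Realizes G) (hH : s.Realizes H) :
    Nonempty (G ≃g H) := by
  cases s <;> exact IsBlowup.nonempty_iso hG hH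

theorem Realizes.trace_pow {V : Type*} [Fintype V] [DecidableEq V] {G : SimpleGraph V}
    [DecidableRel G.Adj] {s : Shape} (hG : s.Realizes G) :
    ((G.adjMatrix ℝ + 1) ^ 0).trace = (s.order : ℝ) ∧
    ((G.adjMatrix ℝ + 1) ^ 2).trace = (s.second : ℝ) ∧
    ((G.adjMatrix ℝ + 1) ^ 3).trace = (s.third : ℝ) := by
  cases s with
  | doubled p q =>
    obtain ⟨h0, h2, h3⟩ := IsBlowup.trace_pow hG fun i => .inl rfl
    obtain ⟨k2, k3⟩ := sum_joinRel (fun _ : Fin p => 2) (fun _ : Fin q => 2) _ rfl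
    rw [h0, h2, h3, k2, k3]
    refine ⟨?_, ?_, ?_⟩ <;> norm_cast <;> simp [order, second, third] <;> ring
  | fan l k =>
    obtain ⟨h0, h2, h3⟩ := IsBlowup.trace_pow hG fun i => .inl rfl
    obtain ⟨k2, k3⟩ := sum_joinRel (fun _ : Fin 1 => l) (fun _ : Fin k => 2) _ rfl
    rw [h0, h2, h3, k2, k3]
    refine ⟨?_, ?_, ?_⟩ <;> norm_cast <;> simp [order, second, third] <;> ring
  | path c b =>
    obtain ⟨h0, h2, h3⟩ := IsBlowup.trace_pow hG fun i => .inl rfl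
    obtain ⟨k2, k3⟩ := sum_joinRel (fun _ : Fin 1 => c) ![1, b] _ rfl
    rw [h0, h2, h3, k2, k3]
    refine ⟨?_, ?_, ?_⟩ <;> norm_cast <;> simp [order, second, third] <;> ring
  | crown N y =>
    obtain ⟨h0, h2, h3⟩ := IsBlowup.trace_pow hG (by rintro (i | i | i) <;> simp [crownRel])
    obtain ⟨k2, k3⟩ := sum_crownRel N y _ rfl
    rw [h0, h2, h3, k2, k3]
    refine ⟨?_, rfl, rfl⟩
    norm_cast
    simp [order]
    ring
  | hub =>
    obtain ⟨h0, h2, h3⟩ := IsBlowup.trace_pow hG (by rintro (i | i) <;> rfl)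
    obtain ⟨k2, k3⟩ := sum_hubRel _ rfl
    rw [h0, h2, h3, k2, k3]
    refine ⟨?_, rfl, rfl⟩
    simp [order]
  | block =>
    obtain ⟨h0, h2, h3⟩ := IsBlowup.trace_pow hG (by rintro (i | i) <;> rfl)
    obtain ⟨k2, k3⟩ := sum_blockRel _ rfl
    rw [h0, h2, h3, k2, k3]
    refine ⟨?_, rfl, rfl⟩
    simp [order]

/-- For the joins of two unions of `K₂` the invariants determine `p + q` and `p * q`. -/
theorem eq_of_doubled {p q : ℕ} {s : Shape} (h : (doubled p q).Valid) (hs : s.Valid)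
    (h0 : (doubled p q).order = s.order) (h2 : (doubled p q).second = s.second)
    (h3 : (doubled p q).third = s.third) : doubled p q = s := by
  obtain ⟨hp, hpq⟩ := h
  have key : ∀ m k : ℤ, (p : ℤ) + q = m → (p : ℤ) * q = k → m ≤ 6 →
      (m = 5 → k = 4 ∨ k = 6) ∧ (m = 6 → k = 5 ∨ k = 8 ∨ k = 9) := by
    rintro m k rfl rfl hm
    have hp6 : p ≤ 6 := by omega
    constructor <;> intro hm <;> interval_cases p <;> push_cast <;> omega
  have hm : ∀ n m : ℤ, 2 * (p : ℤ) + 2 * q = n → 4 * (p : ℤ) + 4 * q + 8 * p * q = m →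
      8 * ((p : ℤ) * q) = m - 2 * n := fun n m h h' => by rw [← h, ← h']; ring
  cases s with
  | doubled p' q' =>
    obtain ⟨hp', hpq'⟩ := hs
    simp only [order, second] at h0 h2
    have h : ((p : ℤ) - p') * (p - q') = 0 := by
      have := hm _ _ h0 h2
      apply mul_left_cancel₀ (by norm_num : (8 : ℤ) ≠ 0)
      linear_combination 4 * (p : ℤ) * h0 - this
    rcases mul_eq_zero.mp h with h | h <;> congr 1 <;> omega
  | fan l k =>
    obtain ⟨hl, hk, hl2⟩ := hs
    simp only [order, second, third] at h0 h2 h3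
    have h : (l : ℤ) * ((l - 2) * (l - 4 + 6 * k)) = 0 := by
      linear_combination 6 * h2 - h3 - 8 * h0
    rcases mul_eq_zero.mp h with h | h
    · omega
    · rcases mul_eq_zero.mp h with h | h <;> omega
  | path c b =>
    simp only [order, second] at h0 h2
    have := hm _ _ h0 h2
    have := key _ _ rfl rfl
    rcases hs with ⟨rfl, rfl⟩ | ⟨rfl, rfl⟩ | ⟨rfl, rfl⟩ <;> push_cast at * <;> omega
  | crown N y =>
    simp only [order, second, third] at h0 h2 h3
    have := hm _ _ h0 h2
    have := key _ _ rfl rfl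
    rcases hs with ⟨hN, rfl⟩ | ⟨rfl, rfl⟩ | ⟨rfl, rfl⟩
    · push_cast at h0 h2 h3
      have h : (N : ℤ) * (N - 2) = 0 := by
        apply mul_left_cancel₀ (by norm_num : (6 : ℤ) ≠ 0)
        linear_combination h3 - 6 * h2 + 8 * h0
      rcases mul_eq_zero.mp h with h | h <;> omega
    all_goals push_cast at *; omega
  | hub =>
    simp only [order, second] at h0 h2
    have := hm _ _ h0 h2
    have := key _ _ rfl rfl
    omega
  | block =>
    simp only [order, second] at h0 h2
    have := hm _ _ h0 h2
    have := key _ _ rfl rfl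
    omega

/-- For the joins of a clique with a union of `K₂` the invariants determine `k * (k - 1)`. -/
theorem eq_of_fan {l k : ℕ} {s : Shape} (h : (fan l k).Valid) (hs : s.Valid)
    (hd : ∀ p q, s ≠ doubled p q)
    (h0 : (fan l k).order = s.order) (h2 : (fan l k).second = s.second)
    (h3 : (fan l k).third = s.third) : fan l k = s := by
  obtain ⟨hl, hk, hl2⟩ := h
  have hm : ∀ n m : ℤ, (l : ℤ) + 2 * k = n → (l : ℤ) ^ 2 + 4 * k + 4 * k * l = m →
      4 * ((k : ℤ) * (k - 1)) = n ^ 2 - m := fun n m h h' => by rw [← h, ← h']; ring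
  have key : k ≤ 6 → (k : ℤ) * (k - 1) = 0 ∨ (k : ℤ) * (k - 1) = 2 ∨ (k : ℤ) * (k - 1) = 6 ∨
      (k : ℤ) * (k - 1) = 12 ∨ ((k : ℤ) * (k - 1) = 20 ∧ k = 5) ∨ (k : ℤ) * (k - 1) = 30 := by
    intro h
    interval_cases k <;> simp
  cases s with
  | doubled p q => exact absurd rfl (hd p q)
  | fan l' k' =>
    obtain ⟨hl', hk', -⟩ := hs
    simp only [order, second] at h0 h2
    have h : ((k : ℤ) - k') * (k + k' - 1) = 0 := by
      have := hm _ _ h0 h2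
      apply mul_left_cancel₀ (by norm_num : (4 : ℤ) ≠ 0)
      linear_combination this
    rcases mul_eq_zero.mp h with h | h <;> congr 1 <;> omega
  | path c b =>
    simp only [order, second] at h0 h2
    have := hm _ _ h0 h2
    rcases hs with ⟨rfl, rfl⟩ | ⟨rfl, rfl⟩ | ⟨rfl, rfl⟩ <;> push_cast at * <;> omega
  | crown N y =>
    simp only [order, second, third] at h0 h2 h3
    have := hm _ _ h0 h2
    rcases hs with ⟨hN, rfl⟩ | ⟨rfl, rfl⟩ | ⟨rfl, rfl⟩
    · push_cast at h0 h2 h3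
      have h : (l : ℤ) * (l ^ 2 + 6 * l * k - 3 * l + 2) = 0 := by
        linear_combination h3 - 3 * h2 + 2 * h0
      have hl' : (1 : ℤ) ≤ l := by exact_mod_cast hl
      have hk' : (1 : ℤ) ≤ k := by exact_mod_cast hk
      rcases mul_eq_zero.mp h with h | h
      · omega
      · nlinarith
    · push_cast at *; omega
    · push_cast at h0 h2 h3 this
      have hk5 : k = 5 := by omega
      have hl3 : l = 3 := by omega
      subst hk5 hl3
      norm_num at h3
  | hub =>
    simp only [order, second] at h0 h2
    have := hm _ _ h0 h2
    omega
  | block =>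
    simp only [order, second] at h0 h2
    have := hm _ _ h0 h2
    omega

/-- The first two invariants distinguish the shapes with parameters other than `doubled` and
`fan`. -/
theorem eq_of_sporadic {s s' : Shape} (hd : ∀ p q, s ≠ doubled p q ∧ s' ≠ doubled p q)
    (hf : ∀ l k, s ≠ fan l k ∧ s' ≠ fan l k) (hs : s.Valid) (hs' : s'.Valid)
    (h0 : s.order = s'.order) (h2 : s.second = s'.second) : s = s' := by
  have key : ∀ {s : Shape}, (∀ p q, s ≠ doubled p q) → (∀ l k, s ≠ fan l k) → s.Valid →
      s = path 3 8 ∨ s = path 4 6 ∨ s = path 6 5 ∨ (∃ N, 3 ≤ N ∧ s = crown N 0) ∨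
      s = crown 4 4 ∨ s = crown 5 3 ∨ s = hub ∨ s = block := by
    intro s hd hf hs
    cases s with
    | doubled p q => exact absurd rfl (hd p q)
    | fan l k => exact absurd rfl (hf l k)
    | path c b => rcases hs with ⟨rfl, rfl⟩ | ⟨rfl, rfl⟩ | ⟨rfl, rfl⟩ <;> simp
    | crown N y => rcases hs with ⟨hN, rfl⟩ | ⟨rfl, rfl⟩ | ⟨rfl, rfl⟩ <;> simp [*]
    | hub => simp
    | block => simp
  rcases key (fun p q => (hd p q).1) (fun l k => (hf l k).1) hs with
    rfl | rfl | rfl | ⟨N, hN, rfl⟩ | rfl | rfl | rfl | rfl <;>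
  rcases key (fun p q => (hd p q).2) (fun l k => (hf l k).2) hs' with
    rfl | rfl | rfl | ⟨N', hN', rfl⟩ | rfl | rfl | rfl | rfl <;>
  first
  | rfl
  | (simp only [order, second] at h0 h2
     push_cast at h0 h2 <;>
     first
     | omega
     | (congr 1; omega)
     | (have : N = 5 ∨ N = 6 := by omega
        rcases this with rfl | rfl <;> omega)
     | (have : N' = 5 ∨ N' = 6 := by omega
        rcases this with rfl | rfl <;> omega))

/-- The three traces determine the shape. -/
theorem eq_of_invariants {s s' : Shape} (hs : s.Valid) (hs' : s'.Valid) (h0 : s.order = s'.order)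
    (h2 : s.second = s'.second) (h3 : s.third = s'.third) : s = s' := by
  by_cases h : ∃ p q, s = doubled p q
  · obtain ⟨p, q, rfl⟩ := h
    exact eq_of_doubled hs hs' h0 h2 h3
  by_cases h' : ∃ p q, s' = doubled p q
  · obtain ⟨p, q, rfl⟩ := h'
    exact (eq_of_doubled hs' hs h0.symm h2.symm h3.symm).symm
  push Not at h h'
  by_cases k : ∃ l k, s = fan l k
  · obtain ⟨l, k, rfl⟩ := k
    exact eq_of_fan hs hs' h' h0 h2 h3
  by_cases k' : ∃ l k, s' = fan l k
  · obtain ⟨l, k, rfl⟩ := k'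
    exact (eq_of_fan hs' hs h h0.symm h2.symm h3.symm).symm
  push Not at k k'
  exact eq_of_sporadic (fun p q => ⟨h p q, h' p q⟩) (fun l j => ⟨k l j, k' l j⟩) hs hs' h0 h2

end Shape

variable {V : Type*} [Fintype V] [DecidableEq V] {G : SimpleGraph V} [DecidableRel G.Adj]

theorem Shape.exists_doubled {p q : ℕ} (hp : 1 ≤ p) (hq : 1 ≤ q)
    (h : (Shape.doubled p q).Realizes G) : ∃ s : Shape, s.Valid ∧ s.Realizes G := by
  rcases le_total p q with hpq | hpq
  · exact ⟨.doubled p q, ⟨hp, hpq⟩, h⟩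
  · refine ⟨.doubled q p, ⟨hq, hpq⟩, IsBlowup.congr h (Equiv.sumComm _ _) ?_ ?_⟩
    · rintro (i | i) (j | j) <;> simp [joinRel]
    · rintro (i | i) <;> rfl

/-- The classification of the graphs whose adjacency matrix has one eigenvalue greater than `1`, one
eigenvalue less than `-1`, and no others besides `1` and `-1`. -/
theorem PlanarSpectrum.exists_shape (H : G.PlanarSpectrum) :
    ∃ s : Shape, s.Valid ∧ s.Realizes G := by
  by_cases hB : ∀ a u c w b, ¬ G.Fork a u c w b
  · rcases H.join_isBlowup hB with ⟨p, q, hp, hq, h⟩ | ⟨l, k, hl, hk, h⟩ | ⟨c, b, hcb, h⟩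
    · refine Shape.exists_doubled hp hq (IsBlowup.congr h (Equiv.refl _) (fun _ _ => Iff.rfl) ?_)
      rintro (i | i) <;> rfl
    · by_cases hl2 : l = 2
      · subst hl2
        exact Shape.exists_doubled le_rfl hk h
      · exact ⟨.fan l k, ⟨hl, hk, hl2⟩, h⟩
    · exact ⟨.path c b, hcb, h⟩
  · push Not at hB
    obtain ⟨a, u, c, w, b, hF⟩ := hB
    rcases (H.frame_of_fork hF).isBlowup H with ⟨N, y, hN, h⟩ | h | h
    · exact ⟨.crown N y, hN, h⟩
    · exact ⟨.hub, trivial, h⟩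
    · exact ⟨.block, trivial, h⟩

/-- Cospectral graphs have the same traces of powers of `A + 1`. -/
theorem Cospectral.trace_pow {W : Type*} [Fintype W] [DecidableEq W] {H : SimpleGraph W}
    [DecidableRel H.Adj] (h : G.Cospectral H) (k : ℕ) :
    ((G.adjMatrix ℝ + 1) ^ k).trace = ((H.adjMatrix ℝ + 1) ^ k).trace := by
  rw [trace_add_one_pow _ G.isSymm_adjMatrix, trace_add_one_pow _ H.isSymm_adjMatrix]
  exact congrArg (fun s : Multiset ℝ => (s.map fun x => (x + 1) ^ k).sum) h

end SimpleGraph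

theorem mainTheorem2 {V W : Type*} [Fintype V] [DecidableEq V] [Fintype W] [DecidableEq W]
    (G : SimpleGraph V) [DecidableRel G.Adj] (H : SimpleGraph W) [DecidableRel H.Adj]
    (hG : G.InClassG) (hH : H.InClassG) (hGH : ¬ Nonempty (G ≃g H)) :
    ¬ G.Cospectral H := by
  intro h
  obtain ⟨s, hs, hsG⟩ := hG.planarSpectrum.exists_shape
  obtain ⟨s', hs', hsH⟩ := hH.planarSpectrum.exists_shape
  obtain ⟨k0, k2, k3⟩ := hsG.trace_pow
  obtain ⟨l0, l2, l3⟩ := hsH.trace_pow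
  rw [h.trace_pow] at k0 k2 k3
  have : s = s' := SimpleGraph.Shape.eq_of_invariants hs hs'
    (by exact_mod_cast k0.symm.trans l0) (by exact_mod_cast k2.symm.trans l2)
    (by exact_mod_cast k3.symm.trans l3)
  subst this
  exact hGH (hsG.nonempty_iso hsH)
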